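/- Let the cake be the unit interval $[0,1]$; a piece is a finite union of intervals of $[0,1]$. There are $n$ agents, the vertices of a graph $G$. Agent $i$ has a valuation $v_i$ of pieces that is non-negative, additive ($v_i(A\cup B)=v_i(A)+v_i(B)$ for disjoint pieces $A,B$), non-atomic (for all $0\le x\le y\le 1$ and $\lambda\in[0,1]$ there is $y'\in[x,y]$ with $v_i([x,y'])=\lambda\, v_i([x,y])$) and normalized ($v_i([0,1])=1$). An allocation is a family $(A_1,\dots,A_n)$ of pairwise disjoint pieces with $\bigcup_i A_i=[0,1]$; it is locally envy-free on $G$ if $v_i(A_i)\ge v_i(A_j)$ for every edge $\{i,j\}$ of $G$ (both ways round). A discrete protocol in the Robertson–Webb model knows $n$ and $G$ and accesses the valuations only by adaptively asking finitely many queries, after which it outputs bundles. A query is either $\mathrm{eval}_i(x,y)$, $0\le x<y\le 1$, answered by $v_i([x,y])$, or $\mathrm{cut}_i(x,\tau)$, $x,\tau\in[0,1]$, answered by some $y\in[x,1]$ with $v_i([x,y])=\tau$ (any such $y$), or by a fixed garbage value if no such $y$ exists. **Theorem.** There are a discrete protocol in the Robertson–Webb model and a function $\varepsilon:\mathbb{N}\to\mathbb{R}$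 with $\varepsilon(n)\to 0$ as $n\to\infty$ such that for every $n$, every tree $G$ on the $n$ agents and all valuations $v_1,\dots,v_n$ as above, the protocol, on any truthful answers, outputs a locally envy-free allocation of $[0,1]$ on $G$ after at most $n^{(1+\varepsilon(n))n}$ queries (cut and eval queries counted together). -/

import Mathlib

namespace CakeCutting

/-- The cake `[0, 1]`. -/
abbrev Cake : Type := unitInterval

/-- A piece (bundle): a finite union of intervals of the cake. Order-connected subsets of `[0, 1]`
are exactly its intervals (open, closed or half-open, degenerate or empty). -/
def IsPiece (A : Set Cake) : Prop :=
  ∃ S : Set (Set Cake), S.Finite ∧ (∀ I ∈ S, I.OrdConnected) ∧ ⋃₀ S = A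

/-- The valuation of an agent: a non-negative, additive, non-atomic (divisible) and normalized
function of pieces of the cake. Values at sets that are not pieces play no role. -/
structure AgentValuation where
  value : Set Cake → ℝ
  nonneg : ∀ A, IsPiece A → 0 ≤ value A
  additive : ∀ A B, IsPiece A → IsPiece B → Disjoint A B → value (A ∪ B) = value A + value B
  divisible : ∀ x y : Cake, x ≤ y → ∀ t : ℝ, 0 ≤ t → t ≤ 1 →
    ∃ y' : Cake, x ≤ y' ∧ y' ≤ y ∧ value (Set.Icc x y') = t * value (Set.Icc x y)
  normalized : value Set.univ = 1

/-- A (complete) allocation: pairwise disjoint pieces, one for each agent, covering the cake. -/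
def IsAllocation {n : ℕ} (A : Fin n → Set Cake) : Prop :=
  (∀ i, IsPiece (A i)) ∧ (∀ i j, i ≠ j → Disjoint (A i) (A j)) ∧ ⋃ i, A i = Set.univ

/-- No agent values the bundle of a neighbour in `G` more than her own bundle. -/
def LocallyEnvyFree {n : ℕ} (G : SimpleGraph (Fin n)) (v : Fin n → AgentValuation)
    (A : Fin n → Set Cake) : Prop :=
  ∀ i j, G.Adj i j → (v i).value (A j) ≤ (v i).value (A i)

/-- A discrete protocol for `n` agents in the Robertson-Webb model: an adaptive query tree. It either
stops with an output, or asks agent `i` an evaluation query or a cut query and continues in a way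
that depends on the answer. The tree is well-founded, so every branch is finite. -/
inductive Protocol (n : ℕ) : Type
  | output (A : Fin n → Set Cake) : Protocol n
  | eval (i : Fin n) (x y : Cake) (hxy : x < y) (next : ℝ → Protocol n) : Protocol n
  | cut (i : Fin n) (x τ : Cake) (next : Option Cake → Protocol n) : Protocol n

/-- Truthful answers to the query `cut (x, τ)`: any point `y` such that `[x, y]` has value `τ`, or
the fixed value `none` if there is no such point. -/
def IsCutAnswer (v : AgentValuation) (x τ : Cake) : Option Cake → Prop
  | some y => x ≤ y ∧ v.value (Set.Icc x y) = (τ : ℝ)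
  | none => ∀ y : Cake, x ≤ y → v.value (Set.Icc x y) ≠ (τ : ℝ)

/-- `Run v P q A`: on some sequence of truthful answers of agents with valuations `v`, the protocol
`P` stops after exactly `q` queries (of both types together) and outputs `A`. -/
inductive Run {n : ℕ} (v : Fin n → AgentValuation) :
    Protocol n → ℕ → (Fin n → Set Cake) → Prop
  | output (A : Fin n → Set Cake) : Run v (Protocol.output A) 0 A
  | eval (i : Fin n) (x y : Cake) (hxy : x < y) (next : ℝ → Protocol n) (q : ℕ)
      (A : Fin n → Set Cake) (h : Run v (next ((v i).value (Set.Icc x y))) q A) :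
      Run v (Protocol.eval i x y hxy next) (q + 1) A
  | cut (i : Fin n) (x τ : Cake) (next : Option Cake → Protocol n) (r : Option Cake) (q : ℕ)
      (A : Fin n → Set Cake) (hr : IsCutAnswer (v i) x τ r) (h : Run v (next r) q A) :
      Run v (Protocol.cut i x τ next) (q + 1) A

/-- Truthful answers always exist, so every protocol has a run on every valuation profile. -/
theorem exists_run {n : ℕ} (v : Fin n → AgentValuation) (P : Protocol n) :
    ∃ (q : ℕ) (A : Fin n → Set Cake), Run v P q A := by
  induction P with
  | output A => exact ⟨0, A, Run.output A⟩
  | eval i x y hxy next ih =>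
    obtain ⟨q, A, h⟩ := ih ((v i).value (Set.Icc x y))
    exact ⟨q + 1, A, Run.eval i x y hxy next q A h⟩
  | cut i x τ next ih =>
    have hr : ∃ r, IsCutAnswer (v i) x τ r := by
      by_cases h : ∃ y : Cake, x ≤ y ∧ (v i).value (Set.Icc x y) = (τ : ℝ)
      · obtain ⟨y, hy⟩ := h
        exact ⟨some y, hy⟩
      · exact ⟨none, fun y hxy he => h ⟨y, hxy, he⟩⟩
    obtain ⟨r, hr⟩ := hr
    obtain ⟨q, A, h⟩ := ih r
    exact ⟨q + 1, A, Run.cut i x τ next r q A hr h⟩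

end CakeCutting

namespace CakeCutting

open Set

/-! ### Pieces and valuations -/

/-! What a protocol knows is the set of profiles consistent with the answers so far. `Reach`
describes strategies in these terms: one step is a cut query followed by evaluations by all agents,
so that every set made of evaluated cells has a known value for everyone, and a strategy with `c`
steps becomes a protocol with at most `c * (n + 1)` queries (`Reach.exists_protocol`).

The engine is `reach_core`: given `k` agents and `k` nested families of pieces, an envy-free
assignment of trimmed pieces is found in `k! * k ^ 3` steps. Existence is `exists_ef_graph`: if the
total length of an envy-free trimming is maximal, then every piece is linked to an untrimmed one by
a chain of indifferences. Given the assignment, `k` rounds in the manner of a shortest path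
computation find the positions: every piece is cut back to the least mark at which some agent other
than its owner would be as content as with her own piece. All `k!` assignments are tried. This
factorial produces `n ^ n`; all other factors are polynomial.

The second ingredient is `reach_win`: some agent `i` gets such an advantage over a neighbour `j`
that `j` could receive the whole residue without being envied by `i`. Polynomially many envy-free
partial allocations are made with the same cutter, and the residue is shrunk until every difference
between bundles is either negligible or at least three residues (`reach_gap`). The fair share of the
cutter forces a significant difference in each round. By a counting argument (`card_tight_le`), the
bundles of each round can be permuted without significant loss to anyone such that, whatever
assignment `m` of slots to agents is used later, in some round some agent finds her own bundle or
that of a neighbour significantly worse (`exists_permutations`). The resulting slots are only nearly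
envy-free. They are repaired by `reach_core` after padding with crumbs of the residue whose values
decrease geometrically, so that only crumbs are trimmed (`bundle_subset_of_crumbs`). An agent never
ends up significantly worse off herself, so the significant difference concerns a neighbour, and it
outweighs all crumbs and the residue.

Finally, the edge between `i` and `j` is removed from the tree and the residue is allocated
recursively within the branch of `j` (`reach_allocation`). At most `n - 1` advantages are needed,
each at a cost of at most `n! * n ^ 22` steps. -/

theorem isPiece_of_ordConnected {I : Set Cake} (h : I.OrdConnected) : IsPiece I :=
  ⟨{I}, Set.finite_singleton I, by simpa using h, by simp⟩

theorem isPiece_empty : IsPiece ∅ := isPiece_of_ordConnected Set.ordConnected_empty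

theorem IsPiece.union {A B : Set Cake} (hA : IsPiece A) (hB : IsPiece B) : IsPiece (A ∪ B) := by
  obtain ⟨S, hS, hS', rfl⟩ := hA
  obtain ⟨T, hT, hT', rfl⟩ := hB
  refine ⟨S ∪ T, hS.union hT, ?_, Set.sUnion_union S T⟩
  rintro I (h | h)
  exacts [hS' I h, hT' I h]

namespace AgentValuation

variable (v : AgentValuation)

theorem value_empty : v.value ∅ = 0 := by
  have := v.additive ∅ ∅ isPiece_empty isPiece_empty (by simp)
  simp at this
  exact this

theorem value_singleton (x : Cake) : v.value {x} = 0 := by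
  obtain ⟨y, h1, h2, h3⟩ := v.divisible x x le_rfl 0 le_rfl zero_le_one
  have : y = x := le_antisymm h2 h1
  subst this
  simpa using h3

/-- The value of the initial segment `[0, x]`. -/
def cdf (x : Cake) : ℝ := v.value (Icc 0 x)

theorem cdf_zero : v.cdf 0 = 0 := by
  simpa [cdf] using v.value_singleton 0

theorem cdf_one : v.cdf 1 = 1 := by
  have : (Icc 0 1 : Set Cake) = univ := by
    ext x; simp [unitInterval.le_one']
  rw [cdf, this, v.normalized]

theorem value_Iio (x : Cake) : v.value (Iio x) = v.cdf x := by
  have h : (Icc 0 x : Set Cake) = Iio x ∪ {x} := by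
    ext y
    have : (0 : Cake) ≤ y := unitInterval.nonneg'
    simp only [mem_Icc, mem_union, mem_Iio, mem_singleton_iff, this, true_and, le_iff_lt_or_eq]
  rw [cdf, h, v.additive _ _ (isPiece_of_ordConnected Set.ordConnected_Iio)
    (isPiece_of_ordConnected Set.ordConnected_singleton) (by simp), v.value_singleton, add_zero]

theorem value_Ico {x y : Cake} (h : x ≤ y) : v.value (Ico x y) = v.cdf y - v.cdf x := by
  have := v.additive (Iio x) (Ico x y) (isPiece_of_ordConnected Set.ordConnected_Iio)
    (isPiece_of_ordConnected Set.ordConnected_Ico)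
    (Set.disjoint_left.2 fun z hz hz' => absurd hz'.1 (not_le.2 hz))
  rw [Set.Iio_union_Ico_eq_Iio h, value_Iio, value_Iio] at this
  linarith

theorem cdf_mono : Monotone v.cdf := fun x y h => by
  have := v.nonneg (Ico x y) (isPiece_of_ordConnected Set.ordConnected_Ico)
  rw [v.value_Ico h] at this
  linarith

theorem exists_cdf_eq (t : Cake) : ∃ y, v.cdf y = t := by
  obtain ⟨y, -, -, h⟩ := v.divisible 0 1 unitInterval.nonneg' t t.2.1 t.2.2
  refine ⟨y, ?_⟩
  have h1 := v.cdf_one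
  rw [cdf] at h1
  rw [cdf, h, h1, mul_one]

end AgentValuation

/-- `X` is a union of cells cut out by the finite set of points `E`. -/
def Adapted (E : Finset Cake) (X : Set Cake) : Prop :=
  ∀ x y, x ≤ y → (∀ e ∈ E, x < e → ¬ e ≤ y) → (x ∈ X ↔ y ∈ X)

/-- `X` agrees below `a` with a union of cells cut out by the finite set of points `E`. -/
def AdaptedBelow (E : Finset Cake) (a : Cake) (X : Set Cake) : Prop :=
  ∀ x y, x ≤ y → y < a → (∀ e ∈ E, x < e → ¬ e ≤ y) → (x ∈ X ↔ y ∈ X)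

theorem Adapted.mono {E E' : Finset Cake} {X : Set Cake} (h : Adapted E X) (hE : E ⊆ E') :
    Adapted E' X := fun x y hxy he => h x y hxy fun e h' => he e (hE h')

theorem Adapted.compl {E : Finset Cake} {X : Set Cake} (h : Adapted E X) : Adapted E Xᶜ :=
  fun x y hxy he => not_congr (h x y hxy he)

theorem Adapted.union {E : Finset Cake} {X Y : Set Cake} (h : Adapted E X) (h' : Adapted E Y) :
    Adapted E (X ∪ Y) := fun x y hxy he => or_congr (h x y hxy he) (h' x y hxy he)

theorem Adapted.inter {E : Finset Cake} {X Y : Set Cake} (h : Adapted E X) (h' : Adapted E Y) :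
    Adapted E (X ∩ Y) := fun x y hxy he => and_congr (h x y hxy he) (h' x y hxy he)

theorem adapted_empty (E : Finset Cake) : Adapted E ∅ := fun _ _ _ _ => Iff.rfl

theorem adapted_univ (E : Finset Cake) : Adapted E univ := fun _ _ _ _ => by simp

theorem adapted_Iio {E : Finset Cake} {e : Cake} (he : e ∈ E) : Adapted E (Iio e) := by
  intro x y hxy h
  refine ⟨fun hx => ?_, fun hy => lt_of_le_of_lt hxy hy⟩
  exact not_le.1 (h e he hx)

theorem Adapted.below {E : Finset Cake} {X : Set Cake} (h : Adapted E X) (a : Cake) :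
    AdaptedBelow E a X := fun x y hxy _ he => h x y hxy he

/-- Induction over the cells of a set. -/
theorem AdaptedBelow.induction (p : Set Cake → Prop) (a0 : p ∅) (Q : Cake → Prop)
    (h1 : ∀ a, Q a → p (Iio a)) (h2 : ∀ a b, a ≤ b → Q a → Q b → p (Ico a b))
    (h3 : ∀ X Y, p X → p Y → Disjoint X Y → p (X ∪ Y)) :
    ∀ (E : Finset Cake), (∀ e ∈ E, Q e) → ∀ a, (∀ e ∈ E, e ≤ a) → Q a →
      ∀ X, AdaptedBelow E a X → p (X ∩ Iio a) := by
  intro E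
  induction E using Finset.induction_on_max with
  | empty =>
    intro _ a _ ha X hX
    by_cases h : ∃ x, x ∈ X ∩ Iio a
    · obtain ⟨x, hx, hxa⟩ := h
      have : X ∩ Iio a = Iio a := by
        ext y
        refine ⟨fun h => h.2, fun hy => ⟨?_, hy⟩⟩
        rcases le_total x y with hxy | hxy
        · exact (hX x y hxy hy (by simp)).1 hx
        · exact (hX y x hxy hxa (by simp)).2 hx
      rw [this]; exact h1 a ha
    · have : X ∩ Iio a = ∅ := by
        ext y; simp only [Set.mem_empty_iff_false, iff_false]; exact fun hy => h ⟨y, hy⟩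
      rw [this]; exact a0
  | insert b E hb ih =>
    intro hE a hE' ha X hX
    have hba : b ≤ a := hE' b (by simp)
    have hQb : Q b := hE b (by simp)
    -- The largest boundary point `b` splits off the last cell `[b, a)`, which `X` contains or
    -- misses as a whole.
    have e1 : X ∩ Iio a = (X ∩ Iio b) ∪ (X ∩ Ico b a) := by
      rw [← Set.inter_union_distrib_left, Set.Iio_union_Ico_eq_Iio hba]
    rw [e1]
    apply h3
    · apply ih (fun e he => hE e (by simp [he])) b (fun e he => (hb e he).le) hQb
      intro x y hxy hyb he
      refine hX x y hxy (lt_of_lt_of_le hyb hba) ?_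
      intro e he' hxe
      rcases Finset.mem_insert.1 he' with rfl | he'
      · exact not_le.2 hyb
      · exact he e he' hxe
    · by_cases h : ∃ x, x ∈ X ∩ Ico b a
      · obtain ⟨x, hx, hxa⟩ := h
        have key : ∀ x y, x ∈ Ico b a → y ∈ Ico b a → x ≤ y → (x ∈ X ↔ y ∈ X) := by
          intro x y hx hy hxy
          refine hX x y hxy hy.2 ?_
          intro e he hxe
          have : e ≤ b := by
            rcases Finset.mem_insert.1 he with rfl | he'
            exacts [le_rfl, (hb e he').le]
          exact absurd (lt_of_le_of_lt hx.1 hxe) (not_lt.2 this)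
        have : X ∩ Ico b a = Ico b a := by
          ext y
          refine ⟨fun h => h.2, fun hy => ⟨?_, hy⟩⟩
          rcases le_total x y with hxy | hxy
          · exact (key x y hxa hy hxy).1 hx
          · exact (key y x hy hxa hxy).2 hx
        rw [this]; exact h2 b a hba hQb ha
      · have : X ∩ Ico b a = ∅ := by
          ext y; simp only [Set.mem_empty_iff_false, iff_false]; exact fun hy => h ⟨y, hy⟩
        rw [this]; exact a0
    · refine Set.disjoint_left.2 ?_
      rintro x ⟨_, hx⟩ ⟨_, hx'⟩
      exact absurd hx'.1 (not_le.2 hx)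

/-- Half-open cells leave out the right end of the cake, which is treated apart; as a single point
it has no value. -/
theorem inter_Iio_one_union (X : Set Cake) : X = (X ∩ Iio 1) ∪ (X ∩ {1}) := by
  rw [← Set.inter_union_distrib_left]
  ext x
  simp only [Set.mem_inter_iff, Set.mem_union, Set.mem_Iio, Set.mem_singleton_iff]
  have : x < 1 ∨ x = 1 := lt_or_eq_of_le unitInterval.le_one'
  tauto

theorem isPiece_inter_singleton (X : Set Cake) (a : Cake) : IsPiece (X ∩ {a}) := by
  rcases Set.subset_singleton_iff_eq.1 (Set.inter_subset_right : X ∩ {a} ⊆ {a}) with h | h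
  · rw [h]; exact isPiece_empty
  · rw [h]; exact isPiece_of_ordConnected Set.ordConnected_singleton

theorem Adapted.isPiece {E : Finset Cake} {X : Set Cake} (h : Adapted E X) : IsPiece X := by
  rw [inter_Iio_one_union X]
  refine IsPiece.union ?_ (isPiece_inter_singleton X 1)
  exact AdaptedBelow.induction IsPiece isPiece_empty (fun _ => True)
    (fun a _ => isPiece_of_ordConnected Set.ordConnected_Iio)
    (fun a b _ _ _ => isPiece_of_ordConnected Set.ordConnected_Ico)
    (fun X Y hX hY _ => hX.union hY) E (by simp) 1 (fun e _ => unitInterval.le_one') trivial X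
    (h.below 1)

theorem AgentValuation.value_inter_Iio_one (v : AgentValuation) {E : Finset Cake} {X : Set Cake}
    (h : Adapted E X) : v.value (X ∩ Iio 1) = v.value X := by
  have h1 : IsPiece (X ∩ Iio 1) :=
    ((h.mono (Finset.subset_insert 1 E)).inter (adapted_Iio (Finset.mem_insert_self 1 E))).isPiece
  have h2 := v.additive (X ∩ Iio 1) (X ∩ {1}) h1 (isPiece_inter_singleton X 1) (by
    refine Set.disjoint_left.2 ?_
    rintro x ⟨_, hx⟩ ⟨_, hx'⟩
    simp at hx hx'; exact absurd hx' hx.ne)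
  rw [← inter_Iio_one_union X] at h2
  have h3 : v.value (X ∩ {1}) = 0 := by
    rcases Set.subset_singleton_iff_eq.1 (Set.inter_subset_right : X ∩ {1} ⊆ {1}) with h | h
    · rw [h, v.value_empty]
    · rw [h, v.value_singleton]
  linarith

/-- The value of a union of cells is determined by the values of the initial segments that end at
the cell boundaries. -/
theorem value_eq_of_cdf_eq {v w : AgentValuation} {E : Finset Cake} {X : Set Cake}
    (h : Adapted E X) (hE : ∀ e ∈ E, v.cdf e = w.cdf e) : v.value X = w.value X := by
  rw [← v.value_inter_Iio_one h, ← w.value_inter_Iio_one h]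
  refine (AdaptedBelow.induction (fun X => IsPiece X ∧ v.value X = w.value X)
    ⟨isPiece_empty, by rw [v.value_empty, w.value_empty]⟩ (fun a => v.cdf a = w.cdf a)
    (fun a ha => ⟨isPiece_of_ordConnected Set.ordConnected_Iio, by
      rw [v.value_Iio, w.value_Iio, ha]⟩)
    (fun a b hab ha hb => ⟨isPiece_of_ordConnected Set.ordConnected_Ico, by
      rw [v.value_Ico hab, w.value_Ico hab, ha, hb]⟩)
    (fun X Y hX hY hd => ⟨hX.1.union hY.1, by
      rw [v.additive X Y hX.1 hY.1 hd, w.additive X Y hX.1 hY.1 hd, hX.2, hY.2]⟩)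
    E hE 1 (fun e _ => unitInterval.le_one') (by rw [v.cdf_one, w.cdf_one]) X (h.below 1)).2

/-- A region: a finite union of half-open cells. -/
def Reg (X : Set Cake) : Prop := ∃ E, Adapted E X

theorem Reg.isPiece {X : Set Cake} : Reg X → IsPiece X := fun ⟨_, h⟩ => h.isPiece

theorem reg_empty : Reg ∅ := ⟨∅, adapted_empty _⟩

theorem Reg.union {X Y : Set Cake} : Reg X → Reg Y → Reg (X ∪ Y) := by
  rintro ⟨E, h⟩ ⟨E', h'⟩
  exact ⟨E ∪ E', (h.mono Finset.subset_union_left).union (h'.mono Finset.subset_union_right)⟩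

theorem Reg.compl {X : Set Cake} : Reg X → Reg Xᶜ := fun ⟨E, h⟩ => ⟨E, h.compl⟩

theorem Reg.inter {X Y : Set Cake} : Reg X → Reg Y → Reg (X ∩ Y) := by
  rintro ⟨E, h⟩ ⟨E', h'⟩
  exact ⟨E ∪ E', (h.mono Finset.subset_union_left).inter (h'.mono Finset.subset_union_right)⟩

theorem Reg.diff {X Y : Set Cake} (h : Reg X) (h' : Reg Y) : Reg (X \ Y) := h.inter h'.compl

namespace AgentValuation

variable (v : AgentValuation)

theorem value_nonneg {X : Set Cake} (h : Reg X) : 0 ≤ v.value X := v.nonneg X h.isPiece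

theorem value_union {X Y : Set Cake} (h : Reg X) (h' : Reg Y) (hd : Disjoint X Y) :
    v.value (X ∪ Y) = v.value X + v.value Y := v.additive X Y h.isPiece h'.isPiece hd

theorem value_mono {X Y : Set Cake} (h : Reg X) (h' : Reg Y) (hs : X ⊆ Y) :
    v.value X ≤ v.value Y := by
  have := v.value_union h (h'.diff h) Set.disjoint_sdiff_right
  rw [Set.union_sdiff_cancel hs] at this
  have := v.value_nonneg (h'.diff h)
  linarith

theorem value_union_le {X Y : Set Cake} (h : Reg X) (h' : Reg Y) :
    v.value (X ∪ Y) ≤ v.value X + v.value Y := by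
  have := v.value_union h (h'.diff h) Set.disjoint_sdiff_right
  rw [Set.union_sdiff_self] at this
  have := v.value_mono (h'.diff h) h' Set.sdiff_subset
  linarith

end AgentValuation

theorem Reg.biUnion {κ : Type*} (F : Finset κ) {X : κ → Set Cake} (h : ∀ k ∈ F, Reg (X k)) :
    Reg (⋃ k ∈ F, X k) := by
  classical
  induction F using Finset.induction_on with
  | empty => simpa using reg_empty
  | insert a F _ ih =>
    rw [Finset.set_biUnion_insert]
    exact (h a (by simp)).union (ih fun k hk => h k (by simp [hk]))

theorem Reg.iUnion {κ : Type*} [Fintype κ] {X : κ → Set Cake} (h : ∀ k, Reg (X k)) :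
    Reg (⋃ k, X k) := by
  simpa using Reg.biUnion Finset.univ (X := X) fun k _ => h k

namespace AgentValuation

theorem value_biUnion (v : AgentValuation) {κ : Type*} (F : Finset κ) {X : κ → Set Cake}
    (h : ∀ k ∈ F, Reg (X k)) (hd : ∀ k ∈ F, ∀ l ∈ F, k ≠ l → Disjoint (X k) (X l)) :
    v.value (⋃ k ∈ F, X k) = ∑ k ∈ F, v.value (X k) := by
  classical
  induction F using Finset.induction_on with
  | empty => simpa using v.value_empty
  | insert a F ha ih =>
    rw [Finset.set_biUnion_insert, Finset.sum_insert ha, v.value_union (h a (by simp))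
      (Reg.biUnion F fun k hk => h k (by simp [hk])),
      ih (fun k hk => h k (by simp [hk])) fun k hk l hl => hd k (by simp [hk]) l (by simp [hl])]
    simp only [Set.disjoint_iUnion_right]
    intro k hk
    exact hd a (by simp) k (by simp [hk]) (by rintro rfl; exact ha hk)

theorem value_iUnion (v : AgentValuation) {κ : Type*} [Fintype κ] {X : κ → Set Cake}
    (h : ∀ k, Reg (X k)) (hd : ∀ k l, k ≠ l → Disjoint (X k) (X l)) :
    v.value (⋃ k, X k) = ∑ k, v.value (X k) := by
  simpa using v.value_biUnion Finset.univ (X := X) (fun k _ => h k) fun k _ l _ => hd k l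

theorem value_iUnion_le (v : AgentValuation) {κ : Type*} [Fintype κ] {X : κ → Set Cake}
    (h : ∀ k, Reg (X k)) : v.value (⋃ k, X k) ≤ ∑ k, v.value (X k) := by
  classical
  have key : ∀ F : Finset κ, v.value (⋃ k ∈ F, X k) ≤ ∑ k ∈ F, v.value (X k) := by
    intro F
    induction F using Finset.induction_on with
    | empty => simp [v.value_empty]
    | insert a F ha ih =>
      rw [Finset.set_biUnion_insert, Finset.sum_insert ha]
      have := v.value_union_le (h a) (Reg.biUnion F fun k _ => h k)
      linarith
  simpa using key Finset.univ

end AgentValuation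

/-! ### Knowledge about the valuations -/

/-- A valuation profile. -/
abbrev Prof (n : ℕ) : Type := Fin n → AgentValuation

variable {n : ℕ}

/-- With at most `c` steps, in each of which an agent is asked for a point with a prescribed value
of the initial segment and all agents evaluate that segment, the set of the profiles that are
consistent with the answers can be brought from `P` into `Φ`. -/
inductive Reach (Φ : Set (Prof n) → Prop) : ℕ → Set (Prof n) → Prop
  | done {c : ℕ} {P : Set (Prof n)} : Φ P → Reach Φ c P
  | ask {c : ℕ} {P : Set (Prof n)} (i : Fin n) (t : Cake) :
      (∀ (y : Cake) (w : Fin n → ℝ),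
        (P ∩ {v | (v i).cdf y = t ∧ ∀ k, (v k).cdf y = w k}).Nonempty →
          Reach Φ c (P ∩ {v | (v i).cdf y = t ∧ ∀ k, (v k).cdf y = w k})) →
      Reach Φ (c + 1) P

namespace Reach

variable {Φ Ψ : Set (Prof n) → Prop} {P : Set (Prof n)} {c d : ℕ}

theorem mono (h : Reach Φ c P) (hcd : c ≤ d) : Reach Φ d P := by
  induction h generalizing d with
  | done h => exact done h
  | ask i t _ ih =>
    obtain ⟨d, rfl⟩ : ∃ e, d = e + 1 := ⟨d - 1, by omega⟩
    exact ask i t fun y w hyw => ih y w hyw (by omega)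

theorem bind (h : Reach Φ c P) (hP : P.Nonempty)
    (hΨ : ∀ P' ⊆ P, P'.Nonempty → Φ P' → Reach Ψ d P') : Reach Ψ (c + d) P := by
  induction h with
  | done h => exact (hΨ _ le_rfl hP h).mono (by omega)
  | @ask c P i t _ ih =>
    rw [show c + 1 + d = c + d + 1 by omega]
    refine ask i t fun y w hyw => ih y w hyw hyw fun P' h1 h2 h3 => ?_
    exact hΨ P' (h1.trans Set.inter_subset_left) h2 h3

theorem imp (h : Reach Φ c P) (hP : P.Nonempty)
    (hΨ : ∀ P' ⊆ P, P'.Nonempty → Φ P' → Ψ P') : Reach Ψ c P :=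
  h.bind (d := 0) hP fun P' h1 h2 h3 => done (hΨ P' h1 h2 h3)

/-- To reach persistent properties one after the other. -/
theorem forall_finset {α σ : Type*} (F : Finset α) (Inv : Set (Prof n) → σ → Prop)
    (le : σ → σ → Prop) (le_refl : ∀ s, le s s) (le_trans : ∀ r s t, le r s → le s t → le r t)
    (Ψ : α → Set (Prof n) → σ → Prop)
    (hΨ : ∀ x P P' s s', P' ⊆ P → le s s' → Ψ x P s → Ψ x P' s') (a : ℕ)
    (step : ∀ x ∈ F, ∀ P s, P.Nonempty → Inv P s →
      Reach (fun P' => ∃ s', le s s' ∧ Inv P' s' ∧ Ψ x P' s') a P)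
    (P : Set (Prof n)) (s : σ) (hP : P.Nonempty) (hs : Inv P s) :
    Reach (fun P' => ∃ s', le s s' ∧ Inv P' s' ∧ ∀ x ∈ F, Ψ x P' s') (F.card * a) P := by
  classical
  induction F using Finset.induction_on generalizing P s with
  | empty => exact done ⟨s, le_refl s, hs, by simp⟩
  | insert x F hx ih =>
    rw [Finset.card_insert_of_notMem hx, Nat.succ_mul]
    refine (ih (fun x hx => step x (by simp [hx])) P s hP hs).bind hP ?_
    rintro P' h1 h2 ⟨s', h3, h4, h5⟩
    refine (step x (by simp) P' s' h2 h4).imp h2 ?_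
    rintro P'' h6 h7 ⟨s'', h8, h9, h10⟩
    refine ⟨s'', le_trans _ _ _ h3 h8, h9, fun y hy => ?_⟩
    rcases Finset.mem_insert.1 hy with rfl | hy
    exacts [h10, hΨ y P' P'' s' s'' h6 h8 (h5 y hy)]

end Reach

/-- All agents in the list evaluate the initial segment `[0, y]`. -/
noncomputable def evalList (y : Cake) (F : (Fin n → ℝ) → Protocol n) :
    List (Fin n) → (Fin n → ℝ) → Protocol n
  | [], w => F w
  | k :: l, w =>
    if h : 0 < y then Protocol.eval k 0 y h fun r => evalList y F l (Function.update w k r)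
    else evalList y F l (Function.update w k 0)

theorem run_evalList (v : Prof n) (y : Cake) (F : (Fin n → ℝ) → Protocol n) (A : Fin n → Set Cake)
    (l : List (Fin n)) : ∀ (w : Fin n → ℝ) (q : ℕ), Run v (evalList y F l w) q A →
      ∃ q', q ≤ q' + l.length ∧
        Run v (F fun k => if k ∈ l then (v k).cdf y else w k) q' A := by
  induction l with
  | nil => intro w q h; exact ⟨q, by simp, by simpa [evalList] using h⟩
  | cons k l ih =>
    intro w q h
    have key : ∀ q, Run v (evalList y F l (Function.update w k ((v k).cdf y))) q A →
        ∃ q', q ≤ q' + l.length ∧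
          Run v (F fun j => if j ∈ k :: l then (v j).cdf y else w j) q' A := by
      intro q h
      obtain ⟨q', h1, h2⟩ := ih _ _ h
      refine ⟨q', h1, ?_⟩
      convert h2 using 2
      ext j
      by_cases hj : j = k
      · subst hj; simp
      · simp [hj]
    rw [evalList] at h
    split_ifs at h with hy
    · cases h with
      | eval _ _ _ _ _ q _ h =>
        obtain ⟨q', h1, h2⟩ := key q h
        exact ⟨q', by simp only [List.length_cons]; omega, h2⟩
    -- The degenerate segment cannot be queried; the default 0 recorded for it is its true value.
    · have hy0 : y = 0 := le_antisymm (not_lt.1 hy) unitInterval.nonneg'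
      obtain ⟨q', h1, h2⟩ := key q (by rwa [hy0, AgentValuation.cdf_zero, ← hy0])
      exact ⟨q', by simp only [List.length_cons]; omega, h2⟩

/-- A strategy that determines a good allocation can be carried out by a protocol. -/
theorem Reach.exists_protocol {Good : Prof n → (Fin n → Set Cake) → Prop} {c : ℕ}
    {P : Set (Prof n)} (h : Reach (fun P' => ∃ A, ∀ v ∈ P', Good v A) c P) :
    ∃ prot : Protocol n, ∀ v ∈ P, ∀ q A, Run v prot q A → Good v A ∧ q ≤ c * (n + 1) := by
  classical
  induction h with
  | done h =>
    obtain ⟨A, hA⟩ := h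
    refine ⟨Protocol.output A, fun v hv q A' h => ?_⟩
    cases h
    exact ⟨hA v hv, Nat.zero_le _⟩
  | @ask c P i t _ ih =>
    choose prot hprot using ih
    -- Answers that no profile in `P` can give do not occur in a truthful run; the output after them
    -- is arbitrary.
    let F : Cake → (Fin n → ℝ) → Protocol n := fun y w =>
      if h : (P ∩ {v | (v i).cdf y = t ∧ ∀ k, (v k).cdf y = w k}).Nonempty then prot y w h
      else Protocol.output fun _ => ∅
    refine ⟨Protocol.cut i 0 t fun r => r.elim (Protocol.output fun _ => ∅)
      fun y => evalList y (F y) (List.finRange n) 0, fun v hv q A h => ?_⟩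
    cases h with
    | cut _ _ _ _ r q _ hr h =>
      cases r with
      | none =>
        obtain ⟨y, hy⟩ := (v i).exists_cdf_eq t
        exact absurd hy (hr y unitInterval.nonneg')
      | some y =>
        obtain ⟨q', h1, h2⟩ := run_evalList v y (F y) A _ _ _ h
        simp only [List.mem_finRange, if_true, List.length_finRange] at h1 h2
        have hv' : v ∈ P ∩ {v' | (v' i).cdf y = t ∧ ∀ k, (v' k).cdf y = (v k).cdf y} :=
          ⟨hv, hr.2, fun _ => rfl⟩
        have hF : F y (fun k => (v k).cdf y) = prot y _ ⟨v, hv'⟩ := dif_pos _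
        rw [hF] at h2
        obtain ⟨h3, h4⟩ := hprot y _ ⟨v, hv'⟩ v hv' q' A h2
        refine ⟨h3, ?_⟩
        rw [Nat.succ_mul]
        omega

/-- The point `y` has been evaluated by all agents. -/
def Kp (P : Set (Prof n)) (y : Cake) : Prop :=
  ∀ k, ∀ v ∈ P, ∀ w ∈ P, (v k).cdf y = (w k).cdf y

/-- The set `X` is made up of cells between points that all agents have evaluated. -/
def Kn (P : Set (Prof n)) (X : Set Cake) : Prop := ∃ E, (∀ e ∈ E, Kp P e) ∧ Adapted E X

/-! ### Points and sets of known value -/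

section Kn

variable {P P' : Set (Prof n)} {X Y : Set Cake}

theorem Kp.anti {y : Cake} (h : Kp P y) (hP : P' ⊆ P) : Kp P' y :=
  fun k v hv w hw => h k v (hP hv) w (hP hw)

theorem kp_zero : Kp P 0 := fun k v _ w _ => by
  rw [AgentValuation.cdf_zero, AgentValuation.cdf_zero]

theorem kp_one : Kp P 1 := fun k v _ w _ => by
  rw [AgentValuation.cdf_one, AgentValuation.cdf_one]

theorem Kn.anti (h : Kn P X) (hP : P' ⊆ P) : Kn P' X := by
  obtain ⟨E, h1, h2⟩ := h
  exact ⟨E, fun e he => (h1 e he).anti hP, h2⟩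

theorem Kn.reg (h : Kn P X) : Reg X := by
  obtain ⟨E, -, h⟩ := h
  exact ⟨E, h⟩

theorem Kn.value_eq (h : Kn P X) {v w : Prof n} (hv : v ∈ P) (hw : w ∈ P) (k : Fin n) :
    (v k).value X = (w k).value X := by
  obtain ⟨E, h1, h2⟩ := h
  exact value_eq_of_cdf_eq h2 fun e he => h1 e he k v hv w hw

theorem kn_empty : Kn P ∅ := ⟨∅, by simp, adapted_empty _⟩

theorem kn_univ : Kn P univ := ⟨∅, by simp, adapted_univ _⟩

theorem kn_Iio {y : Cake} (h : Kp P y) : Kn P (Iio y) :=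
  ⟨{y}, by simpa using h, adapted_Iio (Finset.mem_singleton_self y)⟩

theorem Kn.compl (h : Kn P X) : Kn P Xᶜ := by
  obtain ⟨E, h1, h2⟩ := h
  exact ⟨E, h1, h2.compl⟩

theorem Kn.union (h : Kn P X) (h' : Kn P Y) : Kn P (X ∪ Y) := by
  classical
  obtain ⟨E, h1, h2⟩ := h
  obtain ⟨E', h1', h2'⟩ := h'
  refine ⟨E ∪ E', fun e he => ?_,
    (h2.mono Finset.subset_union_left).union (h2'.mono Finset.subset_union_right)⟩
  rcases Finset.mem_union.1 he with he | he
  exacts [h1 e he, h1' e he]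

theorem Kn.inter (h : Kn P X) (h' : Kn P Y) : Kn P (X ∩ Y) := by
  have := (h.compl.union h'.compl).compl
  rwa [← Set.compl_inter, compl_compl] at this

theorem Kn.sdiff (h : Kn P X) (h' : Kn P Y) : Kn P (X \ Y) := h.inter h'.compl

theorem Kn.biUnion {κ : Type*} (F : Finset κ) {X : κ → Set Cake} (h : ∀ k ∈ F, Kn P (X k)) :
    Kn P (⋃ k ∈ F, X k) := by
  classical
  induction F using Finset.induction_on with
  | empty => simpa using kn_empty
  | insert a F _ ih =>
    rw [Finset.set_biUnion_insert]
    exact (h a (by simp)).union (ih fun k hk => h k (by simp [hk]))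

theorem Kn.iUnion {κ : Type*} [Fintype κ] {X : κ → Set Cake} (h : ∀ k, Kn P (X k)) :
    Kn P (⋃ k, X k) := by
  simpa using Kn.biUnion Finset.univ (X := X) fun k _ => h k

end Kn

/-! ### Cutting a known region at a prescribed value -/

theorem AgentValuation.value_inter_Iio_of_Ico_subset (v : AgentValuation) {X : Set Cake}
    (h : Reg X) {a y : Cake} (hay : a ≤ y) (hX : Ico a y ⊆ X) :
    v.value (X ∩ Iio y) = v.value (X ∩ Iio a) + (v.cdf y - v.cdf a) := by
  have h1 : X ∩ Iio y = X ∩ Iio a ∪ Ico a y := by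
    rw [← Set.Iio_union_Ico_eq_Iio hay, Set.inter_union_distrib_left, Set.inter_eq_right.2 hX]
  have r : ∀ a : Cake, Reg (Iio a) := fun a => ⟨{a}, adapted_Iio (Finset.mem_singleton_self a)⟩
  have h2 : Reg (Ico a y) := by
    have : Ico a y = Iio y \ Iio a := by ext; simp
    rw [this]; exact (r y).diff (r a)
  rw [h1, v.value_union (h.inter (r a)) h2, v.value_Ico hay]
  exact Set.disjoint_left.2 fun z hz hz' => absurd hz'.1 (not_le.2 hz.2)

/-- For `f y` the value of `X ∩ [0, y)`, this locates the cell in which the target is reached: it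
starts at the last boundary point where `f` does not exceed `τ`, and it lies in `X` because `f` does
not grow across a cell outside `X`. -/
theorem exists_cell {E : Finset Cake} {X : Set Cake} (hX : Adapted E X) {f : Cake → ℝ} {τ : ℝ}
    (hf : ∀ a b, X ∩ Iio b = X ∩ Iio a → f b = f a) (h0 : 0 ∈ E) (h1 : 1 ∈ E) (hf0 : f 0 ≤ τ) :
    f 1 ≤ τ ∨ ∃ a ∈ E, ∃ b ∈ E, a ≤ b ∧ Ico a b ⊆ X ∧ f a ≤ τ ∧ τ ≤ f b := by
  classical
  obtain ⟨a, ha, hmax⟩ := Finset.exists_max_image (E.filter fun e => f e ≤ τ) id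
    ⟨0, Finset.mem_filter.2 ⟨h0, hf0⟩⟩
  obtain ⟨haE, haτ⟩ := Finset.mem_filter.1 ha
  rcases eq_or_lt_of_le (unitInterval.le_one' : a ≤ 1) with ha1 | ha1
  · left; rwa [ha1] at haτ
  right
  obtain ⟨b, hb, hmin⟩ := Finset.exists_min_image (E.filter fun e => a < e) id
    ⟨1, Finset.mem_filter.2 ⟨h1, ha1⟩⟩
  obtain ⟨hbE, hab⟩ := Finset.mem_filter.1 hb
  have hcell : ∀ x ∈ Ico a b, (a ∈ X ↔ x ∈ X) := fun x hx =>
    hX a x hx.1 fun e he hae =>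
      not_le.2 (lt_of_lt_of_le hx.2 (hmin e (Finset.mem_filter.2 ⟨he, hae⟩)))
  have hb' : τ < f b := by
    by_contra h
    exact absurd (hmax b (Finset.mem_filter.2 ⟨hbE, not_lt.1 h⟩)) (not_le.2 hab)
  have haX : a ∈ X := by
    by_contra haX
    have : X ∩ Iio b = X ∩ Iio a := by
      ext x
      simp only [mem_inter_iff, mem_Iio, and_congr_right_iff]
      intro hx
      refine ⟨fun h => ?_, fun h => h.trans hab⟩
      by_contra hxa
      exact haX ((hcell x ⟨not_lt.1 hxa, h⟩).2 hx)
    exact absurd haτ (not_le.2 (hf a b this ▸ hb'))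
  exact ⟨a, haE, b, hbE, hab.le, fun x hx => (hcell x hx).1 haX, haτ, hb'.le⟩

/-- One step suffices to cut a known region at a prescribed value. -/
theorem reach_mark {P : Set (Prof n)} {X : Set Cake} (hX : Kn P X) {v₀ : Prof n} (hv₀ : v₀ ∈ P)
    (i : Fin n) {τ : ℝ} (h0 : 0 ≤ τ) (h1 : τ ≤ (v₀ i).value X) :
    Reach (fun P' => ∃ y, Kp P' y ∧ ∀ v ∈ P', (v i).value (X ∩ Iio y) = τ) 1 P := by
  classical
  obtain ⟨E, hE, hXE⟩ := id hX
  have hKE : ∀ e ∈ insert 0 (insert 1 E), Kp P e := by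
    intro e he
    simp only [Finset.mem_insert] at he
    rcases he with rfl | rfl | he
    exacts [kp_zero, kp_one, hE e he]
  have hφ0 : (v₀ i).value (X ∩ Iio 0) = 0 := by
    have : Iio (0 : Cake) = ∅ := by
      ext y; simp
    simp [this, AgentValuation.value_empty]
  rcases exists_cell (f := fun y => (v₀ i).value (X ∩ Iio y)) (τ := τ)
      (hXE.mono ((Finset.subset_insert 1 E).trans (Finset.subset_insert 0 _)))
      (fun a b h => by rw [h]) (by simp) (by simp) (hφ0.trans_le h0) with h | h
  · refine Reach.done ⟨1, kp_one, fun v hv => ?_⟩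
    rw [(v₀ i).value_inter_Iio_one hXE] at h
    rw [(v i).value_inter_Iio_one hXE, hX.value_eq hv hv₀]
    exact le_antisymm h h1
  obtain ⟨a, haE, b, hbE, hab, hIco, haτ, hτb⟩ := h
  replace haE := hKE a haE
  replace hbE := hKE b hbE
  have hφb := (v₀ i).value_inter_Iio_of_Ico_subset hX.reg hab hIco
  have hca : 0 ≤ (v₀ i).cdf a := by
    rw [← (v₀ i).cdf_zero]; exact (v₀ i).cdf_mono unitInterval.nonneg'
  have hcb : (v₀ i).cdf b ≤ 1 := by
    rw [← (v₀ i).cdf_one]; exact (v₀ i).cdf_mono unitInterval.le_one'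
  -- On the cell `[a, b)` the value of `X ∩ [0, y)` and that of `[0, y)` differ by a constant, which
  -- translates the target.
  refine Reach.ask i ⟨τ - (v₀ i).value (X ∩ Iio a) + (v₀ i).cdf a, by linarith, by linarith⟩ ?_
  rintro y w -
  -- If the valuation vanishes near `a` or `b`, the answer may lie outside `[a, b]`. Clamping does
  -- not change its value for agent `i`, and all three candidate points have been evaluated by
  -- everyone.
  refine Reach.done ⟨max a (min y b), ?_, ?_⟩
  · rcases max_choice a (min y b) with h | h <;> rw [h]
    · exact haE.anti Set.inter_subset_left
    · rcases min_choice y b with h | h <;> rw [h]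
      · exact fun k v hv v' hv' => by rw [hv.2.2 k, hv'.2.2 k]
      · exact hbE.anti Set.inter_subset_left
  · rintro v ⟨hv, hvy, -⟩
    simp only at hvy
    have e1 : (v i).cdf a = (v₀ i).cdf a := haE i v hv v₀ hv₀
    have e2 : (v i).cdf b = (v₀ i).cdf b := hbE i v hv v₀ hv₀
    have e3 : (v i).value (X ∩ Iio a) = (v₀ i).value (X ∩ Iio a) :=
      (hX.inter (kn_Iio haE)).value_eq hv hv₀ i
    rw [(v i).value_inter_Iio_of_Ico_subset hX.reg (le_max_left _ _)
      ((Set.Ico_subset_Ico_right (max_le hab (min_le_right _ _))).trans hIco), e3]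
    have e4 : (v i).cdf (max a (min y b)) = (v i).cdf y := by
      rw [(v i).cdf_mono.map_max, (v i).cdf_mono.map_min, min_eq_left, max_eq_right] <;> linarith
    rw [e4, hvy, e1]
    ring

/-! ### Nested families of regions along which pieces are trimmed -/

/-- One step suffices to find, between two known members of the family `X`, a member with a
prescribed value. -/
def Markable {Pos : Type*} [LinearOrder Pos] (P : Set (Prof n)) (X : Pos → Set Cake) : Prop :=
  ∀ P' ⊆ P, ∀ v₀ ∈ P', ∀ s₁ s₂, s₁ ≤ s₂ → Kn P' (X s₁) → Kn P' (X s₂) → ∀ i τ,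
    (v₀ i).value (X s₁) ≤ τ → τ ≤ (v₀ i).value (X s₂) →
      Reach (fun P'' => ∃ s, s₁ ≤ s ∧ s ≤ s₂ ∧ Kn P'' (X s) ∧ ∀ v ∈ P'', (v i).value (X s) = τ) 1 P'

theorem Markable.anti {Pos : Type*} [LinearOrder Pos] {P P' : Set (Prof n)} {X : Pos → Set Cake}
    (h : Markable P X) (hP : P' ⊆ P) : Markable P' X :=
  fun P'' hP'' => h P'' (hP''.trans hP)

/-- The union of the layers before the given one and of an initial part of the latter. -/
def layered (L : ℕ → Set Cake) (s : ℕ ×ₗ Cake) : Set Cake :=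
  (⋃ k ∈ Finset.range (ofLex s).1, L k) ∪ L (ofLex s).1 ∩ Iio (ofLex s).2

section Layered

variable {L : ℕ → Set Cake} {P : Set (Prof n)}

theorem layered_zero (L : ℕ → Set Cake) (l : ℕ) :
    layered L (toLex (l, 0)) = ⋃ k ∈ Finset.range l, L k := by
  have : Iio (0 : Cake) = ∅ := by
    ext y; simp
  simp [layered, this]

theorem layered_mono (L : ℕ → Set Cake) : Monotone (layered L) := by
  intro s t hst
  rw [Prod.Lex.le_iff] at hst
  rintro x (hx | ⟨hx, hx'⟩)
  · simp only [Set.mem_iUnion, Finset.mem_range, exists_prop] at hx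
    obtain ⟨l, hl, hx⟩ := hx
    left
    simp only [Set.mem_iUnion, Finset.mem_range, exists_prop]
    exact ⟨l, by rcases hst with h | ⟨h, -⟩ <;> omega, hx⟩
  · rcases hst with h | ⟨h, h'⟩
    · left
      simp only [Set.mem_iUnion, Finset.mem_range, exists_prop]
      exact ⟨_, h, hx⟩
    · right
      rw [h] at hx
      exact ⟨hx, lt_of_lt_of_le hx' h'⟩

theorem kn_layered (h : ∀ l, Kn P (L l)) {l : ℕ} {y : Cake} (hy : Kp P y) :
    Kn P (layered L (toLex (l, y))) :=
  (Kn.biUnion _ fun k _ => h k).union ((h l).inter (kn_Iio hy))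

theorem value_layered (v : Prof n) (h : ∀ l, Kn P (L l))
    (hd : ∀ k l, k ≠ l → Disjoint (L k) (L l)) (i : Fin n) (l : ℕ) {y : Cake} (hy : Kp P y) :
    (v i).value (layered L (toLex (l, y))) =
      (v i).value (layered L (toLex (l, 0))) + (v i).value (L l ∩ Iio y) := by
  rw [layered_zero, ← (v i).value_union (Reg.biUnion _ fun k _ => (h k).reg)
    ((h l).inter (kn_Iio hy)).reg]
  · rfl
  · simp only [Set.disjoint_iUnion_left, Finset.mem_range]
    exact fun k hk => (hd k l hk.ne).mono_right Set.inter_subset_left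

/-- The target value is reached within a single layer, and `reach_mark` cuts that layer. -/
theorem markable_layered (h : ∀ l, Kn P (L l)) (hd : ∀ k l, k ≠ l → Disjoint (L k) (L l)) :
    Markable P (layered L) := by
  intro P' hP v₀ hv₀ s₁ s₂ hs hk₁ hk₂ i τ h₁ h₂
  replace h : ∀ l, Kn P' (L l) := fun l => (h l).anti hP
  have hk0 : ∀ l, Kn P' (layered L (toLex (l, 0))) := fun l => kn_layered h kp_zero
  have h00 : (v₀ i).value (layered L (toLex (0, 0))) ≤ τ := by
    rw [layered_zero]
    simp only [Finset.range_zero, Finset.notMem_empty, Set.iUnion_of_empty, Set.iUnion_empty,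
      AgentValuation.value_empty]
    exact ((v₀ i).value_nonneg hk₁.reg).trans h₁
  obtain ⟨l, hl, hτ⟩ : ∃ l, (v₀ i).value (layered L (toLex (l, 0))) ≤ τ ∧
      τ ≤ (v₀ i).value (layered L (toLex (l + 1, 0))) := by
    by_contra! hcon
    have : ∀ l, (v₀ i).value (layered L (toLex (l, 0))) ≤ τ := by
      intro l
      induction l with
      | zero => exact h00
      | succ l ih => exact (hcon l ih).le
    have h3 := hcon (ofLex s₂).1 (this _)
    have h4 : layered L s₂ ⊆ layered L (toLex ((ofLex s₂).1 + 1, 0)) := by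
      apply layered_mono
      rw [Prod.Lex.le_iff]
      left; exact Nat.lt_succ_self _
    have := (v₀ i).value_mono hk₂.reg (hk0 _).reg h4
    linarith
  have hsucc : (v₀ i).value (layered L (toLex (l + 1, 0))) =
      (v₀ i).value (layered L (toLex (l, 0))) + (v₀ i).value (L l) := by
    rw [layered_zero, layered_zero, Finset.range_add_one, Finset.set_biUnion_insert, Set.union_comm,
      (v₀ i).value_union (Reg.biUnion _ fun k _ => (h k).reg) (h l).reg]
    simp only [Set.disjoint_iUnion_left, Finset.mem_range]
    exact fun k hk => hd k l hk.ne
  refine (reach_mark (h l) hv₀ i (τ := τ - (v₀ i).value (layered L (toLex (l, 0))))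
    (by linarith) (by linarith)).imp ⟨v₀, hv₀⟩ ?_
  rintro P'' hP'' - ⟨y, hy, hyv⟩
  have hks : Kn P'' (layered L (toLex (l, y))) := kn_layered (fun l => (h l).anti hP'') hy
  have hvs : ∀ v ∈ P'', (v i).value (layered L (toLex (l, y))) = τ := by
    intro v hv
    rw [value_layered v (fun l => (h l).anti hP'') hd i l hy, hyv v hv, (hk0 l).value_eq (hP'' hv) hv₀]
    ring
  -- When values coincide, the cut may fall outside `[s₁, s₂]`; by monotonicity of the family,
  -- clamping keeps the value.
  refine ⟨max s₁ (min (toLex (l, y)) s₂), le_max_left _ _, max_le hs (min_le_right _ _), ?_, ?_⟩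
  · rcases max_choice s₁ (min (toLex (l, y)) s₂) with h | h <;> rw [h]
    · exact hk₁.anti hP''
    · rcases min_choice (toLex (l, y)) s₂ with h | h <;> rw [h]
      exacts [hks, hk₂.anti hP'']
  · intro v hv
    rw [← hk₁.value_eq (hP'' hv) hv₀] at h₁
    rw [← hk₂.value_eq (hP'' hv) hv₀] at h₂
    have hs' := hvs v hv
    rcases le_total s₁ (toLex (l, y)) with h3 | h3
    · rcases le_total (toLex (l, y)) s₂ with h4 | h4
      · rw [min_eq_left h4, max_eq_right h3, hs']
      · rw [min_eq_right h4, max_eq_right hs]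
        have := (v i).value_mono (hk₂.anti hP'').reg hks.reg (layered_mono L h4)
        linarith
    · rw [max_eq_left ((min_le_left _ _).trans h3)]
      have := (v i).value_mono hks.reg (hk₁.anti hP'').reg (layered_mono L h3)
      linarith

end Layered

/-! ### Trimmed pieces with an envy-free assignment -/

section Existence

/-- The assignment `m` of the pieces, trimmed at `y`, is envy-free for the valuations `L`. -/
def EF {α κ : Type*} (L : α → κ → ℝ → ℝ) (y : κ → ℝ) (m : α → κ) : Prop :=
  ∀ i p, L i p (y p) ≤ L i (m i) (y (m i))

/-- Every agent takes the better of her two offers, and the one from `y` in case of a tie. Whoever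
changes takes a piece that is strictly longer in `z`; whoever stays keeps a piece that is at least
as long in `y`. Hence no piece is taken twice. -/
theorem EF.join {α κ : Type*} {L : α → κ → ℝ → ℝ} (hL : ∀ i p, StrictMono (L i p))
    {y z : κ → ℝ} {m m' : α → κ} (hy : EF L y m) (hz : EF L z m') (hm : m.Injective)
    (hm' : m'.Injective) : ∃ k : α → κ, k.Injective ∧ EF L (fun p => max (y p) (z p)) k := by
  classical
  let V : α → ℝ := fun i => L i (m i) (y (m i))
  let V' : α → ℝ := fun i => L i (m' i) (z (m' i))
  have h1 : ∀ i, V i < V' i → y (m' i) < z (m' i) := fun i hi => by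
    by_contra h
    exact absurd (((hL i _).monotone (not_lt.1 h)).trans (hy i (m' i))) (not_le.2 hi)
  have h2 : ∀ i, ¬ V i < V' i → L i (m i) (max (y (m i)) (z (m i))) = V i := fun i hi => by
    rw [(hL i (m i)).monotone.map_max]
    exact max_eq_left ((hz i (m i)).trans (not_lt.1 hi))
  have h3 : ∀ i i', V i < V' i → ¬ V i' < V' i' → m' i ≠ m i' := by
    intro i i' hi hi' h
    have h4 : L i' (m i') (z (m i')) ≤ L i' (m i') (y (m i')) :=
      (hz i' (m i')).trans (not_lt.1 hi')
    exact absurd ((hL i' (m i')).le_iff_le.1 h4) (not_le.2 (h ▸ h1 i hi))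
  refine ⟨fun i => if V i < V' i then m' i else m i, ?_, ?_⟩
  · intro i i' h
    simp only at h
    split_ifs at h with hi hi' hi'
    exacts [hm' h, absurd h (h3 i i' hi hi'), absurd h.symm (h3 i' i hi' hi), hm h]
  · intro i p
    simp only
    rw [(hL i p).monotone.map_max]
    split_ifs with hi
    · rw [max_eq_right (h1 i hi).le]
      exact max_le ((hy i p).trans hi.le) (hz i p)
    · rw [h2 i hi]
      exact max_le (hy i p) ((hz i p).trans (not_lt.1 hi))

/-- An auction on a grid. All pieces start at their caps. An unassigned agent claims her favourite
piece; if it is taken, its owner is evicted and the piece is shortened by one grid step. Owners are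
thus content up to one grid step, and unclaimed pieces stay at their caps. -/
theorem exists_auction {κ : Type*} [Fintype κ] [Nonempty κ] {L : κ → κ → ℝ → ℝ}
    (hL : ∀ i p, StrictMono (L i p)) (h0 : ∀ i p, L i p 0 = 0) {u : κ → ℝ} (hu : ∀ p, 0 < u p)
    (N : ℕ) (hN : 0 < N) :
    ∃ (j : κ → ℕ) (m : κ → κ), m.Injective ∧ (∀ p, j p ≤ N) ∧ (∃ p, j p = N) ∧
      ∀ i p, L i p (u p * (j p / N)) ≤ L i (m i) (u (m i) * ((j (m i) + 1) / N)) := by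
  classical
  have hN' : (0 : ℝ) < N := by exact_mod_cast hN
  -- The invariants of the auction, with `A` the set of assigned agents. The measure adds the number
  -- of unassigned agents, which drops at a claim of a free piece, to the remaining grid steps,
  -- which drop at an eviction.
  have main : ∀ (M : ℕ) (A : Finset κ) (j : κ → ℕ) (m : κ → κ),
      (Fintype.card κ - A.card) + ∑ p, j p = M → Set.InjOn m A → (∀ p, j p ≤ N) →
      (∃ p, j p = N) → (∀ p, p ∉ A.image m → j p = N) →
      (∀ i ∈ A, ∀ p, L i p (u p * (j p / N)) ≤ L i (m i) (u (m i) * ((j (m i) + 1) / N))) →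
      ∃ (j : κ → ℕ) (m : κ → κ), m.Injective ∧ (∀ p, j p ≤ N) ∧ (∃ p, j p = N) ∧
        ∀ i p, L i p (u p * (j p / N)) ≤ L i (m i) (u (m i) * ((j (m i) + 1) / N)) := by
    intro M
    induction M using Nat.strong_induction_on with
    | _ M ih =>
    intro A j m hM hm hj hex hun hA
    by_cases hAu : A = Finset.univ
    · subst hAu
      exact ⟨j, m, by simpa using hm, hj, hex, fun i p => hA i (Finset.mem_univ i) p⟩
    obtain ⟨x, hx⟩ : ∃ x, x ∉ A := by
      by_contra! h
      exact hAu (Finset.eq_univ_iff_forall.2 h)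
    have hcard : A.card < Fintype.card κ := Finset.card_lt_univ_of_notMem hx
    obtain ⟨f, hf⟩ : ∃ f, f ∉ A.image m := by
      by_contra! h
      have := Finset.card_image_le (s := A) (f := m)
      rw [Finset.eq_univ_iff_forall.2 h, Finset.card_univ] at this
      omega
    obtain ⟨q, -, hq⟩ := Finset.exists_max_image Finset.univ
      (fun q => L x q (u q * (j q / N))) Finset.univ_nonempty
    replace hq : ∀ p, L x p (u p * (j p / N)) ≤ L x q (u q * (j q / N)) :=
      fun p => hq p (Finset.mem_univ p)
    by_cases hqA : q ∈ A.image m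
    · obtain ⟨o, ho, rfl⟩ := Finset.mem_image.1 hqA
      -- A piece shortened to nothing cannot be the favourite, since the unclaimed piece `f` is
      -- still at its positive cap.
      have hjq : 0 < j (m o) := by
        rw [Nat.pos_iff_ne_zero]
        intro h
        have h1 := hq f
        rw [h, hun f hf, div_self hN'.ne', mul_one, Nat.cast_zero, zero_div, mul_zero, h0] at h1
        have h2 := hL x f (hu f)
        rw [h0] at h2
        linarith
      have hle : ∀ p, Function.update j (m o) (j (m o) - 1) p ≤ j p := by
        intro p
        by_cases hp : p = m o
        · subst hp; simp
        · simp [hp]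
      have hle' : ∀ i p, L i p (u p * ((Function.update j (m o) (j (m o) - 1) p : ℕ) / N)) ≤
          L i p (u p * (j p / N)) := by
        intro i p
        apply (hL i p).monotone
        have := (hu p).le
        have := hle p
        gcongr
      have hxo : x ≠ o := by rintro rfl; exact hx ho
      refine ih _ ?_ (insert x (A.erase o)) (Function.update j (m o) (j (m o) - 1))
        (Function.update m x (m o)) rfl ?_ (fun p => (hle p).trans (hj p)) ?_ ?_ ?_
      · rw [Finset.card_insert_of_notMem (by simp [hx]), Finset.card_erase_of_mem ho]
        have h1 : ∑ p, Function.update j (m o) (j (m o) - 1) p < ∑ p, j p :=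
          Finset.sum_lt_sum (fun p _ => hle p) ⟨m o, Finset.mem_univ _, by simp; omega⟩
        have : 0 < A.card := Finset.card_pos.2 ⟨o, ho⟩
        omega
      · intro a ha b hb hab
        simp only [Finset.coe_insert, Finset.coe_erase, Set.mem_insert_iff, Set.mem_sdiff,
          Finset.mem_coe, Set.mem_singleton_iff] at ha hb
        by_cases hax : a = x <;> by_cases hbx : b = x
        · rw [hax, hbx]
        · subst hax
          simp only [Function.update_self, Function.update_of_ne hbx] at hab
          have hb' := hb.resolve_left hbx
          exact absurd (hm hb'.1 ho hab.symm) hb'.2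
        · subst hbx
          simp only [Function.update_self, Function.update_of_ne hax] at hab
          have ha' := ha.resolve_left hax
          exact absurd (hm ha'.1 ho hab) ha'.2
        · simp only [Function.update_of_ne hax, Function.update_of_ne hbx] at hab
          exact hm (ha.resolve_left hax).1 (hb.resolve_left hbx).1 hab
      · refine ⟨f, ?_⟩
        have : f ≠ m o := by rintro rfl; exact hf hqA
        rw [Function.update_of_ne this, hun f hf]
      · intro p hp
        have hp' : p ∉ A.image m := by
          intro hp'
          obtain ⟨a, ha, rfl⟩ := Finset.mem_image.1 hp'
          apply hp
          by_cases hao : a = o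
          · subst hao
            exact Finset.mem_image.2 ⟨x, by simp, by simp⟩
          · refine Finset.mem_image.2 ⟨a, by simp [ha, hao], ?_⟩
            rw [Function.update_of_ne]
            rintro rfl; exact hx ha
        have : p ≠ m o := by rintro rfl; exact hp' hqA
        rw [Function.update_of_ne this, hun p hp']
      · intro i hi p
        by_cases hix : i = x
        · subst hix
          rw [Function.update_self, Function.update_self]
          refine ((hle' i p).trans (hq p)).trans_eq ?_
          rw [Nat.cast_sub hjq]
          simp
        · have hi' : i ≠ o ∧ i ∈ A := by simpa [hix] using hi
          have : m i ≠ m o := fun h => hi'.1 (hm hi'.2 ho h)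
          rw [Function.update_of_ne hix, Function.update_of_ne this]
          exact (hle' i p).trans (hA i hi'.2 p)
    · refine ih _ ?_ (insert x A) j (Function.update m x q) rfl ?_ hj hex ?_ ?_
      · rw [Finset.card_insert_of_notMem hx]
        omega
      · intro a ha b hb hab
        simp only [Finset.coe_insert, Set.mem_insert_iff, Finset.mem_coe] at ha hb
        by_cases hax : a = x <;> by_cases hbx : b = x
        · rw [hax, hbx]
        · subst hax
          simp only [Function.update_self, Function.update_of_ne hbx] at hab
          exact absurd (Finset.mem_image.2 ⟨b, hb.resolve_left hbx, hab.symm⟩) hqA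
        · subst hbx
          simp only [Function.update_self, Function.update_of_ne hax] at hab
          exact absurd (Finset.mem_image.2 ⟨a, ha.resolve_left hax, hab⟩) hqA
        · simp only [Function.update_of_ne hax, Function.update_of_ne hbx] at hab
          exact hm (ha.resolve_left hax) (hb.resolve_left hbx) hab
      · intro p hp
        apply hun
        intro hp'
        obtain ⟨a, ha, rfl⟩ := Finset.mem_image.1 hp'
        refine hp (Finset.mem_image.2 ⟨a, by simp [ha], ?_⟩)
        rw [Function.update_of_ne]
        rintro rfl; exact hx ha
      · intro i hi p
        by_cases hix : i = x
        · subst hix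
          rw [Function.update_self]
          refine (hq p).trans ((hL i q).monotone ?_)
          have := (hu q).le
          gcongr
          linarith
        · rw [Function.update_of_ne hix]
          exact hA i (by simpa [hix] using hi) p
  exact main _ ∅ (fun _ => N) id rfl (by simp) (fun _ => le_rfl) ⟨Classical.arbitrary κ, rfl⟩
    (fun _ _ => rfl) (by simp)

/-- The limit of auctions on finer and finer grids. Along an ultrafilter the assignment and the
piece at its cap are eventually constant, the positions converge by compactness, and the error of
one grid step vanishes. -/
theorem exists_ef_cap {κ : Type*} [Fintype κ] [Nonempty κ] {L : κ → κ → ℝ → ℝ}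
    (hL : ∀ i p, StrictMono (L i p)) (hc : ∀ i p, Continuous (L i p)) (h0 : ∀ i p, L i p 0 = 0)
    {u : κ → ℝ} (hu : ∀ p, 0 < u p) :
    ∃ (y : κ → ℝ) (m : κ → κ), m.Injective ∧ (∀ p, 0 ≤ y p) ∧ (∀ p, y p ≤ u p) ∧
      (∃ p, y p = u p) ∧ EF L y m := by
  classical
  choose j m hm hj hex hef using fun N : ℕ =>
    exists_auction hL h0 hu (N + 1) (Nat.succ_pos N)
  let F : Ultrafilter ℕ := Filter.hyperfilter ℕ
  have hF : (F : Filter ℕ) ≤ Filter.atTop := by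
    rw [← Nat.cofinite_eq_atTop]; exact Filter.hyperfilter_le_cofinite
  obtain ⟨m₀, hm₀⟩ : ∃ m₀, ∀ᶠ N in (F : Filter ℕ), m N = m₀ :=
    Ultrafilter.eventually_exists_iff.1 (Filter.Eventually.of_forall fun N => ⟨m N, rfl⟩)
  obtain ⟨p₀, hp₀⟩ : ∃ p₀, ∀ᶠ N in (F : Filter ℕ), j N p₀ = N + 1 :=
    Ultrafilter.eventually_exists_iff.1 (Filter.Eventually.of_forall fun N => hex N)
  let Y : ℕ → κ → ℝ := fun N p => u p * (j N p / ((N + 1 : ℕ) : ℝ))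
  have hY : ∀ N, Y N ∈ Set.Icc (0 : κ → ℝ) u := by
    intro N
    refine ⟨fun p => ?_, fun p => ?_⟩
    · have := (hu p).le
      simp only [Y, Pi.zero_apply]; positivity
    · have h1 : (j N p / ((N + 1 : ℕ) : ℝ)) ≤ 1 := by
        rw [div_le_one (by positivity)]
        exact_mod_cast hj N p
      exact mul_le_of_le_one_right (hu p).le h1
  obtain ⟨y, hy, hlim⟩ := isCompact_Icc.ultrafilter_le_nhds (F.map Y) (by
    rw [Ultrafilter.coe_map, Filter.le_principal_iff]
    exact Filter.mem_map.2 (Filter.Eventually.of_forall hY))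
  have hlim' : Filter.Tendsto Y F (nhds y) := hlim
  have hlimp : ∀ p, Filter.Tendsto (fun N => Y N p) F (nhds (y p)) :=
    fun p => tendsto_pi_nhds.1 hlim' p
  have hlimq : ∀ p, Filter.Tendsto
      (fun N => u p * ((j N p + 1) / ((N + 1 : ℕ) : ℝ))) F (nhds (y p)) := by
    intro p
    have h1 : Filter.Tendsto (fun N : ℕ => u p * (1 / ((N : ℝ) + 1))) F (nhds (u p * 0)) :=
      (tendsto_one_div_add_atTop_nhds_zero_nat.mono_left hF).const_mul _
    have h2 := (hlimp p).add h1
    rw [mul_zero, add_zero] at h2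
    refine h2.congr fun N => ?_
    simp only [Y]; push_cast; ring
  refine ⟨y, m₀, ?_, hy.1, hy.2, ⟨p₀, ?_⟩, fun i p => ?_⟩
  · obtain ⟨N, hN⟩ := hm₀.exists
    exact hN ▸ hm N
  · refine tendsto_nhds_unique (hlimp p₀) (tendsto_const_nhds.congr' ?_)
    filter_upwards [hp₀] with N hN
    simp only [Y, hN]
    rw [div_self (by positivity), mul_one]
  · refine le_of_tendsto_of_tendsto ((hc i p).continuousAt.tendsto.comp (hlimp p))
      ((hc i (m₀ i)).continuousAt.tendsto.comp (hlimq (m₀ i))) ?_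
    filter_upwards [hm₀] with N hN
    have := hef N i p
    rw [hN] at this
    exact this

/-- An envy-free assignment of trimmed pieces in which every proper set of pieces is left, either
by an untrimmed piece outside the set, or by an agent of the set that is indifferent to a piece
outside the set. -/
theorem exists_ef_graph {ι : Type*} [Fintype ι] {L : ι → ι → ℝ → ℝ}
    (hL : ∀ i p, StrictMono (L i p)) (hc : ∀ i p, Continuous (L i p)) (h0 : ∀ i p, L i p 0 = 0) :
    ∃ (y : ι → ℝ) (m : ι → ι), m.Injective ∧ (∀ p, 0 ≤ y p) ∧ (∀ p, y p ≤ 1) ∧ EF L y m ∧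
      ∀ Q : Set ι, Q ≠ univ → (∃ p, p ∉ Q ∧ y p = 1) ∨
        ∃ i, m i ∈ Q ∧ ∃ p, p ∉ Q ∧ L i p (y p) = L i (m i) (y (m i)) := by
  classical
  -- The trimmings that are envy-free under some assignment form a compact set; one of maximal total
  -- length has the required property, since a set `Q` that is not left would permit a longer one.
  let S : Set (ι → ℝ) := ⋃ m ∈ {m : ι → ι | m.Injective}, Set.Icc 0 1 ∩ {y | EF L y m}
  have hS : IsCompact S := by
    refine (Set.toFinite _).isCompact_biUnion fun m _ => isCompact_Icc.inter_right ?_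
    simp only [EF, Set.ofPred_forall]
    refine isClosed_iInter fun i => isClosed_iInter fun p => isClosed_le ?_ ?_
    exacts [(hc i p).comp (continuous_apply p), (hc i _).comp (continuous_apply _)]
  have hS0 : S.Nonempty := by
    refine ⟨0, Set.mem_biUnion (x := id) Function.injective_id
      ⟨⟨le_rfl, fun _ => zero_le_one⟩, fun i p => ?_⟩⟩
    simp [h0]
  obtain ⟨y, hyS, hmax⟩ := hS.exists_isMaxOn hS0
    (f := fun y => ∑ p, y p) (by fun_prop)
  simp only [S, Set.mem_iUnion, Set.mem_ofPred_eq, exists_prop] at hyS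
  obtain ⟨m, hm, hy, hef⟩ := hyS
  refine ⟨y, m, hm, hy.1, hy.2, hef, fun Q hQ => ?_⟩
  by_contra! hcon
  obtain ⟨hcon1, hcon2⟩ := hcon
  let e : ι ≃ ι := Equiv.ofBijective m (Finite.injective_iff_bijective.1 hm)
  have hme : ∀ p, m (e.symm p) = p := fun p => e.apply_symm_apply p
  obtain ⟨x, hx⟩ : ∃ x, x ∉ Q := by
    by_contra! h
    exact hQ (Set.eq_univ_of_forall h)
  have : Nonempty {p // p ∉ Q} := ⟨⟨x, hx⟩⟩
  -- The pieces outside `Q` are all trimmed, and the owners of pieces in `Q` strictly prefer their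
  -- own. So there is room to lengthen every piece outside `Q` up to a cap `u` without envy from
  -- these owners.
  have hcap : ∀ p : {p // p ∉ Q}, ∃ t, y p < t ∧ t ≤ 1 ∧
      ∀ i, m i ∈ Q → L i p t ≤ L i (m i) (y (m i)) := by
    rintro ⟨p, hp⟩
    have h1 : ∀ᶠ t in nhdsWithin (y p) (Set.Ioi (y p)), t < 1 ∧
        ∀ i, m i ∈ Q → L i p t < L i (m i) (y (m i)) := by
      refine Filter.Eventually.filter_mono nhdsWithin_le_nhds ?_
      refine (eventually_lt_nhds (lt_of_le_of_ne (hy.2 p) (hcon1 p hp))).and ?_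
      rw [Filter.eventually_all]
      intro i
      by_cases hi : m i ∈ Q
      · simp only [hi, forall_const]
        exact (hc i p).continuousAt.eventually_lt_const
          (lt_of_le_of_ne (hef i p) (hcon2 i hi p hp))
      · simp [hi]
    obtain ⟨t, ⟨ht1, ht2⟩, ht3⟩ := (h1.and self_mem_nhdsWithin).exists
    exact ⟨t, ht3, ht1.le, fun i hi => (ht2 i hi).le⟩
  choose u hu1 hu2 hu3 using hcap
  let L' : {p // p ∉ Q} → {p // p ∉ Q} → ℝ → ℝ := fun a b => L (e.symm a) b
  obtain ⟨w, σ, hσ, hw0, hwu, ⟨p₀, hp₀⟩, hwσ⟩ := exists_ef_cap (L := L') (fun a b => hL _ _)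
    (fun a b => hc _ _) (fun a b => h0 _ _) (u := u)
    (fun p => lt_of_le_of_lt (hy.1 p) (hu1 p))
  have hid : EF L' (fun p => y p) id := by
    intro a b
    have := hef (e.symm a) b
    rw [hme] at this
    exact this
  -- The solution with caps may shorten some pieces; its join with `y` shortens none and lengthens
  -- the piece at its cap.
  obtain ⟨τ, hτ, hzτ⟩ := hid.join (fun a b => hL _ _) hwσ Function.injective_id hσ
  let z : {p // p ∉ Q} → ℝ := fun p => max (y p) (w p)
  have hzu : ∀ p, z p ≤ u p := fun p => max_le (hu1 p).le (hwu p)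
  have hyz : ∀ p : {p // p ∉ Q}, y p ≤ z p := fun p => le_max_left _ _
  let y' : ι → ℝ := fun p => if h : p ∈ Q then y p else z ⟨p, h⟩
  let m' : ι → ι := fun i => if h : m i ∈ Q then m i else τ ⟨m i, h⟩
  have hy'Q : ∀ p, p ∈ Q → y' p = y p := fun p hp => dif_pos hp
  have hy'X : ∀ p : {p // p ∉ Q}, y' p = z p := fun p => dif_neg p.2
  have hyy' : ∀ p, y p ≤ y' p := by
    intro p
    by_cases hp : p ∈ Q
    · exact (hy'Q p hp).ge
    · rw [hy'X ⟨p, hp⟩]; exact hyz ⟨p, hp⟩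
  have hy'S : y' ∈ S := by
    refine Set.mem_biUnion (x := m') ?_ ⟨⟨fun p => (hy.1 p).trans (hyy' p), fun p => ?_⟩, ?_⟩
    · intro a b hab
      simp only [m'] at hab
      split_ifs at hab with ha hb hb
      · exact hm hab
      · exact absurd (hab ▸ ha) (τ ⟨m b, hb⟩).2
      · exact absurd (hab ▸ hb) (τ ⟨m a, ha⟩).2
      · exact hm (Subtype.ext_iff.1 (hτ (Subtype.ext hab)))
    · by_cases hp : p ∈ Q
      · rw [hy'Q p hp]; exact hy.2 p
      · rw [hy'X ⟨p, hp⟩]; exact (hzu _).trans (hu2 _)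
    · intro i p
      by_cases hi : m i ∈ Q
      · have hm'i : m' i = m i := dif_pos hi
        rw [hm'i, hy'Q _ hi]
        by_cases hp : p ∈ Q
        · rw [hy'Q p hp]; exact hef i p
        · rw [hy'X ⟨p, hp⟩]
          exact ((hL i p).monotone (hzu ⟨p, hp⟩)).trans (hu3 ⟨p, hp⟩ i hi)
      · have hm'i : m' i = τ ⟨m i, hi⟩ := dif_neg hi
        have key : ∀ b : {p // p ∉ Q}, L i b (z b) ≤ L i (τ ⟨m i, hi⟩) (z (τ ⟨m i, hi⟩)) := by
          intro b
          have h1 := hzτ ⟨m i, hi⟩ b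
          have h2 : e.symm (m i) = i := e.symm_apply_apply i
          simpa only [L', h2] using h1
        rw [hm'i, hy'X]
        by_cases hp : p ∈ Q
        · rw [hy'Q p hp]
          exact ((hef i p).trans ((hL i (m i)).monotone (hyz ⟨m i, hi⟩))).trans (key ⟨m i, hi⟩)
        · rw [hy'X ⟨p, hp⟩]; exact key ⟨p, hp⟩
  have hlt : ∑ p, y p < ∑ p, y' p := by
    refine Finset.sum_lt_sum (fun p _ => hyy' p) ⟨p₀, Finset.mem_univ _, ?_⟩
    rw [hy'X]
    exact (hu1 p₀).trans_le (hp₀.ge.trans (le_max_right _ _))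
  exact absurd (hmax hy'S) (not_le.2 hlt)

end Existence
/-! ### Computing an envy-free assignment of trimmed pieces -/

/-- Finitely many known levels become functions to which `exists_ef_graph` applies; beyond the last
but one point the extension is linear. -/
theorem exists_strictMono_extension (s : Finset ℝ) (f : ℝ → ℝ) :
    StrictMonoOn f s → ∃ g : ℝ → ℝ, StrictMono g ∧ Continuous g ∧ ∀ x ∈ s, g x = f x := by
  induction s using Finset.induction_on_max with
  | empty => exact fun _ => ⟨id, strictMono_id, continuous_id, by simp⟩
  | insert b s hb ih =>
    intro hf
    obtain ⟨g, hg, hgc, hgs⟩ := ih (hf.mono (by simp))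
    rcases s.eq_empty_or_nonempty with rfl | hs
    · refine ⟨fun x => x + (f b - b), fun x y h => by simpa using h, by fun_prop, ?_⟩
      intro x hx
      obtain rfl : x = b := by simpa using hx
      simp
    obtain ⟨M, hM, hmax⟩ := Finset.exists_max_image s id hs
    have hMb : M < b := hb M hM
    have hfM : f M < f b := hf (by simp [hM]) (by simp) hMb
    have hκ : 0 < (f b - f M) / (b - M) := div_pos (by linarith) (by linarith)
    refine ⟨fun x => g (min x M) + (f b - f M) / (b - M) * max (x - M) 0, fun x y hxy => ?_,
      by fun_prop, fun x hx => ?_⟩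
    · simp only
      have h1 : max (x - M) 0 ≤ max (y - M) 0 := max_le_max (by linarith) le_rfl
      have h2 : g (min x M) ≤ g (min y M) := hg.monotone (min_le_min hxy.le le_rfl)
      rcases lt_or_ge x M with h | h
      · have : g (min x M) < g (min y M) := by
          apply hg
          rw [min_eq_left h.le]
          exact lt_min hxy h
        have := mul_le_mul_of_nonneg_left h1 hκ.le
        linarith
      · rw [max_eq_left (by linarith : 0 ≤ x - M), max_eq_left (by linarith : 0 ≤ y - M)]
        have := mul_lt_mul_of_pos_left (by linarith : x - M < y - M) hκ
        linarith
    · simp only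
      rcases Finset.mem_insert.1 hx with rfl | hx
      · rw [min_eq_right hMb.le, max_eq_left (by linarith), hgs M hM,
          div_mul_cancel₀ _ (by linarith : 0 < x - M).ne']
        ring
      · have : x ≤ M := hmax x hx
        rw [min_eq_left this, max_eq_right (by linarith), hgs x hx]
        ring

theorem eq_univ_of_growing {ι : Type*} [Fintype ι] (R : ℕ → Set ι) (hR : ∀ t, R t ⊆ R (t + 1))
    (hs : ∀ t < Fintype.card ι, R t ≠ univ → ∃ p, p ∉ R t ∧ p ∈ R (t + 1)) : R (Fintype.card ι) = univ := by
  have key : ∀ t ≤ Fintype.card ι, R t = univ ∨ t ≤ (R t).ncard := by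
    intro t
    induction t with
    | zero => intro _; right; omega
    | succ t ih =>
      intro htc
      by_cases h : R t = univ
      · left; exact Set.univ_subset_iff.1 (h ▸ hR t)
      · right
        obtain ⟨p, hp, hp'⟩ := hs t (by omega) h
        have := Set.ncard_lt_ncard (Set.ssubset_iff_of_subset (hR t) |>.2 ⟨p, hp', hp⟩)
          (Set.toFinite _)
        have := (ih (by omega)).resolve_left h
        omega
  rcases key (Fintype.card ι) le_rfl with h | h
  · exact h
  · refine Set.eq_of_subset_of_ncard_le (Set.subset_univ _) ?_ (Set.toFinite _)
    rwa [Set.ncard_univ, Nat.card_eq_fintype_card]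

/-- Finitely many positions on each of the pieces, with levels that refine the order of the values
of each agent to a strictly monotone one. -/
structure World (ι Pos : Type*) where
  known : ι → Finset ℝ
  pos : ι → ℝ → Pos
  lev : ι → ι → ℝ → ℝ

namespace World

variable {ι Pos : Type*}

/-- `W'` contains all data of `W`. -/
structure Ext (W W' : World ι Pos) : Prop where
  known : ∀ p, W.known p ⊆ W'.known p
  pos : ∀ p, ∀ c ∈ W.known p, W'.pos p c = W.pos p c
  lev : ∀ i p, ∀ c ∈ W.known p, W'.lev i p c = W.lev i p c

theorem Ext.refl (W : World ι Pos) : W.Ext W :=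
  ⟨fun _ => le_rfl, fun _ _ _ => rfl, fun _ _ _ _ => rfl⟩

theorem Ext.trans {W W' W'' : World ι Pos} (h : W.Ext W') (h' : W'.Ext W'') : W.Ext W'' :=
  ⟨fun p => (h.known p).trans (h'.known p),
    fun p c hc => (h'.pos p c (h.known p hc)).trans (h.pos p c hc),
    fun i p c hc => (h'.lev i p c (h.known p hc)).trans (h.lev i p c hc)⟩

/-- The data are consistent with the valuations of the agents `a` of the members of the families `X`
between `s₀` and `s₁`. -/
structure Valid [LinearOrder Pos] (a : ι → Fin n) (X : ι → Pos → Set Cake) (s₀ s₁ : ι → Pos)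
    (P : Set (Prof n)) (W : World ι Pos) : Prop where
  zero_mem : ∀ p, 0 ∈ W.known p
  one_mem : ∀ p, 1 ∈ W.known p
  nonneg : ∀ p, ∀ c ∈ W.known p, 0 ≤ c
  le_one : ∀ p, ∀ c ∈ W.known p, c ≤ 1
  pos_mono : ∀ p, ∀ c ∈ W.known p, ∀ d ∈ W.known p, c ≤ d → W.pos p c ≤ W.pos p d
  pos_zero : ∀ p, W.pos p 0 = s₀ p
  pos_one : ∀ p, W.pos p 1 = s₁ p
  kn : ∀ p, ∀ c ∈ W.known p, Kn P (X p (W.pos p c))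
  strict : ∀ i p, StrictMonoOn (W.lev i p) (W.known p)
  lev_zero : ∀ i p, W.lev i p 0 = 0
  compat : ∀ v ∈ P, ∀ i p q, ∀ c ∈ W.known p, ∀ d ∈ W.known q, W.lev i p c ≤ W.lev i q d →
    (v (a i)).value (X p (W.pos p c)) ≤ (v (a i)).value (X q (W.pos q d))

variable [LinearOrder Pos] {a : ι → Fin n} {X : ι → Pos → Set Cake} {s₀ s₁ : ι → Pos}
  {P : Set (Prof n)} {W : World ι Pos}

theorem Valid.anti {P' : Set (Prof n)} (h : W.Valid a X s₀ s₁ P) (hP : P' ⊆ P) :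
    W.Valid a X s₀ s₁ P' :=
  { h with
    kn := fun p c hc => (h.kn p c hc).anti hP
    compat := fun v hv => h.compat v (hP hv) }

/-- A level can be realised on any piece on which it is not exceeded from below. -/
theorem Valid.reach_insert [Fintype ι] (h : W.Valid a X s₀ s₁ P) (hP : P.Nonempty)
    (hX : ∀ p, Markable P (X p)) (hXm : ∀ p, Monotone (X p)) (i p q : ι) {c : ℝ} (hc : c ∈ W.known q)
    (hle : W.lev i q c ≤ W.lev i p 1) :
    Reach (fun P' => ∃ W', W.Ext W' ∧ W'.Valid a X s₀ s₁ P' ∧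
      ∃ d ∈ W'.known p, W'.lev i p d = W.lev i q c) 1 P := by
  classical
  obtain ⟨v₀, hv₀⟩ := hP
  by_cases hex : ∃ d ∈ W.known p, W.lev i p d = W.lev i q c
  · exact Reach.done ⟨W, Ext.refl W, h, hex⟩
  push Not at hex
  obtain ⟨c₁, hc₁, hmax⟩ := Finset.exists_max_image
    ((W.known p).filter fun d => W.lev i p d < W.lev i q c) id
    ⟨0, Finset.mem_filter.2 ⟨h.zero_mem p, lt_of_le_of_ne (by
      rw [h.lev_zero, ← h.lev_zero i q]
      exact (h.strict i q).monotoneOn (h.zero_mem q) hc (h.nonneg q c hc)) (hex 0 (h.zero_mem p))⟩⟩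
  obtain ⟨c₂, hc₂, hmin⟩ := Finset.exists_min_image
    ((W.known p).filter fun d => W.lev i q c < W.lev i p d) id
    ⟨1, Finset.mem_filter.2 ⟨h.one_mem p, lt_of_le_of_ne hle (hex 1 (h.one_mem p)).symm⟩⟩
  obtain ⟨hc₁, hl₁⟩ := Finset.mem_filter.1 hc₁
  obtain ⟨hc₂, hl₂⟩ := Finset.mem_filter.1 hc₂
  have h12 : c₁ < c₂ := (h.strict i p).lt_iff_lt hc₁ hc₂ |>.1 (hl₁.trans hl₂)
  have hgap : ∀ d ∈ W.known p, d ≤ c₁ ∨ c₂ ≤ d := fun d hd => by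
    rcases lt_or_gt_of_ne (hex d hd) with h1 | h1
    · left; exact hmax d (Finset.mem_filter.2 ⟨hd, h1⟩)
    · right; exact hmin d (Finset.mem_filter.2 ⟨hd, h1⟩)
  -- Coordinates are labels that only record the order of the positions, so any number between the
  -- neighbours `c₁` and `c₂` will do.
  obtain ⟨d, hd₁, hd₂⟩ := exists_between h12
  have hd : d ∉ W.known p := fun hd => by
    rcases hgap d hd with h1 | h1 <;> linarith
  refine (hX p P le_rfl v₀ hv₀ (W.pos p c₁) (W.pos p c₂) (h.pos_mono p c₁ hc₁ c₂ hc₂ h12.le)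
    (h.kn p c₁ hc₁) (h.kn p c₂ hc₂) (a i) ((v₀ (a i)).value (X q (W.pos q c)))
    (h.compat v₀ hv₀ i p q c₁ hc₁ c hc hl₁.le) (h.compat v₀ hv₀ i q p c hc c₂ hc₂ hl₂.le)).imp
    ⟨v₀, hv₀⟩ ?_
  rintro P' hP' ⟨w, hw⟩ ⟨s, hs₁, hs₂, hks, hsv⟩
  have hc₀ : Kn P (X q (W.pos q c)) := h.kn q c hc
  replace h := h.anti hP'
  -- The new position needs a level for every agent. For agent `i` it is the prescribed one. For any
  -- other agent it is placed above all levels of smaller value and below all levels of larger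
  -- value, and also strictly between its neighbours on the piece; ties in value are thereby broken
  -- consistently.
  have hlev : ∀ k, ∃ l, (k = i → l = W.lev i q c) ∧ W.lev k p c₁ < l ∧ l < W.lev k p c₂ ∧
      ∀ r, ∀ e ∈ W.known r,
        (W.lev k r e ≤ l → (w (a k)).value (X r (W.pos r e)) ≤ (w (a k)).value (X p s)) ∧
        (l ≤ W.lev k r e → (w (a k)).value (X p s) ≤ (w (a k)).value (X r (W.pos r e))) := by
    intro k
    by_cases hki : k = i
    · subst hki
      refine ⟨W.lev k q c, fun _ => rfl, hl₁, hl₂, fun r e he => ?_⟩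
      rw [hsv w hw, hc₀.value_eq hv₀ (hP' hw)]
      exact ⟨h.compat w hw k r q e he c hc, h.compat w hw k q r c hc e he⟩
    have hv₁ : (w (a k)).value (X p (W.pos p c₁)) ≤ (w (a k)).value (X p s) :=
      (w (a k)).value_mono (h.kn p c₁ hc₁).reg hks.reg (hXm p hs₁)
    have hv₂ : (w (a k)).value (X p s) ≤ (w (a k)).value (X p (W.pos p c₂)) :=
      (w (a k)).value_mono hks.reg (h.kn p c₂ hc₂).reg (hXm p hs₂)
    have hlt : ∀ r, ∀ e ∈ W.known r, ∀ r', ∀ e' ∈ W.known r',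
        (w (a k)).value (X r (W.pos r e)) < (w (a k)).value (X r' (W.pos r' e')) →
          W.lev k r e < W.lev k r' e' := by
      intro r e he r' e' he' hlt
      by_contra hcon
      exact absurd (h.compat w hw k r' r e' he' e he (not_lt.1 hcon)) (not_le.2 hlt)
    obtain ⟨l, hlo, hhi⟩ := Order.exists_between_finsets
      (insert (W.lev k p c₁) (Finset.univ.biUnion fun r => ((W.known r).filter fun e =>
        (w (a k)).value (X r (W.pos r e)) < (w (a k)).value (X p s)).image (W.lev k r)))
      (insert (W.lev k p c₂) (Finset.univ.biUnion fun r => ((W.known r).filter fun e =>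
        (w (a k)).value (X p s) < (w (a k)).value (X r (W.pos r e))).image (W.lev k r))) (by
        intro x hx y hy
        simp only [Finset.mem_insert, Finset.mem_biUnion, Finset.mem_univ, true_and,
          Finset.mem_image, Finset.mem_filter] at hx hy
        rcases hx with rfl | ⟨r, e, ⟨he, hve⟩, rfl⟩ <;> rcases hy with rfl | ⟨r', e', ⟨he', hve'⟩, rfl⟩
        · exact h.strict k p hc₁ hc₂ h12
        · exact hlt _ _ hc₁ _ _ he' (hv₁.trans_lt hve')
        · exact hlt _ _ he _ _ hc₂ (hve.trans_le hv₂)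
        · exact hlt _ _ he _ _ he' (hve.trans hve'))
    refine ⟨l, fun hk => absurd hk hki, hlo _ (by simp), hhi _ (by simp), fun r e he => ⟨?_, ?_⟩⟩
    · intro hle
      by_contra hcon
      refine absurd hle (not_le.2 (hhi _ (Finset.mem_insert_of_mem ?_)))
      exact Finset.mem_biUnion.2 ⟨r, Finset.mem_univ r, Finset.mem_image.2
        ⟨e, Finset.mem_filter.2 ⟨he, not_le.1 hcon⟩, rfl⟩⟩
    · intro hle
      by_contra hcon
      refine absurd hle (not_le.2 (hlo _ (Finset.mem_insert_of_mem ?_)))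
      exact Finset.mem_biUnion.2 ⟨r, Finset.mem_univ r, Finset.mem_image.2
        ⟨e, Finset.mem_filter.2 ⟨he, not_le.1 hcon⟩, rfl⟩⟩
  choose l hli hl1 hl2 hlc using hlev
  let W' : World ι Pos :=
    { known := fun r => if r = p then insert d (W.known p) else W.known r
      pos := fun r e => if r = p ∧ e = d then s else W.pos r e
      lev := fun k r e => if r = p ∧ e = d then l k else W.lev k r e }
  have hmem : ∀ r e, e ∈ W'.known r → e ∈ W.known r ∨ (r = p ∧ e = d) := by
    intro r e he
    by_cases hr : r = p
    · subst hr
      simp only [W', if_true, Finset.mem_insert] at he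
      rcases he with rfl | he
      exacts [Or.inr ⟨rfl, rfl⟩, Or.inl he]
    · simp only [W', if_neg hr] at he
      exact Or.inl he
  have hmem₁ : ∀ r, W.known r ⊆ W'.known r := by
    intro r e he
    by_cases hr : r = p
    · subst hr
      simp [W', he]
    · simpa only [W', if_neg hr] using he
  have hnew : d ∈ W'.known p := by simp [W']
  have hne : ∀ r, ∀ e ∈ W.known r, ¬ (r = p ∧ e = d) := by
    rintro r e he ⟨rfl, rfl⟩
    exact hd he
  have hpos : ∀ r, ∀ e ∈ W.known r, W'.pos r e = W.pos r e := fun r e he => if_neg (hne r e he)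
  have hlev : ∀ k r, ∀ e ∈ W.known r, W'.lev k r e = W.lev k r e :=
    fun k r e he => if_neg (hne r e he)
  have hposd : W'.pos p d = s := if_pos ⟨rfl, rfl⟩
  have hlevd : ∀ k, W'.lev k p d = l k := fun k => if_pos ⟨rfl, rfl⟩
  have hkn' : ∀ r, ∀ e ∈ W'.known r, Kn P' (X r (W'.pos r e)) := by
    intro r e he
    rcases hmem r e he with he | ⟨rfl, rfl⟩
    · rw [hpos r e he]; exact h.kn r e he
    · rw [hposd]; exact hks
  refine ⟨W', ⟨hmem₁, hpos, hlev⟩, ⟨fun r => hmem₁ r (h.zero_mem r), fun r => hmem₁ r (h.one_mem r),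
    ?_, ?_, ?_, fun r => (hpos r 0 (h.zero_mem r)).trans (h.pos_zero r),
    fun r => (hpos r 1 (h.one_mem r)).trans (h.pos_one r), hkn', ?_,
    fun k r => (hlev k r 0 (h.zero_mem r)).trans (h.lev_zero k r), ?_⟩,
    d, hnew, (hlevd i).trans (hli i rfl)⟩
  · intro r e he
    rcases hmem r e he with he | ⟨rfl, rfl⟩
    · exact h.nonneg r e he
    · exact (h.nonneg _ _ hc₁).trans hd₁.le
  · intro r e he
    rcases hmem r e he with he | ⟨rfl, rfl⟩
    · exact h.le_one r e he
    · exact hd₂.le.trans (h.le_one _ _ hc₂)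
  · intro r e he e' he' hee
    rcases hmem r e he with he₁ | ⟨rfl, rfl⟩
    · rcases hmem r e' he' with he' | ⟨rfl, rfl⟩
      · rw [hpos r e he₁, hpos r e' he']
        exact h.pos_mono r e he₁ e' he' hee
      · rw [hpos r e he₁, hposd]
        rcases hgap e he₁ with h1 | h1
        · exact (h.pos_mono r e he₁ c₁ hc₁ h1).trans hs₁
        · linarith
    · rcases hmem r e' he' with he' | ⟨-, rfl⟩
      · rw [hpos r e' he', hposd]
        rcases hgap e' he' with h1 | h1
        · linarith
        · exact hs₂.trans (h.pos_mono r c₂ hc₂ e' he' h1)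
      · exact le_rfl
  · intro k r e he e' he' hee
    rw [Finset.mem_coe] at he he'
    rcases hmem r e he with he₁ | ⟨rfl, rfl⟩
    · rcases hmem r e' he' with he' | ⟨rfl, rfl⟩
      · rw [hlev k r e he₁, hlev k r e' he']
        exact h.strict k r he₁ he' hee
      · rw [hlev k r e he₁, hlevd]
        rcases hgap e he₁ with h1 | h1
        · exact ((h.strict k r).monotoneOn he₁ hc₁ h1).trans_lt (hl1 k)
        · linarith
    · rcases hmem r e' he' with he' | ⟨-, rfl⟩
      · rw [hlev k r e' he', hlevd]
        rcases hgap e' he' with h1 | h1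
        · linarith
        · exact (hl2 k).trans_le ((h.strict k r).monotoneOn hc₂ he' h1)
      · exact absurd hee (lt_irrefl _)
  · intro v hv k r r' e he e' he'
    rw [(hkn' r e he).value_eq hv hw, (hkn' r' e' he').value_eq hv hw]
    rcases hmem r e he with he₁ | ⟨rfl, rfl⟩
    · rcases hmem r' e' he' with he' | ⟨rfl, rfl⟩
      · rw [hpos r e he₁, hpos r' e' he', hlev k r e he₁, hlev k r' e' he']
        exact h.compat w hw k r r' e he₁ e' he'
      · rw [hpos r e he₁, hposd, hlev k r e he₁, hlevd]
        exact (hlc k r e he₁).1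
    · rcases hmem r' e' he' with he' | ⟨rfl, rfl⟩
      · rw [hpos r' e' he', hposd, hlev k r' e' he', hlevd]
        exact (hlc k r' e' he').2
      · exact fun _ => le_rfl

end World

/-! ### Iterated trimming for a fixed assignment -/

namespace World

variable {ι Pos : Type*} {W W' : World ι Pos}

/-- Every piece is trimmed as little as possible so that, for every agent, no other piece is better
than her own piece of the previous round. -/
structure Step (W : World ι Pos) (m : ι → ι) (c d : ι → ℝ) : Prop where
  mem : ∀ p, c p ∈ W.known p
  mem' : ∀ p, d p ∈ W.known p
  eq : ∀ p, d p = 1 ∨ ∃ i, m i ≠ p ∧ W.lev i p (d p) = W.lev i (m i) (c (m i))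
  le : ∀ p i, m i ≠ p → W.lev i p (d p) ≤ W.lev i (m i) (c (m i))

theorem Step.ext {m : ι → ι} {c d : ι → ℝ} (h : W.Step m c d) (hW : W.Ext W') :
    W'.Step m c d where
  mem p := hW.known p (h.mem p)
  mem' p := hW.known p (h.mem' p)
  eq p := by
    simp_rw [hW.lev _ p _ (h.mem' p), fun i => hW.lev i (m i) _ (h.mem (m i))]
    exact h.eq p
  le p i hi := by
    rw [hW.lev _ p _ (h.mem' p), hW.lev i (m i) _ (h.mem (m i))]
    exact h.le p i hi

variable [Fintype ι] [LinearOrder Pos] {a : ι → Fin n} {X : ι → Pos → Set Cake} {s₀ s₁ : ι → Pos}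
  {P : Set (Prof n)}

/-- For each of the `k ^ 2` pairs of an agent `i` and a piece `p`, the level that `i` attains on her
own piece at `c` is marked on `p`, provided that `p` reaches it. Then `d p` is the least position on
`p` that is 1 or such a mark of an agent other than the owner of `p`. -/
theorem Valid.reach_step (h : W.Valid a X s₀ s₁ P) (hP : P.Nonempty)
    (hX : ∀ p, Markable P (X p)) (hXm : ∀ p, Monotone (X p)) (m : ι → ι) (c : ι → ℝ)
    (hc : ∀ p, c p ∈ W.known p) :
    Reach (fun P' => ∃ W', W.Ext W' ∧ W'.Valid a X s₀ s₁ P' ∧ ∃ d, W'.Step m c d)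
      (Fintype.card ι ^ 2) P := by
  classical
  refine ((Reach.forall_finset (Finset.univ : Finset (ι × ι))
    (fun P' W' => W.Ext W' ∧ W'.Valid a X s₀ s₁ P' ∧ ∀ p, Markable P' (X p)) Ext Ext.refl
    (fun _ _ _ => Ext.trans)
    (fun x _ W' => W.lev x.1 (m x.1) (c (m x.1)) ≤ W.lev x.1 x.2 1 →
      ∃ d ∈ W'.known x.2, W'.lev x.1 x.2 d = W.lev x.1 (m x.1) (c (m x.1))) ?_ 1 ?_ P W hP
      ⟨Ext.refl W, h, hX⟩).mono (by simp [sq])).imp hP ?_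
  · rintro ⟨i, p⟩ P P' W₁ W₂ - hW hΨ hle
    obtain ⟨d, hd, hd'⟩ := hΨ hle
    exact ⟨d, hW.known _ hd, (hW.lev _ _ _ hd).trans hd'⟩
  · rintro ⟨i, p⟩ - P W₁ hP ⟨hW, hv, hX⟩
    by_cases hle : W.lev i (m i) (c (m i)) ≤ W.lev i p 1
    · have e1 := hW.lev i (m i) _ (hc (m i))
      have e2 := hW.lev i p 1 (h.one_mem p)
      refine (hv.reach_insert hP hX hXm i p (m i) (hW.known _ (hc (m i))) (by rwa [e1, e2])).imp
        hP ?_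
      rintro P' hP' - ⟨W₂, h1, h2, d, hd, hd'⟩
      exact ⟨W₂, h1, ⟨hW.trans h1, h2, fun p => (hX p).anti hP'⟩, fun _ => ⟨d, hd, hd'.trans e1⟩⟩
    · exact Reach.done ⟨W₁, Ext.refl W₁, ⟨hW, hv, hX⟩, fun h => absurd h hle⟩
  rintro P' hP' - ⟨W₁, -, ⟨hW, hv, -⟩, hΨ⟩
  have hmin : ∀ p, ∃ d ∈ W₁.known p,
      (d = 1 ∨ ∃ i, m i ≠ p ∧ W₁.lev i p d = W₁.lev i (m i) (c (m i))) ∧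
      ∀ e ∈ W₁.known p, (e = 1 ∨ ∃ i, m i ≠ p ∧ W₁.lev i p e = W₁.lev i (m i) (c (m i))) →
        d ≤ e := by
    intro p
    obtain ⟨d, hd, hmin⟩ := Finset.exists_min_image ((W₁.known p).filter fun d =>
      d = 1 ∨ ∃ i, m i ≠ p ∧ W₁.lev i p d = W₁.lev i (m i) (c (m i))) id
      ⟨1, Finset.mem_filter.2 ⟨hv.one_mem p, Or.inl rfl⟩⟩
    obtain ⟨hd, hd'⟩ := Finset.mem_filter.1 hd
    exact ⟨d, hd, hd', fun e he he' => hmin e (Finset.mem_filter.2 ⟨he, he'⟩)⟩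
  choose d hd hd' hdmin using hmin
  refine ⟨W₁, hW, hv, d, fun p => hW.known p (hc p), hd, hd', fun p i hi => ?_⟩
  have e1 := hW.lev i (m i) _ (hc (m i))
  have e2 := hW.lev i p 1 (h.one_mem p)
  by_cases hle : W.lev i (m i) (c (m i)) ≤ W.lev i p 1
  · obtain ⟨e, he, he'⟩ := hΨ (i, p) (Finset.mem_univ _) hle
    rw [e1, ← he']
    exact (hv.strict i p).monotoneOn (hd p) he
      (hdmin p e he (Or.inr ⟨i, hi, by rw [e1]; exact he'⟩))
  · rw [e1]
    refine le_trans ?_ (not_le.1 hle).le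
    rw [← e2]
    exact (hv.strict i p).monotoneOn (hd p) (hv.one_mem p) (hv.le_one p _ (hd p))

theorem Valid.reach_steps (T : ℕ) (h : W.Valid a X s₀ s₁ P) (hP : P.Nonempty)
    (hX : ∀ p, Markable P (X p)) (hXm : ∀ p, Monotone (X p)) (m : ι → ι) :
    Reach (fun P' => ∃ W', W.Ext W' ∧ W'.Valid a X s₀ s₁ P' ∧ ∃ c : ℕ → ι → ℝ,
      (∀ p, c 0 p = 1) ∧ (∀ t ≤ T, ∀ p, c t p ∈ W'.known p) ∧
      ∀ t < T, W'.Step m (c t) (c (t + 1))) (T * Fintype.card ι ^ 2) P := by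
  induction T with
  | zero =>
    refine Reach.done ⟨W, Ext.refl W, h, fun _ _ => 1, fun _ => rfl, fun t ht p => h.one_mem p, ?_⟩
    intro t ht; omega
  | succ T ih =>
    rw [Nat.succ_mul]
    refine ih.bind hP ?_
    rintro P' hP' hne ⟨W₁, hW₁, hv₁, c, hc0, hcm, hcs⟩
    refine (hv₁.reach_step hne (fun p => (hX p).anti hP') hXm m (c T) (hcm T le_rfl)).imp hne ?_
    rintro P'' - - ⟨W₂, hW₂, hv₂, d, hd⟩
    have hold : ∀ t ≤ T, Function.update c (T + 1) d t = c t := fun t ht =>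
      Function.update_of_ne (by omega) _ _
    refine ⟨W₂, hW₁.trans hW₂, hv₂, Function.update c (T + 1) d, ?_, ?_, ?_⟩
    · rw [hold 0 (Nat.zero_le _)]; exact hc0
    · intro t ht p
      rcases Nat.lt_or_ge T t with h | h
      · obtain rfl : t = T + 1 := by omega
        rw [Function.update_self]; exact hd.mem' p
      · rw [hold t h]; exact hW₂.known p (hcm t h p)
    · intro t ht
      rw [hold t (by omega)]
      rcases Nat.lt_or_ge t T with h | h
      · rw [hold _ (by omega)]
        exact (hcs t h).ext hW₂
      · obtain rfl : t = T := by omega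
        rw [Function.update_self]; exact hd

/-- The positions of an envy-free assignment are found by the iterated steps. -/
theorem Valid.exists_known_ef (h : W.Valid a X s₀ s₁ P)
    (hW : ∀ m : ι → ι, m.Injective → ∃ c : ℕ → ι → ℝ,
      (∀ p, c 0 p = 1) ∧ (∀ t ≤ Fintype.card ι, ∀ p, c t p ∈ W.known p) ∧
      ∀ t < Fintype.card ι, W.Step m (c t) (c (t + 1))) :
    ∃ (y : ι → ℝ) (m : ι → ι), m.Injective ∧ (∀ p, y p ∈ W.known p) ∧
      (∀ i p, W.lev i p (y p) ≤ W.lev i (m i) (y (m i))) ∧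
      ∀ Q : Set ι, Q ≠ univ → (∃ p, p ∉ Q ∧ y p = 1) ∨
        ∃ i, m i ∈ Q ∧ ∃ p, p ∉ Q ∧ W.lev i p (y p) = W.lev i (m i) (y (m i)) := by
  choose L hL hLc hLW using fun i p =>
    exists_strictMono_extension (W.known p) (W.lev i p) (h.strict i p)
  -- The assignment `m` depends on the extension of the levels and cannot be foreseen, which is why
  -- the rounds are required for every injective `m`.
  obtain ⟨y, m, hm, -, hy1, hef, hgr⟩ := exists_ef_graph hL hLc fun i p =>
    (hLW i p 0 (h.zero_mem p)).trans (h.lev_zero i p)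
  obtain ⟨c, hc0, hcm, hcs⟩ := hW m hm
  -- The iterates start above `y` and stay there, since in `y` no agent prefers another piece to her
  -- own.
  have hge : ∀ t ≤ Fintype.card ι, ∀ p, y p ≤ c t p := by
    intro t
    induction t with
    | zero => intro _ p; rw [hc0]; exact hy1 p
    | succ t ih =>
      intro ht p
      have hs := hcs t (by omega)
      rcases hs.eq p with h1 | ⟨i, -, hi⟩
      · rw [h1]; exact hy1 p
      · rw [← hLW i p _ (hs.mem' p), ← hLW i (m i) _ (hs.mem (m i))] at hi
        refine (hL i p).le_iff_le.1 ?_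
        rw [hi]
        exact (hef i p).trans ((hL i (m i)).monotone (ih (by omega) (m i)))
  -- The pieces linked to an untrimmed one by at most `t` indifferences of owners. On these, the
  -- iterates have come down to `y` after `t` rounds, and the chains exhaust all pieces after `k`
  -- rounds; so `y` is among the known positions.
  let R : ℕ → Set ι := fun t => Nat.rec {p | y p = 1} (fun _ R => {p | p ∈ R ∨
    ∃ i, m i ∈ R ∧ m i ≠ p ∧ L i p (y p) = L i (m i) (y (m i))}) t
  have hR : R (Fintype.card ι) = univ := by
    refine eq_univ_of_growing R (fun t p hp => Or.inl hp) fun t _ ht => ?_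
    rcases hgr (R t) ht with ⟨p, hp, hp1⟩ | ⟨i, hi, p, hp, he⟩
    · refine absurd ?_ hp
      have : ∀ t, p ∈ R t := by
        intro t
        induction t with
        | zero => exact hp1
        | succ t ih => exact Or.inl ih
      exact this t
    · exact ⟨p, hp, Or.inr ⟨i, hi, by rintro rfl; exact hp hi, he⟩⟩
  have hle : ∀ t, ∀ p ∈ R t, ∀ s, t ≤ s → s ≤ Fintype.card ι → c s p ≤ y p := by
    intro t
    induction t with
    | zero =>
      intro p hp s _ hs
      have : y p = 1 := hp
      rw [this]; exact h.le_one p _ (hcm s hs p)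
    | succ t ih =>
      rintro p (hp | ⟨i, hi, hip, he⟩) s hts hs
      · exact ih p hp s (by omega) hs
      · obtain ⟨s, rfl⟩ : ∃ r, s = r + 1 := ⟨s - 1, by omega⟩
        have hst := hcs s (by omega)
        have h1 := hst.le p i hip
        rw [← hLW i p _ (hst.mem' p), ← hLW i (m i) _ (hst.mem (m i))] at h1
        refine (hL i p).le_iff_le.1 (h1.trans ?_)
        rw [he]
        exact (hL i (m i)).monotone (ih _ hi s (by omega) (by omega))
  have hyk : ∀ p, y p ∈ W.known p := by
    intro p
    have : c (Fintype.card ι) p = y p :=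
      le_antisymm (hle _ p (hR ▸ Set.mem_univ p) _ le_rfl le_rfl) (hge _ le_rfl p)
    rw [← this]; exact hcm _ le_rfl p
  have hyL : ∀ i p, L i p (y p) = W.lev i p (y p) := fun i p => hLW i p _ (hyk p)
  simp only [EF, hyL] at hef hgr
  exact ⟨y, m, hm, hyk, hef, hgr⟩

end World

/-- An envy-free assignment of trimmed pieces to the agents can be computed. -/
theorem reach_core {ι Pos : Type*} [Fintype ι] [LinearOrder Pos] (a : ι → Fin n)
    {X : ι → Pos → Set Cake} {s₀ s₁ : ι → Pos} {P : Set (Prof n)} (hP : P.Nonempty)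
    (hX : ∀ p, Markable P (X p)) (hXm : ∀ p, Monotone (X p)) (hs : ∀ p, s₀ p ≤ s₁ p)
    (h₀ : ∀ p, X p (s₀ p) = ∅) (h₁ : ∀ p, Kn P (X p (s₁ p))) :
    Reach (fun P' => ∃ (s : ι → Pos) (m : ι → ι), m.Injective ∧
      (∀ p, s p ≤ s₁ p ∧ Kn P' (X p (s p))) ∧
      (∀ v ∈ P', ∀ i p, (v (a i)).value (X p (s p)) ≤ (v (a i)).value (X (m i) (s (m i)))) ∧
      ∀ Q : Set ι, Q ≠ univ → (∃ p, p ∉ Q ∧ s p = s₁ p) ∨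
        ∃ i, m i ∈ Q ∧ ∃ p, p ∉ Q ∧ ∀ v ∈ P',
          (v (a i)).value (X p (s p)) = (v (a i)).value (X (m i) (s (m i))))
      ((Fintype.card ι).factorial * Fintype.card ι ^ 3) P := by
  classical
  obtain ⟨v₀, hv₀⟩ := id hP
  -- The summand 1 makes the levels strictly increasing even on worthless pieces; being the same for
  -- all pieces, it respects comparisons of full pieces.
  let W₀ : World ι Pos :=
    { known := fun _ => {0, 1}
      pos := fun p c => if c = 0 then s₀ p else s₁ p
      lev := fun i p c => c * ((v₀ (a i)).value (X p (s₁ p)) + 1) }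
  have hpos : ∀ i p, 0 < (v₀ (a i)).value (X p (s₁ p)) + 1 := fun i p => by
    have := (v₀ (a i)).value_nonneg (h₁ p).reg
    linarith
  have hv : W₀.Valid a X s₀ s₁ P := by
    refine ⟨?_, ?_, ?_, ?_, ?_, ?_, ?_, ?_, ?_, ?_, ?_⟩
    · simp [W₀]
    · simp [W₀]
    · simp [W₀]
    · simp [W₀]
    · simp only [W₀, Finset.mem_insert, Finset.mem_singleton]
      rintro p c (rfl | rfl) d (rfl | rfl) hcd
      · simp
      · simpa using hs p
      · linarith
      · simp
    · simp [W₀]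
    · simp [W₀]
    · simp only [W₀, Finset.mem_insert, Finset.mem_singleton]
      rintro p c (rfl | rfl)
      · simpa [h₀] using kn_empty
      · simpa using h₁ p
    · intro i p c _ d _ hcd
      exact mul_lt_mul_of_pos_right hcd (hpos i p)
    · simp [W₀]
    · simp only [W₀, Finset.mem_insert, Finset.mem_singleton]
      rintro v hv i p q c (rfl | rfl) d (rfl | rfl) hcd
      · simp [h₀]
      · simpa [h₀, AgentValuation.value_empty] using (v (a i)).value_nonneg (h₁ q).reg
      · have := hpos i p
        linarith
      · simp only [one_ne_zero, if_false]
        rw [(h₁ p).value_eq hv hv₀, (h₁ q).value_eq hv hv₀]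
        linarith
  -- All `k!` assignments are tried, each with `k` rounds of `k ^ 2` marks.
  refine ((Reach.forall_finset (Finset.univ : Finset (Equiv.Perm ι))
    (fun P' W' => W'.Valid a X s₀ s₁ P' ∧ ∀ p, Markable P' (X p)) World.Ext World.Ext.refl
    (fun _ _ _ => World.Ext.trans)
    (fun m _ W => ∃ c : ℕ → ι → ℝ,
      (∀ p, c 0 p = 1) ∧ (∀ t ≤ Fintype.card ι, ∀ p, c t p ∈ W.known p) ∧
      ∀ t < Fintype.card ι, W.Step m (c t) (c (t + 1))) ?_ (Fintype.card ι * Fintype.card ι ^ 2)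
    ?_ P W₀ hP ⟨hv, hX⟩).mono ?_).imp hP ?_
  · rintro m _ _ W W' - hW ⟨c, hc0, hcm, hcs⟩
    exact ⟨c, hc0, fun t ht p => hW.known p (hcm t ht p), fun t ht => (hcs t ht).ext hW⟩
  · rintro m - P W hP ⟨hv, hX⟩
    refine (hv.reach_steps _ hP hX hXm m).imp hP ?_
    rintro P' hP' - ⟨W', h1, h2, h3⟩
    exact ⟨W', h1, ⟨h2, fun p => (hX p).anti hP'⟩, h3⟩
  · rw [Finset.card_univ, Fintype.card_perm]
    exact le_of_eq (by ring)
  · rintro P' - - ⟨W, -, ⟨hv, -⟩, hW⟩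
    obtain ⟨y, m, hm, hy, hef, hgr⟩ := hv.exists_known_ef fun m hm =>
      hW (Equiv.ofBijective m (Finite.injective_iff_bijective.1 hm)) (Finset.mem_univ _)
    refine ⟨fun p => W.pos p (y p), m, hm, fun p => ⟨?_, hv.kn p _ (hy p)⟩,
      fun v hv' i p => hv.compat v hv' i p (m i) _ (hy p) _ (hy _) (hef i p), fun Q hQ => ?_⟩
    · rw [← hv.pos_one p]
      exact hv.pos_mono p _ (hy p) _ (hv.one_mem p) (hv.le_one p _ (hy p))
    · rcases hgr Q hQ with ⟨p, hp, hp1⟩ | ⟨i, hi, p, hp, he⟩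
      · left
        refine ⟨p, hp, ?_⟩
        simp only
        rw [hp1, hv.pos_one]
      · right
        exact ⟨i, hi, p, hp, fun v hv' => le_antisymm
          (hv.compat v hv' i p (m i) _ (hy p) _ (hy _) he.le)
          (hv.compat v hv' i (m i) p _ (hy _) _ (hy p) he.ge)⟩

/-! ### Permuting the bundles of several allocations -/

section Permutations

variable {ι : Type*}

/-- No agent considers her bundle after the permutation significantly worse. -/
def Adm (D : ι → Set ι) (σ : Equiv.Perm ι) : Prop := ∀ i, σ i ∈ D i

/-- Moreover, no agent considers the bundle of a neighbour significantly worse. -/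
def Tight (G : SimpleGraph ι) (D : ι → Set ι) (σ : Equiv.Perm ι) : Prop :=
  Adm D σ ∧ ∀ i j, G.Adj i j → σ j ∈ D i

/-- The product of the transpositions along the first steps of a walk. -/
def walkPerm [DecidableEq ι] (x : ℕ → ι) : ℕ → Equiv.Perm ι
  | 0 => 1
  | s + 1 => walkPerm x s * Equiv.swap (x s) (x (s + 1))

theorem walkPerm_apply [DecidableEq ι] (x : ℕ → ι) (s : ℕ) : walkPerm x s (x s) = x 0 := by
  induction s with
  | zero => rfl
  | succ s ih => rw [walkPerm, Equiv.Perm.mul_apply, Equiv.swap_apply_right, ih]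

theorem Tight.adm_swap [DecidableEq ι] {G : SimpleGraph ι} {D : ι → Set ι} {σ : Equiv.Perm ι}
    (h : Tight G D σ) {a b : ι} (hab : G.Adj a b) : Adm D (σ * Equiv.swap a b) := by
  intro i
  rw [Equiv.Perm.mul_apply]
  by_cases ha : i = a
  · subst ha
    rw [Equiv.swap_apply_left]
    exact h.2 _ _ hab
  by_cases hb : i = b
  · subst hb
    rw [Equiv.swap_apply_right]
    exact h.2 _ _ hab.symm
  rw [Equiv.swap_apply_of_ne_of_ne ha hb]
  exact h.1 i

variable [Fintype ι]

/-- Starting from a tight permutation, the bundle `j₀` is moved by swaps along a walk from its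
holder to `i₀`. A swap of neighbours applied to a tight permutation gives an admissible one, but the
last permutation gives `j₀` to `i₀` and is not admissible. So an admissible permutation that is not
tight occurs on the way. Together with the holder and the number of swaps, at most `k ^ 2`
possibilities, it determines the original permutation. -/
theorem card_tight_le [DecidableEq ι] {G : SimpleGraph ι} (hG : G.Connected) {D : ι → Set ι}
    {i₀ j₀ : ι} (h₀ : j₀ ∉ D i₀) (A T : Finset (Equiv.Perm ι)) (hA : ∀ σ, σ ∈ A ↔ Adm D σ)
    (hT : ∀ σ, σ ∈ T ↔ Tight G D σ) :
    (Fintype.card ι ^ 2 + 1) * T.card ≤ Fintype.card ι ^ 2 * A.card := by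
  have hw : ∀ a, ∃ w : G.Walk a i₀, w.length < Fintype.card ι := fun a => by
    obtain ⟨w, hw⟩ := hG.exists_isPath a i₀
    exact ⟨w, hw.length_lt⟩
  choose w hw using hw
  let c : ι × Fin (Fintype.card ι) → Equiv.Perm ι := fun z => walkPerm (w z.1).getVert z.2
  have hTA : T ⊆ A := fun σ hσ => (hA σ).2 ((hT σ).1 hσ).1
  have key : T ⊆ Finset.univ.biUnion fun z => (A \ T).image fun σ => σ * (c z)⁻¹ := by
    intro σ hσ
    have hσT := (hT σ).1 hσ
    let a := σ.symm j₀
    have ha : σ a = j₀ := σ.apply_symm_apply j₀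
    by_contra hcon
    have h1 : ∀ s ≤ (w a).length, Adm D (σ * walkPerm (w a).getVert s) := by
      intro s
      induction s with
      | zero => intro _; simpa [walkPerm] using hσT.1
      | succ s ih =>
        intro hs
        have hadm := ih (by omega)
        have ht : Tight G D (σ * walkPerm (w a).getVert s) := by
          by_contra ht
          apply hcon
          refine Finset.mem_biUnion.2 ⟨(a, ⟨s, by have := hw a; omega⟩), Finset.mem_univ _,
            Finset.mem_image.2 ⟨σ * walkPerm (w a).getVert s, ?_, ?_⟩⟩
          · rw [Finset.mem_sdiff, hA, hT]
            exact ⟨hadm, ht⟩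
          · simp [c]
        rw [walkPerm, ← mul_assoc]
        exact ht.adm_swap ((w a).adj_getVert_succ (by omega))
    have h2 := h1 _ le_rfl i₀
    rw [Equiv.Perm.mul_apply] at h2
    have h3 := walkPerm_apply (w a).getVert (w a).length
    rw [SimpleGraph.Walk.getVert_length, SimpleGraph.Walk.getVert_zero] at h3
    rw [h3, ha] at h2
    exact h₀ h2
  have h1 := (Finset.card_le_card key).trans Finset.card_biUnion_le
  have h2 : ∑ z : ι × Fin (Fintype.card ι), ((A \ T).image fun σ => σ * (c z)⁻¹).card ≤
      Fintype.card ι ^ 2 * (A \ T).card := by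
    refine (Finset.sum_le_card_nsmul _ _ _ fun z _ => Finset.card_image_le).trans ?_
    simp [sq]
  have h3 := h1.trans h2
  rw [Finset.card_sdiff_of_subset hTA, Nat.mul_sub] at h3
  have h4 := Nat.mul_le_mul_left (Fintype.card ι ^ 2) (Finset.card_le_card hTA)
  rw [Nat.succ_mul]
  omega

/-- Averaging over the admissible `σ`: for fixed `m`, the map `σ ↦ σ * m` is injective, so at most
as many `σ` make `σ * m` tight as there are tight permutations, and `card_tight_le` bounds these. -/
theorem exists_adm_card_le {G : SimpleGraph ι} (hG : G.Connected) {D : ι → Set ι}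
    (hD : ∀ i, i ∈ D i) (h₀ : ∃ i j, j ∉ D i) [∀ σ m, Decidable (Tight G D (σ * m))]
    (M : Finset (Equiv.Perm ι)) :
    ∃ σ, Adm D σ ∧ (Fintype.card ι ^ 2 + 1) * (M.filter fun m => Tight G D (σ * m)).card ≤
      Fintype.card ι ^ 2 * M.card := by
  classical
  obtain ⟨i₀, j₀, h₀⟩ := h₀
  by_contra! hcon
  let A := (Finset.univ : Finset (Equiv.Perm ι)).filter (Adm D)
  let T := (Finset.univ : Finset (Equiv.Perm ι)).filter (Tight G D)
  have hle := card_tight_le hG h₀ A T (by simp [A]) (by simp [T])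
  have hA : A.Nonempty := ⟨1, by simpa [A, Adm] using hD⟩
  have h1 : ∑ σ ∈ A, Fintype.card ι ^ 2 * M.card <
      ∑ σ ∈ A, (Fintype.card ι ^ 2 + 1) * (M.filter fun m => Tight G D (σ * m)).card :=
    Finset.sum_lt_sum_of_nonempty hA fun σ hσ => hcon σ (by simpa [A] using hσ)
  rw [Finset.sum_const, smul_eq_mul, ← Finset.mul_sum] at h1
  have h2 : ∑ σ ∈ A, (M.filter fun m => Tight G D (σ * m)).card ≤ M.card * T.card := by
    simp_rw [Finset.card_filter]
    rw [Finset.sum_comm, ← smul_eq_mul]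
    refine Finset.sum_le_card_nsmul _ _ _ fun m _ => ?_
    rw [← Finset.card_filter]
    refine Finset.card_le_card_of_injOn (fun σ => σ * m) ?_ (fun σ _ σ' _ h => by simpa using h)
    intro σ hσ
    simpa [T] using (Finset.mem_filter.1 hσ).2
  have h3 := Nat.mul_le_mul_left (Fintype.card ι ^ 2 + 1) h2
  have h4 := Nat.mul_le_mul_left M.card hle
  have h5 : A.card * (Fintype.card ι ^ 2 * M.card) = M.card * (Fintype.card ι ^ 2 * A.card) := by
    ring
  have h6 : (Fintype.card ι ^ 2 + 1) * (M.card * T.card) =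
      M.card * ((Fintype.card ι ^ 2 + 1) * T.card) := by ring
  omega

/-- By Bernoulli, `(1 + 1 / K) ^ (K + 1) ≥ 2`. Hence `(K + 1) * K` reductions by the factor `K / (K
+ 1)` amount to at least `2 ^ K`, which exceeds `k!` when `K = k ^ 2`. -/
theorem two_pow_mul_pow_le (K : ℕ) : 2 ^ K * K ^ ((K + 1) * K) ≤ (K + 1) ^ ((K + 1) * K) := by
  rw [pow_mul, pow_mul, ← mul_pow]
  refine Nat.pow_le_pow_left ?_ K
  rcases Nat.eq_zero_or_pos K with rfl | hK
  · simp
  have h1 := one_add_mul_le_pow (a := 1 / (K : ℝ)) (by have : (0 : ℝ) ≤ 1 / K := by positivity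
                                                       linarith) (K + 1)
  have hK' : (0 : ℝ) < K := by exact_mod_cast hK
  have h2 : (2 : ℝ) ≤ (1 + 1 / K) ^ (K + 1) := by
    refine le_trans ?_ h1
    have : (1 : ℝ) ≤ ((K + 1 : ℕ) : ℝ) * (1 / K) := by
      rw [mul_one_div, le_div_iff₀ hK']
      push_cast; linarith
    linarith
  have h3 : (2 : ℝ) * K ^ (K + 1) ≤ (K + 1) ^ (K + 1) := by
    calc (2 : ℝ) * K ^ (K + 1) ≤ (1 + 1 / K) ^ (K + 1) * K ^ (K + 1) := by gcongr
      _ = (K + 1) ^ (K + 1) := by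
        rw [← mul_pow]; congr 1; field_simp
  exact_mod_cast h3

theorem factorial_lt_two_pow {k : ℕ} (hk : 0 < k) : k.factorial < 2 ^ (k ^ 2) := by
  calc k.factorial ≤ k ^ k := Nat.factorial_le_pow k
    _ < (2 ^ k) ^ k := Nat.pow_lt_pow_left Nat.lt_two_pow_self hk.ne'
    _ = 2 ^ (k ^ 2) := by rw [← pow_mul, sq]

/-- There are permutations of the bundles of sufficiently many allocations such that in any
assignment of the agents to the slots, some agent considers her bundle or that of a neighbour
significantly worse than her original one. -/
theorem exists_permutations {G : SimpleGraph ι} (hG : G.Connected) (D : ℕ → ι → Set ι)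
    (hD : ∀ t i, i ∈ D t i) (h₀ : ∀ t, ∃ i j, j ∉ D t i) :
    ∃ σ : ℕ → Equiv.Perm ι, (∀ t, Adm (D t) (σ t)) ∧ ∀ m : Equiv.Perm ι,
      ∃ t < (Fintype.card ι ^ 2 + 1) * Fintype.card ι ^ 2, ¬ Tight G (D t) (σ t * m) := by
  classical
  have : Nonempty ι := hG.nonempty
  choose f hf hf' using fun (t : ℕ) (M : Finset (Equiv.Perm ι)) =>
    exists_adm_card_le hG (hD t) (h₀ t) M
  -- The assignments that have been tight in all rounds before `t`; the permutation of round `t` is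
  -- chosen greedily against them.
  let M : ℕ → Finset (Equiv.Perm ι) := fun t => Nat.rec Finset.univ
    (fun t M => M.filter fun m => Tight G (D t) (f t M * m)) t
  have hM : ∀ t, M (t + 1) = (M t).filter fun m => Tight G (D t) (f t (M t) * m) := fun t => rfl
  refine ⟨fun t => f t (M t), fun t => hf t _, fun m => ?_⟩
  by_contra! hcon
  set K := Fintype.card ι ^ 2 with hK
  have h1 : ∀ t ≤ (K + 1) * K, m ∈ M t := by
    intro t
    induction t with
    | zero => intro _; exact Finset.mem_univ m
    | succ t ih =>
      intro ht
      rw [hM, Finset.mem_filter]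
      exact ⟨ih (by omega), hcon t (by omega)⟩
  have h2 : ∀ t, (K + 1) ^ t * (M t).card ≤ K ^ t * (Fintype.card ι).factorial := by
    intro t
    induction t with
    | zero => simp [M, Fintype.card_perm]
    | succ t ih =>
      have h3 := hf' t (M t)
      rw [← hM] at h3
      calc (K + 1) ^ (t + 1) * (M (t + 1)).card
          = (K + 1) ^ t * ((K + 1) * (M (t + 1)).card) := by ring
        _ ≤ (K + 1) ^ t * (K * (M t).card) := Nat.mul_le_mul_left _ h3
        _ = K * ((K + 1) ^ t * (M t).card) := by ring
        _ ≤ K * (K ^ t * (Fintype.card ι).factorial) := Nat.mul_le_mul_left _ ih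
        _ = K ^ (t + 1) * (Fintype.card ι).factorial := by ring
  have h3 : 1 ≤ (M ((K + 1) * K)).card := Finset.card_pos.2 ⟨m, h1 _ le_rfl⟩
  have h4 := h2 ((K + 1) * K)
  have h5 := two_pow_mul_pow_le K
  have hk : 0 < Fintype.card ι := Fintype.card_pos
  have h6 : (Fintype.card ι).factorial < 2 ^ K := factorial_lt_two_pow hk
  have h7 : 0 < K ^ ((K + 1) * K) := by positivity
  have h8 := Nat.mul_lt_mul_of_pos_left h6 h7
  have h9 := Nat.mul_le_mul_left ((K + 1) ^ ((K + 1) * K)) h3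
  rw [mul_comm (2 ^ K)] at h5
  omega

end Permutations

/-! ### Partial allocations -/

/-- `reach_core` for pieces that are trimmed layer by layer, the last layers first. Positions are
ordered lexicographically, so a trimmed piece is comparable with every union of initial layers. -/
theorem reach_core_layers {ι : Type*} [Fintype ι] (a : ι → Fin n) {P : Set (Prof n)}
    (hP : P.Nonempty) (L : ι → ℕ → Set Cake) (hL : ∀ p l, Kn P (L p l))
    (hd : ∀ p k l, k ≠ l → Disjoint (L p k) (L p l)) (K : ℕ) :
    Reach (fun P' => ∃ (T : ι → Set Cake) (m : ι → ι), m.Injective ∧ (∀ p, Kn P' (T p)) ∧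
      (∀ p, T p ⊆ ⋃ k ∈ Finset.range K, L p k) ∧
      (∀ p l, (⋃ k ∈ Finset.range l, L p k) ⊆ T p ∨ T p ⊆ ⋃ k ∈ Finset.range l, L p k) ∧
      (∀ v ∈ P', ∀ i p, (v (a i)).value (T p) ≤ (v (a i)).value (T (m i))) ∧
      ∀ Q : Set ι, Q ≠ univ → (∃ p, p ∉ Q ∧ T p = ⋃ k ∈ Finset.range K, L p k) ∨
        ∃ i, m i ∈ Q ∧ ∃ p, p ∉ Q ∧ ∀ v ∈ P', (v (a i)).value (T p) = (v (a i)).value (T (m i)))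
      ((Fintype.card ι).factorial * Fintype.card ι ^ 3) P := by
  refine (reach_core a (X := fun p => layered (L p)) (s₀ := fun _ => toLex (0, 0))
    (s₁ := fun _ => toLex (K, 0)) hP (fun p => markable_layered (hL p) (hd p))
    (fun p => layered_mono (L p)) ?_ ?_ ?_).imp hP ?_
  · intro p
    rw [Prod.Lex.le_iff]
    rcases Nat.eq_zero_or_pos K with h | h
    · right; exact ⟨h.symm, le_rfl⟩
    · left; exact h
  · intro p; rw [layered_zero]; simp
  · exact fun p => kn_layered (hL p) kp_zero
  · rintro P' - - ⟨s, m, hm, hs, hef, hgr⟩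
    refine ⟨fun p => layered (L p) (s p), m, hm, fun p => (hs p).2, fun p => ?_, fun p l => ?_,
      hef, fun Q hQ => ?_⟩
    · rw [← layered_zero]; exact layered_mono _ (hs p).1
    · rw [← layered_zero]
      exact (le_total (toLex (l, 0)) (s p)).imp (fun h => layered_mono _ h) fun h => layered_mono _ h
    · rcases hgr Q hQ with ⟨p, hp, hp'⟩ | h
      · left
        refine ⟨p, hp, ?_⟩
        simp only
        rw [hp', layered_zero]
      · exact Or.inr h

/-- A known region can be cut into parts that an agent considers equal. -/
theorem reach_equalCut_fin (r : Fin n) (M : ℕ) {P : Set (Prof n)} (hP : P.Nonempty)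
    {R : Set Cake} (hR : Kn P R) :
    Reach (fun P' => ∃ E : Fin (M + 1) → Set Cake, (∀ j, Kn P' (E j)) ∧
      (∀ j l, j ≠ l → Disjoint (E j) (E l)) ∧ ⋃ j, E j = R ∧
      ∀ v ∈ P', ∀ j, (M + 1) * (v r).value (E j) = (v r).value R) (M + 1) P := by
  induction M generalizing P R with
  | zero =>
    refine Reach.done ⟨fun _ => R, fun _ => hR, ?_, Set.iUnion_const R, ?_⟩
    · intro j l h; exact absurd (Subsingleton.elim (α := Fin 1) j l) h
    · simp
  | succ M ih =>
    obtain ⟨v₀, hv₀⟩ := id hP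
    have h0 := (v₀ r).value_nonneg hR.reg
    rw [show M + 1 + 1 = 1 + (M + 1) by ring]
    refine (reach_mark hR hv₀ r (τ := (v₀ r).value R / (M + 2)) (by positivity)
      (div_le_self h0 (by have := M.cast_nonneg (α := ℝ); linarith))).bind hP ?_
    rintro P' hP' hne ⟨y, hy, hyv⟩
    have hR' := hR.anti hP'
    refine (ih hne (hR'.sdiff (kn_Iio hy))).imp hne ?_
    rintro P'' hP'' - ⟨E, hE, hEd, hEu, hEv⟩
    have hsub : ∀ j, E j ⊆ R \ Iio y := fun j => hEu ▸ Set.subset_iUnion E j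
    have hdis : ∀ j, Disjoint (R ∩ Iio y) (E j) := fun j =>
      Set.disjoint_left.2 fun x hx hx' => (hsub j hx').2 hx.2
    rw [show 1 + (M + 1) = M + 1 + 1 by ring]
    refine ⟨Fin.cons (R ∩ Iio y) E, ?_, ?_, ?_, ?_⟩
    · refine Fin.cases ?_ fun j => ?_
      · exact (hR'.inter (kn_Iio hy)).anti hP''
      · exact hE j
    · refine Fin.cases ?_ fun j => ?_ <;> refine Fin.cases ?_ fun l => ?_
      · exact fun h => absurd rfl h
      · exact fun _ => hdis l
      · exact fun _ => (hdis j).symm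
      · exact fun h => hEd j l fun h' => h (by rw [h'])
    · have : ⋃ j, (Fin.cons (R ∩ Iio y) E : Fin (M + 1 + 1) → Set Cake) j =
          (R ∩ Iio y) ∪ ⋃ j, E j := by
        ext x; simp [Fin.exists_fin_succ]
      rw [this, hEu, Set.inter_union_sdiff]
    · intro v hv
      have hval : (v r).value (R ∩ Iio y) * (M + 2) = (v r).value R := by
        rw [hyv v (hP'' hv), hR.value_eq (hP' (hP'' hv)) hv₀]
        field_simp
      have hsplit : (v r).value R = (v r).value (R ∩ Iio y) + (v r).value (R \ Iio y) := by
        rw [← (v r).value_union (hR'.inter (kn_Iio hy)).reg (hR'.sdiff (kn_Iio hy)).reg,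
          Set.inter_union_sdiff]
        exact Set.disjoint_left.2 fun x hx hx' => hx'.2 hx.2
      refine Fin.cases ?_ fun j => ?_
      · simp only [Fin.cons_zero]
        push_cast
        linarith
      · simp only [Fin.cons_succ]
        have h1 := hEv v hv j
        have hM : (0 : ℝ) < M + 1 := by positivity
        have h2 : (M + 1 : ℝ) * ((v r).value (E j) * (M + 2)) = (M + 1) * (v r).value R := by
          linear_combination (M + 2 : ℝ) * h1 - (M + 2 : ℝ) * hsplit - hval
        have h3 := mul_left_cancel₀ hM.ne' h2
        push_cast
        linarith

theorem reach_equalCut (κ : Type*) [Fintype κ] [Nonempty κ] (r : Fin n) {P : Set (Prof n)}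
    (hP : P.Nonempty) {R : Set Cake} (hR : Kn P R) :
    Reach (fun P' => ∃ E : κ → Set Cake, (∀ j, Kn P' (E j)) ∧
      (∀ j l, j ≠ l → Disjoint (E j) (E l)) ∧ ⋃ j, E j = R ∧
      ∀ v ∈ P', ∀ j, Fintype.card κ * (v r).value (E j) = (v r).value R) (Fintype.card κ) P := by
  obtain ⟨M, hM⟩ : ∃ M, Fintype.card κ = M + 1 := ⟨Fintype.card κ - 1, by
    have := Fintype.card_pos (α := κ); omega⟩
  let e := Fintype.equivFinOfCardEq hM
  rw [hM]
  refine (reach_equalCut_fin r M hP hR).imp hP ?_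
  rintro P' - - ⟨E, h1, h2, h3, h4⟩
  refine ⟨E ∘ e, fun j => h1 _, fun j l h => h2 _ _ (e.injective.ne h), ?_, fun v hv j => ?_⟩
  · rw [← h3]; exact e.surjective.iUnion_comp E
  · rw [← h4 v hv (e j)]; push_cast; rfl

section Part

variable {ι : Type*}

/-- The bundles `A` are a partial allocation of `R` with residue `R'`. -/
structure Part (P : Set (Prof n)) (R : Set Cake) (A : ι → Set Cake) (R' : Set Cake) : Prop where
  kn : ∀ i, Kn P (A i)
  kn' : Kn P R'
  disj : ∀ i j, i ≠ j → Disjoint (A i) (A j)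
  disj' : ∀ i, Disjoint (A i) R'
  union : (⋃ i, A i) ∪ R' = R

variable {P P' : Set (Prof n)} {R R' R'' : Set Cake} {A B : ι → Set Cake}

theorem Part.anti (h : Part P R A R') (hP : P' ⊆ P) : Part P' R A R' :=
  ⟨fun i => (h.kn i).anti hP, h.kn'.anti hP, h.disj, h.disj', h.union⟩

theorem Part.subset (h : Part P R A R') (i : ι) : A i ⊆ R :=
  (Set.subset_iUnion A i).trans (Set.subset_union_left.trans h.union.subset)

theorem Part.subset' (h : Part P R A R') : R' ⊆ R :=
  Set.subset_union_right.trans h.union.subset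

theorem part_empty (h : Kn P R) : Part P R (fun _ : ι => ∅) R :=
  ⟨fun _ => kn_empty, h, by simp, by simp, by simp⟩

theorem Part.perm (h : Part P R A R') (σ : Equiv.Perm ι) : Part P R (fun i => A (σ i)) R' :=
  ⟨fun i => h.kn _, h.kn', fun i j hij => h.disj _ _ (σ.injective.ne hij), fun i => h.disj' _, by
    rw [← h.union]; congr 1; exact σ.surjective.iUnion_comp A⟩

theorem Part.trans (h : Part P R A R') (h' : Part P R' B R'') :
    Part P R (fun i => A i ∪ B i) R'' where
  kn i := (h.kn i).union (h'.kn i)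
  kn' := h'.kn'
  disj i j hij := by
    have h1 := (h.disj' i).mono_right (h'.subset j)
    have h2 := (h.disj' j).mono_right (h'.subset i)
    rw [Set.disjoint_union_left, Set.disjoint_union_right, Set.disjoint_union_right]
    exact ⟨⟨h.disj i j hij, h1⟩, h2.symm, h'.disj i j hij⟩
  disj' i := Set.disjoint_union_left.2 ⟨(h.disj' i).mono_right h'.subset', h'.disj' i⟩
  union := by
    rw [Set.iUnion_union_distrib, Set.union_assoc, h'.union, h.union]

theorem Part.value_union (h : Part P R A R') (h' : Part P R' B R'') (v : AgentValuation) (i : ι) (j : ι) :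
    v.value (A i ∪ B j) = v.value (A i) + v.value (B j) :=
  v.value_union (h.kn i).reg (h'.kn j).reg ((h.disj' i).mono_right (h'.subset j))

theorem Part.value [Fintype ι] (h : Part P R A R') (v : AgentValuation) :
    v.value R = ∑ i, v.value (A i) + v.value R' := by
  rw [← h.union, v.value_union (Reg.iUnion fun i => (h.kn i).reg) h.kn'.reg
    (Set.disjoint_iUnion_left.2 h.disj'), v.value_iUnion (fun i => (h.kn i).reg) h.disj]

/-- An envy-free partial allocation. -/
structure EFPart (a : ι → Fin n) (P : Set (Prof n)) (R : Set Cake) (A : ι → Set Cake)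
    (R' : Set Cake) : Prop extends Part P R A R' where
  ef : ∀ v ∈ P, ∀ i j, (v (a i)).value (A j) ≤ (v (a i)).value (A i)

variable {a : ι → Fin n}

theorem EFPart.anti (h : EFPart a P R A R') (hP : P' ⊆ P) : EFPart a P' R A R' :=
  ⟨h.toPart.anti hP, fun v hv => h.ef v (hP hv)⟩

theorem efPart_empty (h : Kn P R) : EFPart a P R (fun _ : ι => ∅) R :=
  ⟨part_empty h, by simp⟩

theorem EFPart.trans (h : EFPart a P R A R') (h' : EFPart a P R' B R'') :
    EFPart a P R (fun i => A i ∪ B i) R'' :=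
  ⟨h.toPart.trans h'.toPart, fun v hv i j => by
    simp only [h.toPart.value_union h'.toPart]
    exact add_le_add (h.ef v hv i j) (h'.ef v hv i j)⟩

variable [Fintype ι]

/-- The cost of cutting a region into equal parts and distributing them. -/
def roundCost (k : ℕ) : ℕ := k + k.factorial * k ^ 3

/-- One agent, the cutter, gets her fair share in an envy-free partial allocation. -/
theorem reach_round (a : ι → Fin n) (r : ι) (hP : P.Nonempty) (hR : Kn P R) :
    Reach (fun P' => ∃ A R', EFPart a P' R A R' ∧
      ∀ v ∈ P', Fintype.card ι * (v (a r)).value (A r) = (v (a r)).value R)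
      (roundCost (Fintype.card ι)) P := by
  have : Nonempty ι := ⟨r⟩
  refine (reach_equalCut ι (a r) hP hR).bind hP ?_
  rintro P' hP' hne ⟨E, hE, hEd, hEu, hEv⟩
  -- A single layer: the equal parts themselves are trimmed.
  let L : ι → ℕ → Set Cake := fun p l => if l = 0 then E p else ∅
  have hL1 : ∀ p, ⋃ k ∈ Finset.range 1, L p k = E p := by simp [L]
  refine (reach_core_layers a hne L ?_ ?_ 1).imp hne ?_
  · intro p l
    by_cases h : l = 0
    · simpa [L, h] using hE p
    · simpa [L, h] using kn_empty
  · intro p k l hkl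
    by_cases h : k = 0
    · have : l ≠ 0 := by omega
      simp [L, this]
    · simp [L, h]
  rintro P'' hP'' ⟨v₀, hv₀⟩ ⟨T, m, hm, hT, hTs, -, hef, hgr⟩
  simp only [hL1] at hTs hgr
  have hTk : Kn P'' (⋃ i, T (m i)) := Kn.iUnion fun i => hT (m i)
  have hTR : ⋃ i, T (m i) ⊆ R :=
    Set.iUnion_subset fun i => (hTs _).trans (hEu ▸ Set.subset_iUnion E (m i))
  refine ⟨fun i => T (m i), R \ ⋃ i, T (m i), ⟨⟨fun i => hT _,
    (hR.anti (hP''.trans hP')).sdiff hTk, fun i j hij => ?_, fun i => ?_, ?_⟩, fun v hv i j =>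
      hef v hv i (m j)⟩, fun v hv => ?_⟩
  · exact (hEd _ _ (hm.ne hij)).mono (hTs _) (hTs _)
  · exact Set.disjoint_sdiff_right.mono_left (Set.subset_iUnion (fun i => T (m i)) i)
  · exact Set.union_sdiff_cancel hTR
  -- For `Q = ∅` the graph property provides an untrimmed part. The cutter does not envy it, so she
  -- gets at least, and hence exactly, an equal share.
  · rcases hgr ∅ Set.empty_ne_univ with ⟨p, -, hp⟩ | ⟨i, hi, -⟩
    · have hc : (0 : ℝ) < Fintype.card ι := by exact_mod_cast Fintype.card_pos
      have h1 := hEv v (hP'' hv) p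
      have h2 := hEv v (hP'' hv) (m r)
      have h3 := hef v hv r p
      rw [hp] at h3
      have h4 := (v (a r)).value_mono (hT (m r)).reg (hE (m r)).reg (hTs (m r))
      have h5 := mul_le_mul_of_nonneg_left h3 hc.le
      have h6 := mul_le_mul_of_nonneg_left h4 hc.le
      simp only
      linarith
    · exact absurd hi (Set.notMem_empty _)

/-- The members of the list act as cutters in turn. A round removes the share `1 / k` of the residue
in the eyes of its cutter and enlarges the residue for nobody. -/
theorem reach_shrink_list (a : ι → Fin n) [DecidableEq ι] (l : List ι) (hP : P.Nonempty)
    (hR : Kn P R) :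
    Reach (fun P' => ∃ A R', EFPart a P' R A R' ∧ ∀ v ∈ P', ∀ i,
      (v (a i)).value R' ≤ (1 - 1 / Fintype.card ι) ^ l.count i * (v (a i)).value R)
      (l.length * roundCost (Fintype.card ι)) P := by
  induction l with
  | nil => exact Reach.done ⟨_, R, efPart_empty hR, by simp⟩
  | cons r l ih =>
    rw [List.length_cons, Nat.succ_mul]
    refine ih.bind hP ?_
    rintro P' hP' hne ⟨A, R', hA, hAR⟩
    refine (reach_round a r hne hA.kn').imp hne ?_
    rintro P'' hP'' - ⟨B, R'', hB, hBr⟩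
    refine ⟨_, R'', (hA.anti hP'').trans hB, fun v hv i => ?_⟩
    have hk : 1 ≤ Fintype.card ι := Fintype.card_pos_iff.2 ⟨r⟩
    have hk' : (1 : ℝ) ≤ Fintype.card ι := by exact_mod_cast hk
    have hfac : 0 ≤ 1 - 1 / (Fintype.card ι : ℝ) := by
      rw [sub_nonneg, div_le_one (by linarith)]; exact hk'
    have h1 := hAR v (hP'' hv) i
    have h2 := (v (a i)).value_mono hB.kn'.reg hA.kn'.reg hB.subset'
    by_cases hir : i = r
    · subst hir
      rw [List.count_cons_self, pow_succ']
      have h3 := hBr v hv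
      have h4 : (v (a i)).value R'' ≤ (1 - 1 / Fintype.card ι) * (v (a i)).value R' := by
        have h5 : (v (a i)).value (B i) + (v (a i)).value R'' ≤ (v (a i)).value R' := by
          rw [← (v (a i)).value_union (hB.kn i).reg hB.kn'.reg (hB.disj' i)]
          exact (v (a i)).value_mono ((hB.kn i).reg.union hB.kn'.reg) hA.kn'.reg
            (Set.union_subset (hB.subset i) hB.subset')
        have h6 : (v (a i)).value (B i) = 1 / Fintype.card ι * (v (a i)).value R' := by
          rw [← h3]; field_simp
        linarith
      calc _ ≤ _ := h4
        _ ≤ _ := mul_le_mul_of_nonneg_left h1 hfac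
        _ = _ := by ring
    · rw [List.count_cons_of_ne (Ne.symm hir)]
      exact h2.trans h1

/-- All agents find the residue small. -/
theorem reach_shrink (a : ι → Fin n) [Nonempty ι] (s : ℕ) (hP : P.Nonempty) (hR : Kn P R) :
    Reach (fun P' => ∃ A R', EFPart a P' R A R' ∧ ∀ v ∈ P', ∀ i,
      (v (a i)).value R' ≤ (1 / 2) ^ s * (v (a i)).value R)
      (Fintype.card ι * s * Fintype.card ι * roundCost (Fintype.card ι)) P := by
  classical
  -- Everyone is the cutter `k * s` times, and `(1 - 1 / k) ^ k ≤ 1 / e ≤ 1 / 2`.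
  have hlen : ((List.replicate (Fintype.card ι * s) Finset.univ.toList).flatten : List ι).length =
      Fintype.card ι * s * Fintype.card ι := by
    simp [List.length_flatten]
  rw [← hlen]
  refine (reach_shrink_list a _ hP hR).imp hP ?_
  rintro P' hP' - ⟨A, R', hA, hAR⟩
  refine ⟨A, R', hA, fun v hv i => (hAR v hv i).trans ?_⟩
  refine mul_le_mul_of_nonneg_right ?_ ((v (a i)).value_nonneg hR.reg)
  have hcount : ((List.replicate (Fintype.card ι * s) Finset.univ.toList).flatten : List ι).count i
      = Fintype.card ι * s := by
    have : (Finset.univ.toList : List ι).count i = 1 :=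
      List.count_eq_one_of_mem (Finset.nodup_toList _) (by simp)
    simp [List.count_flatten, this]
  have hk : (1 : ℝ) ≤ Fintype.card ι := by
    exact_mod_cast Fintype.card_pos (α := ι)
  rw [hcount, pow_mul]
  refine pow_le_pow_left₀ (pow_nonneg ?_ _) ?_ s
  · rw [sub_nonneg, div_le_one (by linarith)]; exact hk
  · refine (Real.one_sub_div_pow_le_exp_neg hk).trans ?_
    rw [Real.exp_neg, one_div]
    refine inv_anti₀ two_pos ?_
    have := Real.add_one_le_exp 1
    linarith

end Part

/-- To repeat a step. -/
theorem Reach.iterate {σ : Type*} (Inv : Set (Prof n) → σ → Prop)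
    (Rel : Set (Prof n) → σ → σ → Prop)
    (anti : ∀ P P' s s', P' ⊆ P → Rel P s s' → Rel P' s s') {c : ℕ}
    (step : ∀ P s, P.Nonempty → Inv P s → Reach (fun P' => ∃ s', Inv P' s' ∧ Rel P' s s') c P)
    (T : ℕ) {P : Set (Prof n)} {s : σ} (hP : P.Nonempty) (hs : Inv P s) :
    Reach (fun P' => ∃ S : ℕ → σ, S 0 = s ∧ Inv P' (S T) ∧
      ∀ t < T, Rel P' (S t) (S (t + 1))) (T * c) P := by
  induction T with
  | zero => exact Reach.done ⟨fun _ => s, rfl, hs, fun t ht => absurd ht (Nat.not_lt_zero t)⟩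
  | succ T ih =>
    rw [Nat.succ_mul]
    refine ih.bind hP ?_
    rintro P' hP' hne ⟨S, h0, hI, hS⟩
    refine (step P' (S T) hne hI).imp hne ?_
    rintro P'' hP'' - ⟨s', hs', hrel⟩
    have hold : ∀ t ≤ T, Function.update S (T + 1) s' t = S t := fun t ht =>
      Function.update_of_ne (by omega) _ _
    refine ⟨Function.update S (T + 1) s', (hold 0 (Nat.zero_le _)).trans h0, ?_, fun t ht => ?_⟩
    · rwa [Function.update_self]
    · rw [hold t (by omega)]
      rcases Nat.lt_or_ge t T with h | h
      · rw [hold _ (by omega)]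
        exact anti _ _ _ _ hP'' (hS t h)
      · obtain rfl : t = T := by omega
        rwa [Function.update_self]

/-! ### Sequences of rounds, gaps between scales, and crumbs -/

variable {ι : Type*} {P : Set (Prof n)} {R : Set Cake}

/-- Each round may hand out its bundles in an order of its own; the bundles collected at `i` form
the slot `i`. -/
theorem Part.iterate {Rs : ℕ → Set Cake} {A : ℕ → ι → Set Cake} (N : ℕ)
    (h : ∀ t < N, Part P (Rs t) (A t) (Rs (t + 1))) (hR : Kn P (Rs 0)) (σ : ℕ → Equiv.Perm ι) :
    Part P (Rs 0) (fun i => ⋃ t ∈ Finset.range N, A t (σ t i)) (Rs N) ∧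
      ∀ (u : AgentValuation) i, u.value (⋃ t ∈ Finset.range N, A t (σ t i)) =
        ∑ t ∈ Finset.range N, u.value (A t (σ t i)) := by
  induction N with
  | zero =>
    refine ⟨?_, by simp [AgentValuation.value_empty]⟩
    simpa using part_empty hR
  | succ N ih =>
    obtain ⟨h1, h2⟩ := ih fun t ht => h t (by omega)
    have h3 := (h N (by omega)).perm (σ N)
    have h4 : ∀ i, ⋃ t ∈ Finset.range (N + 1), A t (σ t i) =
        (⋃ t ∈ Finset.range N, A t (σ t i)) ∪ A N (σ N i) := fun i => by
      rw [Finset.range_add_one, Finset.set_biUnion_insert, Set.union_comm]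
    simp_rw [h4]
    refine ⟨h1.trans h3, fun u i => ?_⟩
    rw [Finset.sum_range_succ, ← h2]
    exact h1.value_union h3 u i i

variable [Fintype ι]

/-- The cost of making the residue small for all agents. -/
def shrinkCost (k s : ℕ) : ℕ := k * (s + 2) * k * roundCost k

/-- After shrinking the residue several times, each of finitely many quantities is either
negligible or large in comparison with its value. -/
theorem reach_gap (a : ι → Fin n) [Nonempty ι] (s : ℕ) {κ : Type*} [Fintype κ] (ag : κ → ι)
    (g : κ → Prof n → ℝ) (M : ℕ) (hP : P.Nonempty) (hR : Kn P R)
    (hg : ∀ x, ∀ v ∈ P, ∀ w ∈ P, g x v = g x w)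
    (hM : ∀ v ∈ P, {x | g x v < 3 * (v (a (ag x))).value R}.ncard ≤ M) :
    Reach (fun P' => ∃ A R', EFPart a P' R A R' ∧ ∀ x,
      (∀ v ∈ P', g x v ≤ (1 / 2) ^ s * (v (a (ag x))).value R') ∨
      ∀ v ∈ P', 3 * (v (a (ag x))).value R' ≤ g x v)
      (M * shrinkCost (Fintype.card ι) s) P := by
  induction M generalizing P R with
  | zero =>
    refine Reach.done ⟨_, R, efPart_empty hR, fun x => Or.inr fun v hv => ?_⟩
    by_contra hcon
    have h1 := hM v hv
    rw [Nat.le_zero, Set.ncard_eq_zero (Set.toFinite _)] at h1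
    exact Set.notMem_empty x (h1 ▸ not_le.1 hcon)
  | succ M ih =>
    obtain ⟨v₀, hv₀⟩ := id hP
    by_cases hgap : ∀ x, g x v₀ ≤ (1 / 2) ^ s * (v₀ (a (ag x))).value R ∨
        3 * (v₀ (a (ag x))).value R ≤ g x v₀
    · refine Reach.done ⟨_, R, efPart_empty hR, fun x => ?_⟩
      refine (hgap x).imp (fun h v hv => ?_) fun h v hv => ?_ <;>
        rwa [hg x v hv v₀ hv₀, hR.value_eq hv hv₀]
    · push Not at hgap
      obtain ⟨x, hx1, hx2⟩ := hgap
      rw [Nat.succ_mul, add_comm]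
      -- The offending `g x` exceeds `(1 / 2) ^ s` old residues; as `3 < 2 ^ 2`, it is at least
      -- three new residues. Large quantities stay large while the residue shrinks, so at most `M`
      -- repairs are needed.
      refine (reach_shrink a (s + 2) hP hR).bind hP ?_
      rintro P' hP' hne ⟨A, R', hA, hAR⟩
      refine (ih hne hA.kn' (fun x v hv w hw => hg x v (hP' hv) w (hP' hw)) fun v hv => ?_).imp
        hne ?_
      · have hlt : {x | g x v < 3 * (v (a (ag x))).value R'}.ncard <
            {x | g x v < 3 * (v (a (ag x))).value R}.ncard := by
          refine Set.ncard_lt_ncard ((Set.ssubset_iff_of_subset fun y hy => ?_).2 ⟨x, ?_, ?_⟩)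
            (Set.toFinite _)
          · have := (v (a (ag y))).value_mono hA.kn'.reg hR.reg hA.subset'
            rw [Set.mem_ofPred_eq] at hy ⊢
            linarith
          · rw [Set.mem_ofPred_eq, hg x v (hP' hv) v₀ hv₀, hR.value_eq (hP' hv) hv₀]
            exact hx2
          · rw [Set.mem_ofPred_eq, not_lt, hg x v (hP' hv) v₀ hv₀]
            refine le_trans ?_ hx1.le
            have h1 := hAR v hv (ag x)
            rw [hR.value_eq (hP' hv) hv₀, pow_add] at h1
            have h2 : 0 ≤ (1 / 2 : ℝ) ^ s * (v₀ (a (ag x))).value R :=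
              mul_nonneg (by positivity) ((v₀ (a (ag x))).value_nonneg hR.reg)
            linarith
        have := hM v (hP' hv)
        omega
      · rintro P'' hP'' - ⟨B, R'', hB, hBx⟩
        exact ⟨_, R'', (hA.anti hP'').trans hB, hBx⟩

/-- A sequence of envy-free partial allocations with the same cutter. -/
theorem reach_rounds (a : ι → Fin n) (r : ι) (N : ℕ) (hP : P.Nonempty) (hR : Kn P R) :
    Reach (fun P' => ∃ (A : ℕ → ι → Set Cake) (Rs : ℕ → Set Cake), Rs 0 = R ∧
      ∀ t < N, EFPart a P' (Rs t) (A t) (Rs (t + 1)) ∧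
        ∀ v ∈ P', Fintype.card ι * (v (a r)).value (A t r) = (v (a r)).value (Rs t))
      (N * roundCost (Fintype.card ι)) P := by
  refine (Reach.iterate (σ := (ι → Set Cake) × Set Cake) (fun P s => Kn P s.2)
    (fun P s s' => EFPart a P s.2 s'.1 s'.2 ∧
      ∀ v ∈ P, Fintype.card ι * (v (a r)).value (s'.1 r) = (v (a r)).value s.2)
    (fun P P' s s' hP h => ⟨h.1.anti hP, fun v hv => h.2 v (hP hv)⟩) (fun P s hP hs => ?_) N
    (s := (fun _ => ∅, R)) hP hR).imp hP ?_
  · refine (reach_round a r hP hs).imp hP ?_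
    rintro P' - - ⟨A, R', hA, hAr⟩
    exact ⟨(A, R'), hA.kn', hA, hAr⟩
  · rintro P' - - ⟨S, h0, -, hS⟩
    exact ⟨fun t => (S (t + 1)).1, fun t => (S t).2, by simp [h0], hS⟩

/-- Agent `i` makes `2 * k ^ 2` equal parts. The relative values of all parts for all agents add up
to `k`, so for some part the sum over the agents is at most `1 / (2 * k)`. -/
theorem reach_crumb_single (a : ι → Fin n) (i : ι) (hP : P.Nonempty) (hR : Kn P R)
    (hpos : ∀ v ∈ P, ∀ i, 0 < (v (a i)).value R) :
    Reach (fun P' => ∃ F ⊆ R, Kn P' F ∧ ∀ v ∈ P',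
      2 * Fintype.card ι ^ 2 * (v (a i)).value F = (v (a i)).value R ∧
      ∀ l, 2 * Fintype.card ι * (v (a l)).value F ≤ (v (a l)).value R)
      (2 * Fintype.card ι ^ 2) P := by
  have hk : 0 < Fintype.card ι := Fintype.card_pos_iff.2 ⟨i⟩
  have hk' : (0 : ℝ) < Fintype.card ι := by exact_mod_cast hk
  have : NeZero (2 * Fintype.card ι ^ 2) := ⟨by positivity⟩
  refine ((reach_equalCut (Fin (2 * Fintype.card ι ^ 2)) (a i) hP hR).mono (by simp)).imp hP ?_
  rintro P' hP' ⟨v₀, hv₀⟩ ⟨E, hE, hEd, hEu, hEv⟩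
  have hsum : ∑ j, ∑ l, (v₀ (a l)).value (E j) / (v₀ (a l)).value R ≤
      ∑ _j : Fin (2 * Fintype.card ι ^ 2), 1 / (2 * Fintype.card ι : ℝ) := by
    rw [Finset.sum_comm]
    have : ∀ l, ∑ j, (v₀ (a l)).value (E j) / (v₀ (a l)).value R = 1 := fun l => by
      rw [← Finset.sum_div, ← (v₀ (a l)).value_iUnion (fun j => (hE j).reg) hEd, hEu,
        div_self (hpos v₀ (hP' hv₀) l).ne']
    simp_rw [this]
    simp only [Finset.sum_const, Finset.card_univ, Fintype.card_fin, nsmul_eq_mul, mul_one]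
    push_cast
    apply le_of_eq
    field_simp
  obtain ⟨j, -, hj⟩ := Finset.exists_le_of_sum_le Finset.univ_nonempty hsum
  refine ⟨E j, hEu ▸ Set.subset_iUnion E j, hE j, fun v hv => ⟨?_, fun l => ?_⟩⟩
  · rw [← hEv v hv j]
    simp
  · rw [(hE j).value_eq hv hv₀, hR.value_eq (hP' hv) (hP' hv₀)]
    have h1 : (v₀ (a l)).value (E j) / (v₀ (a l)).value R ≤ 1 / (2 * Fintype.card ι : ℝ) := by
      refine le_trans (Finset.single_le_sum
        (f := fun l => (v₀ (a l)).value (E j) / (v₀ (a l)).value R) (fun l _ => ?_)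
        (Finset.mem_univ l)) hj
      exact div_nonneg ((v₀ (a l)).value_nonneg (hE j).reg) (hpos v₀ (hP' hv₀) l).le
    rw [div_le_div_iff₀ (hpos v₀ (hP' hv₀) l) (by positivity)] at h1
    linarith

/-- All agents agree that a part of the region is neither too small nor too large. -/
theorem reach_crumb (a : ι → Fin n) (hP : P.Nonempty) (hR : Kn P R)
    (hpos : ∀ v ∈ P, ∀ i, 0 < (v (a i)).value R) :
    Reach (fun P' => ∃ R' ⊆ R, Kn P' R' ∧ ∀ v ∈ P', ∀ i,
      (v (a i)).value R ≤ 2 * Fintype.card ι ^ 2 * (v (a i)).value R' ∧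
      2 * (v (a i)).value R' ≤ (v (a i)).value R)
      (Fintype.card ι * (2 * Fintype.card ι ^ 2)) P := by
  refine (Reach.forall_finset (σ := Unit) (Finset.univ : Finset ι)
    (fun P _ => Kn P R ∧ ∀ v ∈ P, ∀ i, 0 < (v (a i)).value R) (fun _ _ => True) (fun _ => trivial)
    (fun _ _ _ _ _ => trivial) (fun i P _ => ∃ F ⊆ R, Kn P F ∧ ∀ v ∈ P,
      2 * Fintype.card ι ^ 2 * (v (a i)).value F = (v (a i)).value R ∧
      ∀ l, 2 * Fintype.card ι * (v (a l)).value F ≤ (v (a l)).value R) ?_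
      (2 * Fintype.card ι ^ 2) ?_ P () hP ⟨hR, hpos⟩).imp hP ?_
  · rintro i P P' _ _ hP - ⟨F, h1, h2, h3⟩
    exact ⟨F, h1, h2.anti hP, fun v hv => h3 v (hP hv)⟩
  · rintro i - P _ hP ⟨hR, hpos⟩
    refine (reach_crumb_single a i hP hR hpos).imp hP ?_
    rintro P' hP' - h
    exact ⟨(), trivial, ⟨hR.anti hP', fun v hv => hpos v (hP' hv)⟩, h⟩
  · rintro P' hP' - ⟨-, -, -, h⟩
    choose F h1 h2 h3 using fun i => h i (Finset.mem_univ i)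
    -- Everyone finds her own part in the union, worth `1 / (2 * k ^ 2)` of the region to her. None
    -- of the `k` parts is worth more than `1 / (2 * k)` to anyone, so the union is worth at most
    -- one half.
    refine ⟨⋃ i, F i, Set.iUnion_subset h1, Kn.iUnion h2, fun v hv i => ⟨?_, ?_⟩⟩
    · rw [← (h3 i v hv).1]
      exact mul_le_mul_of_nonneg_left ((v (a i)).value_mono (h2 i).reg (Kn.iUnion h2).reg
        (Set.subset_iUnion F i)) (by positivity)
    · have hk' : (0 : ℝ) < Fintype.card ι := by
        exact_mod_cast Fintype.card_pos_iff.2 ⟨i⟩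
      have hle : (v (a i)).value (⋃ j, F j) ≤ ∑ j, (v (a i)).value (F j) :=
        (v (a i)).value_iUnion_le fun j => (h2 j).reg
      have h4 : ∑ j, 2 * Fintype.card ι * (v (a i)).value (F j) ≤ ∑ _j : ι, (v (a i)).value R :=
        Finset.sum_le_sum fun j _ => (h3 j v hv).2 i
      rw [← Finset.mul_sum, Finset.sum_const, Finset.card_univ, nsmul_eq_mul] at h4
      have h5 : Fintype.card ι * (2 * ∑ j, (v (a i)).value (F j)) ≤
          Fintype.card ι * (v (a i)).value R := by linarith
      have h6 := le_of_mul_le_mul_left h5 hk'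
      linarith

/-- A decreasing sequence of regions such that the differences of successive regions are small in
comparison with the earlier differences. -/
theorem reach_crumbs (a : ι → Fin n) (T : ℕ) (hP : P.Nonempty) (hR : Kn P R)
    (hpos : ∀ v ∈ P, ∀ i, 0 < (v (a i)).value R) :
    Reach (fun P' => ∃ Cs : ℕ → Set Cake, Cs 0 = R ∧ Antitone Cs ∧ (∀ t, Kn P' (Cs t)) ∧
      ∀ v ∈ P', ∀ i, (∀ t < T, 2 * (v (a i)).value (Cs (t + 1)) ≤ (v (a i)).value (Cs t)) ∧
        (v (a i)).value R ≤ (2 * Fintype.card ι ^ 2) ^ T * (v (a i)).value (Cs T))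
      (T * (Fintype.card ι * (2 * Fintype.card ι ^ 2))) P := by
  refine (Reach.iterate (fun P s => Kn P s ∧ ∀ v ∈ P, ∀ i, 0 < (v (a i)).value s)
    (fun P s s' => Kn P s ∧ s' ⊆ s ∧ ∀ v ∈ P, ∀ i,
      (v (a i)).value s ≤ 2 * Fintype.card ι ^ 2 * (v (a i)).value s' ∧
      2 * (v (a i)).value s' ≤ (v (a i)).value s)
    (fun P P' s s' hP h => ⟨h.1.anti hP, h.2.1, fun v hv => h.2.2 v (hP hv)⟩)
    (fun P s hP hs => ?_) T hP ⟨hR, hpos⟩).imp hP ?_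
  · refine (reach_crumb a hP hs.1 hs.2).imp hP ?_
    rintro P' hP' - ⟨R', h1, h2, h3⟩
    refine ⟨R', ⟨h2, fun v hv i => ?_⟩, hs.1.anti hP', h1, h3⟩
    by_contra hcon
    have h4 := (h3 v hv i).1
    have h5 := hs.2 v (hP' hv) i
    have h6 := mul_nonpos_of_nonneg_of_nonpos
      (by positivity : (0 : ℝ) ≤ 2 * Fintype.card ι ^ 2) (not_lt.1 hcon)
    linarith
  · rintro P' - - ⟨S, h0, hT, hS⟩
    -- The sequence is made constant from `T` on, so that it is antitone on all of `ℕ`.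
    have hmin : ∀ t ≤ T, S (min t T) = S t := fun t ht => by rw [min_eq_left ht]
    refine ⟨fun t => S (min t T), by simp [h0], antitone_nat_of_succ_le fun t => ?_, fun t => ?_,
      fun v hv i => ⟨fun t ht => ?_, ?_⟩⟩
    · rcases Nat.lt_or_ge t T with h | h
      · rw [hmin t h.le, hmin (t + 1) h]
        exact (hS t h).2.1
      · rw [min_eq_right h, min_eq_right (h.trans (Nat.le_succ t))]
    · simp only
      rcases Nat.lt_or_ge t T with h | h
      · rw [hmin t h.le]; exact (hS t h).1
      · rw [min_eq_right h]; exact hT.1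
    · simp only
      rw [hmin t ht.le, hmin (t + 1) ht]
      exact ((hS t ht).2.2 v hv i).2
    · have key : ∀ t ≤ T, (v (a i)).value R ≤
          (2 * Fintype.card ι ^ 2) ^ t * (v (a i)).value (S t) := by
        intro t
        induction t with
        | zero => intro _; simp [h0]
        | succ t ih =>
          intro ht
          refine (ih (by omega)).trans ?_
          rw [pow_succ (2 * (Fintype.card ι : ℝ) ^ 2) t, mul_assoc]
          exact mul_le_mul_of_nonneg_left ((hS t ht).2.2 v hv i).1 (by positivity)
      simpa using key T le_rfl

theorem AgentValuation.value_sdiff (v : AgentValuation) {X Y : Set Cake} (h : Reg X) (h' : Reg Y)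
    (hs : Y ⊆ X) : v.value (X \ Y) = v.value X - v.value Y := by
  have := v.value_union h' (h.diff h') Set.disjoint_sdiff_right
  rw [Set.union_sdiff_cancel hs] at this
  linarith

/-! ### Slots padded with crumbs -/

section Layers

variable {ι : Type*}

/-- The layers of a slot: its bundle, followed by crumbs. The outer layers of all slots come
earlier in the sequence of the crumbs than the inner layers. -/
def crumbLayer {k : ℕ} (e : ι ≃ Fin k) (B : ι → Set Cake) (Cs : ℕ → Set Cake) (p : ι) (l : ℕ) :
    Set Cake :=
  if l = 0 then B p
  else if l ≤ k then Cs ((k - l) * k + e p) \ Cs ((k - l) * k + e p + 1)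
  else ∅

variable {k : ℕ} {e : ι ≃ Fin k} {B : ι → Set Cake} {Cs : ℕ → Set Cake}

theorem crumbLayer_zero (p : ι) : crumbLayer e B Cs p 0 = B p := if_pos rfl

theorem crumbLayer_of_pos (p : ι) {l : ℕ} (h : 0 < l) (h' : l ≤ k) : crumbLayer e B Cs p l =
    Cs ((k - l) * k + e p) \ Cs ((k - l) * k + e p + 1) := by
  rw [crumbLayer, if_neg h.ne', if_pos h']

theorem kn_crumbLayer {P : Set (Prof n)} (hB : ∀ p, Kn P (B p)) (hC : ∀ t, Kn P (Cs t)) (p : ι)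
    (l : ℕ) : Kn P (crumbLayer e B Cs p l) := by
  rw [crumbLayer]
  split_ifs
  exacts [hB p, (hC _).sdiff (hC _), kn_empty]

theorem disjoint_crumb (hC : Antitone Cs) {x y : ℕ} (h : x ≠ y) :
    Disjoint (Cs x \ Cs (x + 1)) (Cs y \ Cs (y + 1)) := by
  wlog hxy : x < y generalizing x y
  · exact (this h.symm (by omega)).symm
  · exact Set.disjoint_left.2 fun z hz hz' => hz.2 (hC hxy hz'.1)

theorem crumbLayer_subset (hC : Antitone Cs) (p : ι) {l : ℕ} (h : 0 < l) :
    crumbLayer e B Cs p l ⊆ Cs 0 := by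
  rw [crumbLayer, if_neg h.ne']
  split_ifs
  · exact Set.sdiff_subset.trans (hC (Nat.zero_le _))
  · exact Set.empty_subset _

theorem disjoint_crumbLayer (hC : Antitone Cs) (hB : ∀ p q, p ≠ q → Disjoint (B p) (B q))
    (hBC : ∀ p, Disjoint (B p) (Cs 0)) {p q : ι} {l l' : ℕ} (h : p ≠ q ∨ l ≠ l') :
    Disjoint (crumbLayer e B Cs p l) (crumbLayer e B Cs q l') := by
  rcases Nat.eq_zero_or_pos l with rfl | hl <;> rcases Nat.eq_zero_or_pos l' with rfl | hl'
  · simp only [crumbLayer_zero]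
    exact hB p q (h.resolve_right fun h => h rfl)
  · rw [crumbLayer_zero]
    exact (hBC p).mono_right (crumbLayer_subset hC q hl')
  · rw [crumbLayer_zero]
    exact ((hBC q).mono_right (crumbLayer_subset hC p hl)).symm
  · rw [crumbLayer, if_neg hl.ne', crumbLayer, if_neg hl'.ne']
    split_ifs with h1 h2
    · apply disjoint_crumb hC
      intro heq
      have hp := (e p).2
      have hq := (e q).2
      -- The index of a crumb has the digits `k - l` and `e p` in base `k`.
      have e1 : (k - l) = (k - l') := by
        have := congrArg (· / k) heq
        simpa [Nat.add_div_of_dvd_right, Nat.div_eq_of_lt hp, Nat.div_eq_of_lt hq,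
          Nat.mul_div_cancel _ (lt_of_le_of_lt (Nat.zero_le _) hp), mul_comm _ k,
          Nat.mul_add_div (lt_of_le_of_lt (Nat.zero_le _) hp)] using this
      rw [e1] at heq
      have e2 : e p = e q := Fin.ext (by omega)
      rcases h with h | h
      · exact h (e.injective e2)
      · omega
    · exact Set.disjoint_empty _
    · exact Set.empty_disjoint _
    · exact Set.empty_disjoint _

/-- If every agent finds the bundle of her slot almost best, then trimming along the layers does
not touch the bundles. -/
theorem bundle_subset_of_crumbs [Fintype ι] (u : ι → AgentValuation) (hk : Fintype.card ι = k)
    (hB : ∀ p, Reg (B p)) (hCs : ∀ t, Reg (Cs t)) (hC : Antitone Cs)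
    (hBC : ∀ p, Disjoint (B p) (Cs 0))
    (hhalf : ∀ i, ∀ t < k * k, 2 * (u i).value (Cs (t + 1)) ≤ (u i).value (Cs t))
    (hbest : ∀ i p, (u i).value (B p) < (u i).value (B i) + (u i).value (Cs (k * k)))
    {T : ι → Set Cake} {m : ι → ι} (hm : m.Injective) (hT : ∀ p, Reg (T p))
    (hdich : ∀ p l, (⋃ j ∈ Finset.range l, crumbLayer e B Cs p j) ⊆ T p ∨
      T p ⊆ ⋃ j ∈ Finset.range l, crumbLayer e B Cs p j)
    (hef : ∀ i p, (u i).value (T p) ≤ (u i).value (T (m i)))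
    (hgr : ∀ Q : Set ι, Q ≠ univ →
      (∃ p, p ∉ Q ∧ T p = ⋃ j ∈ Finset.range (k + 1), crumbLayer e B Cs p j) ∨
        ∃ i, m i ∈ Q ∧ ∃ p, p ∉ Q ∧ (u i).value (T p) = (u i).value (T (m i))) (p : ι) :
    B p ⊆ T p := by
  let Q : ℕ → Set ι := fun l => {p | (⋃ j ∈ Finset.range l, crumbLayer e B Cs p j) ⊆ T p}
  have hQ : ∀ {l l'}, l ≤ l' → Q l' ⊆ Q l := fun h p hp =>
    (Set.biUnion_subset_biUnion_left (Finset.coe_subset.2 (Finset.range_mono h))).trans hp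
  -- Let crumb `x` be layer `l` of slot `i`. All crumbs in layers below `l` come later in the
  -- sequence. For agent `i`, crumb `x` is worth at least all later crumbs and the unused remainder
  -- `Cs (k * k)` together, and by `hbest` this remainder exceeds any advantage of `B p` over `B i`.
  -- So she strictly prefers `T i` to a piece that lacks layer `l` entirely.
  have key : ∀ l, 0 < l → l ≤ k → ∀ i p, i ∈ Q (l + 1) → (u i).value (T i) ≤ (u i).value (T p) →
      p ∈ Q l := by
    intro l hl hlk i p hi hle
    by_contra hp
    have hTp := (hdich p l).resolve_left hp
    have hx : ((k - l) * k + e i) < k * k := by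
      have h1 : (k - l + 1) * k ≤ k * k := Nat.mul_le_mul_right k (by omega)
      rw [Nat.succ_mul] at h1
      have := (e i).2
      omega
    generalize hxdef : (k - l) * k + e i = x at hx
    have hsub : T p ⊆ B p ∪ (Cs (x + 1) \ Cs (k * k)) := by
      refine hTp.trans (Set.iUnion₂_subset fun l' hl' => ?_)
      rw [Finset.mem_range] at hl'
      rcases Nat.eq_zero_or_pos l' with rfl | hl'0
      · rw [crumbLayer_zero]; exact Set.subset_union_left
      · rw [crumbLayer_of_pos p hl'0 (by omega)]
        have h1 : (k - l + 1) * k ≤ (k - l') * k := Nat.mul_le_mul_right k (by omega)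
        have h2 : (k - l' + 1) * k ≤ k * k := Nat.mul_le_mul_right k (by omega)
        rw [Nat.succ_mul] at h1 h2
        have := (e i).2
        have := (e p).2
        exact (Set.sdiff_subset_sdiff (hC (by omega)) (hC (by omega))).trans Set.subset_union_right
    have hsup : B i ∪ (Cs x \ Cs (x + 1)) ⊆ T i := by
      refine Set.union_subset ?_ ?_
      · rw [← crumbLayer_zero (e := e) (B := B) (Cs := Cs) i]
        exact (Set.subset_biUnion_of_mem (u := crumbLayer e B Cs i)
          (Finset.mem_coe.2 (Finset.mem_range.2 (by omega)))).trans hi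
      · rw [← hxdef, ← crumbLayer_of_pos (B := B) i hl hlk]
        exact (Set.subset_biUnion_of_mem (u := crumbLayer e B Cs i)
          (Finset.mem_coe.2 (Finset.mem_range.2 (by omega)))).trans hi
    have r1 : Reg (Cs (x + 1) \ Cs (k * k)) := (hCs _).diff (hCs _)
    have r2 : Reg (Cs x \ Cs (x + 1)) := (hCs _).diff (hCs _)
    have h1 := (u i).value_mono (hT p) ((hB p).union r1) hsub
    have h2 := (u i).value_union_le (hB p) r1
    rw [(u i).value_sdiff (hCs _) (hCs _) (hC hx)] at h2
    have h3 := (u i).value_mono ((hB i).union r2) (hT i) hsup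
    rw [(u i).value_union (hB i) r2 ((hBC i).mono_right
      (Set.sdiff_subset.trans (hC (Nat.zero_le _)))),
      (u i).value_sdiff (hCs _) (hCs _) (hC (Nat.le_succ x))] at h3
    have h4 := hhalf i x hx
    have h5 := hbest i p
    linarith
  have hfin : Q (k + 1 - Fintype.card ι) = univ := by
    -- Each step gives up one layer and gains a slot. Either `m` leads from the current set to a
    -- slot outside, or `m` permutes the set and the graph property yields an agent of the set who
    -- is indifferent between her piece and one outside. After `k` steps only layer 0, the bundle,
    -- is left.
    refine eq_univ_of_growing (fun t => Q (k + 1 - t)) (fun t => hQ (by omega)) fun t ht hne => ?_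
    obtain ⟨l, hl⟩ : ∃ l, k + 1 - t = l + 1 := ⟨k - t, by omega⟩
    have hl' : k + 1 - (t + 1) = l := by omega
    simp only [hl, hl'] at hne ⊢
    by_cases h : ∃ i ∈ Q (l + 1), m i ∉ Q (l + 1)
    · obtain ⟨i, hi, hmi⟩ := h
      exact ⟨m i, hmi, key l (by omega) (by omega) i (m i) hi (hef i i)⟩
    · push Not at h
      have himg : m '' Q (l + 1) = Q (l + 1) :=
        Set.eq_of_subset_of_ncard_le (Set.image_subset_iff.2 h)
          (Set.ncard_image_of_injective _ hm).ge (Set.toFinite _)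
      rcases hgr _ hne with ⟨p, hp, hp'⟩ | ⟨i, hi, p, hp, he⟩
      · exact absurd (hQ (by omega : l + 1 ≤ k + 1) hp'.ge) hp
      · rw [← himg] at hi
        obtain ⟨i', hi', heq⟩ := hi
        obtain rfl := hm heq
        exact ⟨p, hp, key l (by omega) (by omega) i' p hi' ((hef i' i').trans he.ge)⟩
  have hp : p ∈ Q (k + 1 - Fintype.card ι) := hfin ▸ Set.mem_univ p
  rw [hk, Nat.add_sub_cancel_left] at hp
  simpa [Q, crumbLayer_zero] using hp

end Layers

/-! ### Gaining an advantage over a neighbour -/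

section Win

variable {ι : Type*} [Fintype ι]

/-- Compared with receiving her own bundle in all rounds, agent `i` loses at most `N * η` residues
in slot `i`; so only crumbs are trimmed, and the slot assigned to her is no worse than slot `i`.
This excludes a significant loss of her own. Hence a neighbour's slot is worse by three residues,
which covers the loss of `i`, the crumbs of the neighbour and the final residue, each at most one
residue. -/
theorem win_of_trimmed {a : ι → Fin n} {P : Set (Prof n)} {G : SimpleGraph ι} {k N : ℕ}
    {e : ι ≃ Fin k} (hk : Fintype.card ι = k) {A : ℕ → ι → Set Cake} {Rs Cs : ℕ → Set Cake}
    {S : ι → Set Cake} (hA : ∀ t < N, EFPart a P (Rs t) (A t) (Rs (t + 1))) (hR : Kn P (Rs 0))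
    (hS : EFPart a P (Rs N) S (Cs 0)) {η : ℝ} (hη : 0 ≤ η)
    (hη1 : N * η * (2 * k ^ 2) ^ (k * k) < 1)
    (hpos : ∀ v ∈ P, ∀ i, 0 < (v (a i)).value (Cs 0)) {σ : ℕ → Equiv.Perm ι}
    (hσ : ∀ t < N, ∀ i, ∀ v ∈ P, (v (a i)).value (A t i) - (v (a i)).value (A t (σ t i)) ≤
      η * (v (a i)).value (Cs 0))
    (hC : Antitone Cs) (hCs : ∀ t, Kn P (Cs t))
    (hcr : ∀ v ∈ P, ∀ i,
      (∀ t < k * k, 2 * (v (a i)).value (Cs (t + 1)) ≤ (v (a i)).value (Cs t)) ∧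
      (v (a i)).value (Cs 0) ≤ (2 * k ^ 2) ^ (k * k) * (v (a i)).value (Cs (k * k)))
    {B : ι → Set Cake} (hBdef : ∀ p, B p = ⋃ t ∈ Finset.range N, A t (σ t p))
    {T : ι → Set Cake} {m : ι → ι} (hm : m.Injective) (hT : ∀ p, Kn P (T p))
    (hTs : ∀ p, T p ⊆ ⋃ j ∈ Finset.range (k + 1), crumbLayer e B Cs p j)
    (hdich : ∀ p l, (⋃ j ∈ Finset.range l, crumbLayer e B Cs p j) ⊆ T p ∨
      T p ⊆ ⋃ j ∈ Finset.range l, crumbLayer e B Cs p j)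
    (hef : ∀ v ∈ P, ∀ i p, (v (a i)).value (T p) ≤ (v (a i)).value (T (m i)))
    (hgr : ∀ Q : Set ι, Q ≠ univ →
      (∃ p, p ∉ Q ∧ T p = ⋃ j ∈ Finset.range (k + 1), crumbLayer e B Cs p j) ∨
        ∃ i, m i ∈ Q ∧ ∃ p, p ∉ Q ∧ ∀ v ∈ P, (v (a i)).value (T p) = (v (a i)).value (T (m i)))
    (hsig : ∃ t < N, (∃ i, ∀ v ∈ P, 3 * (v (a i)).value (Cs 0) ≤
        (v (a i)).value (A t i) - (v (a i)).value (A t (σ t (m i)))) ∨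
      ∃ i j, G.Adj i j ∧ ∀ v ∈ P, 3 * (v (a i)).value (Cs 0) ≤
        (v (a i)).value (A t i) - (v (a i)).value (A t (σ t (m j))))
    (hP : P.Nonempty) :
    ∃ A' R', EFPart a P (Rs 0) A' R' ∧ ∃ i j, G.Adj i j ∧ ∀ v ∈ P,
      (v (a i)).value (A' j) + (v (a i)).value R' ≤ (v (a i)).value (A' i) := by
  obtain ⟨hB, hBv⟩ := Part.iterate N (fun t ht => (hA t ht).toPart) hR σ
  simp_rw [← hBdef] at hB hBv
  let base : Prof n → ι → ℝ := fun v i => ∑ t ∈ Finset.range N, (v (a i)).value (A t i)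
  have hbase : ∀ v ∈ P, ∀ i p, (v (a i)).value (B p) ≤ base v i := by
    intro v hv i p
    rw [hBv]
    exact Finset.sum_le_sum fun t ht => (hA t (Finset.mem_range.1 ht)).ef v hv i _
  have hbase3 : ∀ v ∈ P, ∀ i p t, t < N → 3 * (v (a i)).value (Cs 0) ≤
      (v (a i)).value (A t i) - (v (a i)).value (A t (σ t p)) →
      (v (a i)).value (B p) ≤ base v i - 3 * (v (a i)).value (Cs 0) := by
    intro v hv i p t ht h
    have h1 : (v (a i)).value (A t i) - (v (a i)).value (A t (σ t p)) ≤
        ∑ t ∈ Finset.range N, ((v (a i)).value (A t i) - (v (a i)).value (A t (σ t p))) :=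
      Finset.single_le_sum
        (f := fun t => (v (a i)).value (A t i) - (v (a i)).value (A t (σ t p)))
        (fun s hs => sub_nonneg.2 ((hA s (Finset.mem_range.1 hs)).ef v hv i _))
        (Finset.mem_range.2 ht)
    rw [Finset.sum_sub_distrib, ← hBv] at h1
    simp only [base]
    linarith
  have hbaseη : ∀ v ∈ P, ∀ i,
      base v i - N * η * (v (a i)).value (Cs 0) ≤ (v (a i)).value (B i) := by
    intro v hv i
    have h1 : ∑ t ∈ Finset.range N, ((v (a i)).value (A t i) - (v (a i)).value (A t (σ t i))) ≤
        ∑ _t ∈ Finset.range N, η * (v (a i)).value (Cs 0) :=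
      Finset.sum_le_sum fun t ht => hσ t (Finset.mem_range.1 ht) i v hv
    rw [Finset.sum_sub_distrib, ← hBv, Finset.sum_const, Finset.card_range, nsmul_eq_mul] at h1
    simp only [base]
    linarith
  have hB0 : ∀ p, Disjoint (B p) (Cs 0) := fun p => (hB.disj' p).mono_right hS.subset'
  have hBT : ∀ p, B p ⊆ T p := by
    obtain ⟨v, hv⟩ := hP
    refine bundle_subset_of_crumbs (e := e) (fun i => v (a i)) hk (fun p => (hB.kn p).reg)
      (fun t => (hCs t).reg) hC hB0 (fun i => (hcr v hv i).1) (fun i p => ?_) hm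
      (fun p => (hT p).reg) hdich (hef v hv) fun Q hQ => ?_
    · have h1 := hbase v hv i p
      have h2 := hbaseη v hv i
      have h3 := hpos v hv i
      have h4 := (hcr v hv i).2
      have h5 : N * η * (v (a i)).value (Cs 0) ≤
          N * η * (2 * k ^ 2) ^ (k * k) * (v (a i)).value (Cs (k * k)) := by
        rw [mul_assoc (N * η)]
        exact mul_le_mul_of_nonneg_left h4 (by positivity)
      have h6 : 0 < (v (a i)).value (Cs (k * k)) := by
        by_contra hcon
        have := mul_nonpos_of_nonneg_of_nonpos
          (by positivity : (0 : ℝ) ≤ (2 * k ^ 2) ^ (k * k)) (not_lt.1 hcon)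
        linarith
      have h7 := mul_lt_mul_of_pos_right hη1 h6
      linarith
    · exact (hgr Q hQ).imp id fun ⟨i, hi, p, hp, h⟩ => ⟨i, hi, p, hp, h v hv⟩
  have hTsub : ∀ p, T p ∩ Cs 0 ⊆ ⋃ j ∈ Finset.Icc 1 k, crumbLayer e B Cs p j := by
    rintro p x ⟨hx, hx0⟩
    obtain ⟨j, hj, hxj⟩ := Set.mem_iUnion₂.1 (hTs p hx)
    rw [Finset.mem_range] at hj
    refine Set.mem_iUnion₂.2 ⟨j, Finset.mem_Icc.2 ⟨?_, by omega⟩, hxj⟩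
    by_contra h
    obtain rfl : j = 0 := by omega
    rw [crumbLayer_zero] at hxj
    exact Set.disjoint_left.1 (hB0 p) hxj hx0
  have hTeq : ∀ p, T p = B p ∪ (T p ∩ Cs 0) := by
    intro p
    refine Set.Subset.antisymm (fun x hx => ?_) (Set.union_subset (hBT p) Set.inter_subset_left)
    obtain ⟨j, -, hxj⟩ := Set.mem_iUnion₂.1 (hTs p hx)
    rcases Nat.eq_zero_or_pos j with rfl | hj
    · rw [crumbLayer_zero] at hxj
      exact Or.inl hxj
    · exact Or.inr ⟨hx, crumbLayer_subset hC p hj hxj⟩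
  have hTv : ∀ (u : AgentValuation) p,
      u.value (T p) = u.value (B p) + u.value (T p ∩ Cs 0) := fun u p => by
    conv_lhs => rw [hTeq p]
    exact u.value_union (hB.kn p).reg ((hT p).inter (hCs 0)).reg
      ((hB0 p).mono_right Set.inter_subset_right)
  let mE : Equiv.Perm ι := Equiv.ofBijective m (Finite.injective_iff_bijective.1 hm)
  have hW : Part P (Rs 0) (fun i => B (m i) ∪ S i) (Cs 0) := (hB.perm mE).trans hS.toPart
  have hW' : Part P (Cs 0) (fun i => T (m i) ∩ Cs 0) (Cs 0 \ ⋃ i, T (m i)) := by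
    refine ⟨fun i => (hT _).inter (hCs 0), (hCs 0).sdiff (Kn.iUnion fun i => hT _),
      fun i j hij => ?_, fun i => ?_, ?_⟩
    · refine Disjoint.mono (hTsub _) (hTsub _) ?_
      simp only [Set.disjoint_iUnion_left, Set.disjoint_iUnion_right]
      intro l hl l' hl'
      exact disjoint_crumbLayer hC hB.disj hB0 (Or.inl (hm.ne hij))
    · exact Set.disjoint_left.2 fun x hx hx' => hx'.2 (Set.mem_iUnion.2 ⟨i, hx.1⟩)
    · rw [← Set.iUnion_inter, Set.inter_comm, Set.inter_union_sdiff]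
  have hval : ∀ (u : AgentValuation) i, u.value (B (m i) ∪ S i ∪ (T (m i) ∩ Cs 0)) =
      u.value (T (m i)) + u.value (S i) := by
    intro u i
    have h1 := hW.value_union hW' u i i
    have h2 := (hB.perm mE).value_union hS.toPart u i i
    have h3 : u.value (B (m i) ∪ S i) = u.value (B (m i)) + u.value (S i) := h2
    rw [h1, h3, hTv]
    ring
  have hTle : ∀ v ∈ P, ∀ i p, (v (a i)).value (T p) ≤
      (v (a i)).value (B p) + (v (a i)).value (Cs 0) := by
    intro v hv i p
    have := (v (a i)).value_mono ((hT p).inter (hCs 0)).reg (hCs 0).reg Set.inter_subset_right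
    rw [hTv]
    linarith
  have hNη : N * η ≤ 1 := by
    rcases Nat.eq_zero_or_pos k with h0 | h0
    · subst h0; simp at hη1; linarith
    · have h1 : (1 : ℝ) ≤ (2 * k ^ 2) ^ (k * k) := by
        apply one_le_pow₀
        have : (1 : ℝ) ≤ k := by exact_mod_cast h0
        nlinarith
      have h2 : (N * η) * 1 ≤ N * η * (2 * k ^ 2) ^ (k * k) :=
        mul_le_mul_of_nonneg_left h1 (by positivity)
      linarith
  have hge : ∀ v ∈ P, ∀ i, base v i - (v (a i)).value (Cs 0) ≤ (v (a i)).value (T (m i)) := by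
    intro v hv i
    have h1 := hbaseη v hv i
    have h2 := hef v hv i i
    have h3 := (v (a i)).value_mono (hB.kn i).reg (hT i).reg (hBT i)
    have h4 := mul_le_mul_of_nonneg_right hNη (hpos v hv i).le
    linarith
  refine ⟨_, _, ⟨hW.trans hW', fun v hv i j => ?_⟩, ?_⟩
  · simp only [hval]
    exact add_le_add (hef v hv i (m j)) (hS.ef v hv i j)
  · obtain ⟨t, ht, ⟨i, hi⟩ | ⟨i, j, hij, h⟩⟩ := hsig
    · obtain ⟨v, hv⟩ := hP
      have h1 := hbase3 v hv i (m i) t ht (hi v hv)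
      have h2 := hTle v hv i (m i)
      have h3 := hge v hv i
      have h4 := hpos v hv i
      linarith
    · refine ⟨i, j, hij, fun v hv => ?_⟩
      simp only [hval]
      have h1 := hbase3 v hv i (m j) t ht (h v hv)
      have h2 := hTle v hv i (m j)
      have h3 := hge v hv i
      have h4 := (v (a i)).value_mono hW'.kn'.reg (hCs 0).reg Set.sdiff_subset
      have h5 := hS.ef v hv i j
      linarith

/-- The number of the allocations whose bundles are permuted. -/
def roundCount (k : ℕ) : ℕ := (k ^ 2 + 1) * k ^ 2

/-- The exponent of the threshold for negligible differences. -/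
def gapExponent (k : ℕ) : ℕ := roundCount k + 2 * k ^ 2 * (k * k)

/-- This dictates `gapExponent`: all negligible losses together must stay below the remainder after
the last crumb, which is at least the fraction `(2 * k ^ 2) ^ (-k ^ 2)` of the residue. -/
theorem roundCount_mul_lt (k : ℕ) :
    roundCount k * (1 / 2 : ℝ) ^ gapExponent k * (2 * k ^ 2) ^ (k * k) < 1 := by
  have h1 : roundCount k < 2 ^ roundCount k := Nat.lt_two_pow_self
  have h2 : (2 * k ^ 2) ^ (k * k) ≤ 2 ^ (2 * k ^ 2 * (k * k)) := by
    rw [pow_mul 2 (2 * k ^ 2)]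
    exact Nat.pow_le_pow_left Nat.lt_two_pow_self.le _
  have h3 : roundCount k * (2 * k ^ 2) ^ (k * k) < 2 ^ gapExponent k := by
    rw [gapExponent, pow_add]
    exact Nat.mul_lt_mul_of_lt_of_le h1 h2 (by positivity)
  have h4 : (roundCount k * (2 * k ^ 2) ^ (k * k) : ℝ) < 2 ^ gapExponent k := by
    exact_mod_cast h3
  rw [one_div, inv_pow, mul_right_comm, ← div_eq_mul_inv, div_lt_one (by positivity)]
  exact h4

/-- The cost of giving some agent a sufficient advantage over a neighbour. -/
def winCost (k : ℕ) : ℕ :=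
  roundCount k * roundCost k +
    (roundCount k * (k * k) * shrinkCost k (gapExponent k) +
      (k * k * (k * (2 * k ^ 2)) + k.factorial * k ^ 3))

/-- There is an envy-free partial allocation in which some agent would not envy one of her
neighbours even if the neighbour received the residue. -/
theorem reach_win (a : ι → Fin n) {G : SimpleGraph ι} (hG : G.Connected)
    (hcard : 1 < Fintype.card ι) {P : Set (Prof n)} (hP : P.Nonempty) {R : Set Cake}
    (hR : Kn P R) :
    Reach (fun P' => ∃ A R', EFPart a P' R A R' ∧ ∃ i j, G.Adj i j ∧ ∀ v ∈ P',
      (v (a i)).value (A j) + (v (a i)).value R' ≤ (v (a i)).value (A i))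
      (winCost (Fintype.card ι)) P := by
  classical
  have : Nontrivial ι := Fintype.one_lt_card_iff_nontrivial.1 hcard
  obtain ⟨r⟩ := hG.nonempty
  have hnb : ∀ i, ∃ j, G.Adj i j := fun i => by
    obtain ⟨j, hj⟩ := exists_ne i
    exact (hG.preconnected i j).elim fun w => by
      cases w with
      | nil => exact absurd rfl hj
      | cons h _ => exact ⟨_, h⟩
  generalize hk : Fintype.card ι = k at hcard ⊢
  set N := roundCount k with hN
  set η : ℝ := (1 / 2) ^ gapExponent k with hη
  have hη0 : 0 ≤ η := by positivity
  have hηN := roundCount_mul_lt k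
  rw [← hη, ← hN] at hηN
  have h1 := reach_rounds a r N hP hR
  rw [hk] at h1
  refine h1.bind hP ?_
  rintro P₁ hP₁ hne₁ ⟨A, Rs, rfl, hA⟩
  replace hR := hR.anti hP₁
  have hRN : Kn P₁ (Rs N) := by
    have := (Part.iterate N (fun t ht => (hA t ht).1.toPart) hR fun _ => 1).1
    exact this.kn'
  -- The quantities are, for all rounds, the advantages of an agent's bundle over the others; they
  -- are measured against one common final residue.
  have h2 := reach_gap a (gapExponent k) (κ := Fin N × ι × ι) (fun x => x.2.1)
    (fun x v => (v (a x.2.1)).value (A x.1 x.2.1) - (v (a x.2.1)).value (A x.1 x.2.2))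
    (Fintype.card (Fin N × ι × ι)) hne₁ hRN
    (fun x v hv w hw => by
      have hx := (hA x.1 x.1.2).1
      rw [(hx.kn x.2.1).value_eq hv hw, (hx.kn x.2.2).value_eq hv hw])
    (fun v hv => by
      rw [← Nat.card_eq_fintype_card]
      exact Set.ncard_le_card _)
  simp only [Fintype.card_prod, Fintype.card_fin, hk] at h2
  refine h2.bind hne₁ ?_
  rintro P₂ hP₂ ⟨v₀, hv₀⟩ ⟨S, R₁, hS, hgap⟩
  replace hA : ∀ t < N, EFPart a P₂ (Rs t) (A t) (Rs (t + 1)) ∧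
      ∀ v ∈ P₂, k * (v (a r)).value (A t r) = (v (a r)).value (Rs t) := fun t ht =>
    ⟨(hA t ht).1.anti hP₂, fun v hv => hk ▸ (hA t ht).2 v (hP₂ hv)⟩
  replace hR := hR.anti hP₂
  -- An agent to whom the residue is worthless has the required advantage over any neighbour.
  -- Otherwise the residue is positive for everyone, as the crumbs require.
  by_cases hzero : ∃ i, (v₀ (a i)).value R₁ = 0
  · obtain ⟨i, hi⟩ := hzero
    obtain ⟨j, hij⟩ := hnb i
    obtain ⟨hB, hBv⟩ := Part.iterate N (fun t ht => (hA t ht).1.toPart) hR fun _ => 1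
    have hef : EFPart a P₂ (Rs 0) (fun i => ⋃ t ∈ Finset.range N, A t i) (Rs N) := by
      refine ⟨hB, fun v hv i j => ?_⟩
      have h3 := hBv (v (a i)) i
      have h4 := hBv (v (a i)) j
      simp only [Equiv.Perm.one_apply] at h3 h4
      rw [h3, h4]
      exact Finset.sum_le_sum fun t ht => (hA t (Finset.mem_range.1 ht)).1.ef v hv i j
    refine Reach.done ⟨_, R₁, hef.trans hS, i, j, hij, fun v hv => ?_⟩
    rw [hS.kn'.value_eq hv hv₀, hi, add_zero]
    exact (hef.trans hS).ef v hv i j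
  push Not at hzero
  have hpos : ∀ v ∈ P₂, ∀ i, 0 < (v (a i)).value R₁ := fun v hv i => by
    rw [hS.kn'.value_eq hv hv₀]
    exact lt_of_le_of_ne ((v₀ (a i)).value_nonneg hS.kn'.reg) (hzero i).symm
  let small : ℕ → ι → ι → Prop := fun t i j =>
    (v₀ (a i)).value (A t i) - (v₀ (a i)).value (A t j) ≤ η * (v₀ (a i)).value R₁
  have hRs : ∀ d t, t + d ≤ N → Rs (t + d) ⊆ Rs t := by
    intro d
    induction d with
    | zero => intro t _; exact le_rfl
    | succ d ih =>
      intro t ht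
      rw [← add_assoc]
      exact (hA (t + d) (by omega)).1.subset'.trans (ih t (by omega))
  -- If all bundles of a round were almost as good for the cutter as her fair share, she would value
  -- what is left after the round at no more than `k * η` final residues, hence at less than one.
  have hcut : ∀ t < N, ∃ j, ¬ small t r j := by
    intro t ht
    by_contra! hcon
    obtain ⟨hAt, hr⟩ := hA t ht
    have h3 := hAt.value (v₀ (a r))
    have h4 : ∑ j, ((v₀ (a r)).value (A t r) - (v₀ (a r)).value (A t j)) ≤
        ∑ _j : ι, η * (v₀ (a r)).value R₁ := Finset.sum_le_sum fun j _ => hcon j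
    rw [Finset.sum_sub_distrib, Finset.sum_const, Finset.sum_const, Finset.card_univ, hk,
      nsmul_eq_mul, nsmul_eq_mul, hr v₀ hv₀] at h4
    have h5 : R₁ ⊆ Rs (t + 1) := hS.subset'.trans (by
      have := hRs (N - (t + 1)) (t + 1) (by omega)
      rwa [Nat.add_sub_cancel' (by omega)] at this)
    have h6 := (v₀ (a r)).value_mono hS.kn'.reg hAt.kn'.reg h5
    have h7 : k * η < 1 := by
      refine lt_of_le_of_lt ?_ hηN
      have hk1 : (1 : ℝ) < k := by exact_mod_cast hcard
      have h8 : (1 : ℝ) ≤ (2 * k ^ 2) ^ (k * k) := one_le_pow₀ (by nlinarith)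
      have h9 : (k : ℝ) ≤ N := by
        have : k ≤ N := by
          rw [hN, roundCount]
          nlinarith [sq_nonneg (k ^ 2)]
        exact_mod_cast this
      calc k * η ≤ N * η := mul_le_mul_of_nonneg_right h9 hη0
        _ = N * η * 1 := (mul_one _).symm
        _ ≤ _ := mul_le_mul_of_nonneg_left h8 (by positivity)
    have h10 := mul_lt_mul_of_pos_right h7 (hpos v₀ hv₀ r)
    linarith
  -- For `t ≥ N` there is no round; the default `{i}` meets the hypotheses as there are at least two
  -- agents.
  obtain ⟨σ, hσ, hσm⟩ := exists_permutations hG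
    (fun t i => {j | j = i ∨ t < N ∧ small t i j}) (fun t i => Or.inl rfl) (fun t => by
      by_cases ht : t < N
      · obtain ⟨j, hj⟩ := hcut t ht
        refine ⟨r, j, ?_⟩
        rintro (rfl | h)
        · apply hj
          simp only [small, sub_self]
          exact mul_nonneg hη0 (hpos v₀ hv₀ j).le
        · exact hj h.2
      · obtain ⟨i, j, hij⟩ := exists_pair_ne ι
        exact ⟨i, j, fun h => h.elim (fun h => hij h.symm) fun h => ht h.1⟩)
  have hlarge : ∀ t < N, ∀ i j, (j = i ∨ t < N ∧ small t i j) ∨ ∀ v ∈ P₂,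
      3 * (v (a i)).value R₁ ≤ (v (a i)).value (A t i) - (v (a i)).value (A t j) := by
    intro t ht i j
    rcases hgap (⟨t, ht⟩, i, j) with h | h
    · exact Or.inl (Or.inr ⟨ht, h v₀ hv₀⟩)
    · exact Or.inr h
  have hsmall : ∀ t < N, ∀ i, ∀ v ∈ P₂,
      (v (a i)).value (A t i) - (v (a i)).value (A t (σ t i)) ≤ η * (v (a i)).value R₁ := by
    intro t ht i v hv
    rcases hσ t i with h | ⟨-, h⟩
    · rw [h, sub_self]
      exact mul_nonneg hη0 (hpos v hv i).le
    · have hAt := (hA t ht).1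
      rw [(hAt.kn i).value_eq hv hv₀, (hAt.kn (σ t i)).value_eq hv hv₀,
        hS.kn'.value_eq hv hv₀]
      exact h
  have h3 := reach_crumbs a (k * k) ⟨v₀, hv₀⟩ hS.kn' hpos
  rw [hk] at h3
  refine h3.bind ⟨v₀, hv₀⟩ ?_
  rintro P₃ hP₃ hne₃ ⟨Cs, rfl, hC, hCs, hcr⟩
  let e : ι ≃ Fin k := Fintype.equivFinOfCardEq hk
  let B : ι → Set Cake := fun p => ⋃ t ∈ Finset.range N, A t (σ t p)
  have hB := (Part.iterate N (fun t ht => ((hA t ht).1.anti hP₃).toPart) (hR.anti hP₃) σ).1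
  have h4 := reach_core_layers a hne₃ (crumbLayer e B Cs) (kn_crumbLayer hB.kn hCs)
    (fun p l l' hl => disjoint_crumbLayer hC hB.disj
      (fun p => (hB.disj' p).mono_right hS.subset') (Or.inr hl)) (k + 1)
  rw [hk] at h4
  refine h4.imp hne₃ ?_
  rintro P₄ hP₄ hne₄ ⟨T, m, hm, hT, hTs, hdich, hef, hgr⟩
  have h43 := hP₄.trans hP₃
  refine win_of_trimmed hk (fun t ht => (hA t ht).1.anti h43) (hR.anti h43) (hS.anti h43) hη0 hηN
    (fun v hv => hpos v (h43 hv)) (fun t ht i v hv => hsmall t ht i v (h43 hv)) hC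
    (fun t => (hCs t).anti hP₄) (fun v hv i => ?_) (fun p => rfl) hm hT hTs hdich hef hgr ?_ hne₄
  · exact hcr v (hP₄ hv) i
  -- By the gap, a difference that is not negligible is at least three residues, so the failure of
  -- tightness is the significant difference sought.
  · obtain ⟨t, ht, hnt⟩ := hσm (Equiv.ofBijective m (Finite.injective_iff_bijective.1 hm))
    rw [hk] at ht
    refine ⟨t, ht, ?_⟩
    by_contra! hcon
    apply hnt
    refine ⟨fun i => ?_, fun i j hij => ?_⟩
    · refine (hlarge t ht i _).resolve_right fun h => ?_
      obtain ⟨v, hv, hlt⟩ := hcon.1 i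
      exact absurd (h v (h43 hv)) (not_le.2 hlt)
    · refine (hlarge t ht i _).resolve_right fun h => ?_
      obtain ⟨v, hv, hlt⟩ := hcon.2 i j hij
      exact absurd (h v (h43 hv)) (not_le.2 hlt)

end Win

/-! ### Cost bounds and the recursion along the tree -/

theorem winCost_mono {k l : ℕ} (h : k ≤ l) : winCost k ≤ winCost l := by
  have hr : ∀ {k l : ℕ}, k ≤ l → roundCount k ≤ roundCount l := fun h => by
    unfold roundCount; gcongr
  have hc : ∀ {k l : ℕ}, k ≤ l → roundCost k ≤ roundCost l := fun h => by
    have := Nat.factorial_le h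
    unfold roundCost; gcongr
  have hs : shrinkCost k (gapExponent k) ≤ shrinkCost l (gapExponent l) := by
    have := hr h
    have := hc h
    unfold shrinkCost gapExponent; gcongr
  have := hr h
  have := hc h
  have := Nat.factorial_le h
  unfold winCost; gcongr

/-- The repairs of gaps dominate: at most `k ^ 5` rounds times `k ^ 2` pairs of bundles, each at
cost `k! * k ^ 13`. Factors 2 are absorbed by powers of `k ≥ 2`. -/
theorem winCost_le {k : ℕ} (hk : 2 ≤ k) : winCost k ≤ k.factorial * k ^ 22 := by
  have hf : 1 ≤ k.factorial := Nat.one_le_iff_ne_zero.2 k.factorial_ne_zero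
  have hp : ∀ a, 2 * k ^ a ≤ k ^ (a + 1) := fun a => by
    rw [pow_succ, mul_comm]; exact Nat.mul_le_mul_left _ hk
  have hq : ∀ {a b}, a ≤ b → k ^ a ≤ k ^ b := fun h => Nat.pow_le_pow_right (by omega) h
  have h1 : roundCost k ≤ k.factorial * k ^ 4 := by
    calc k + k.factorial * k ^ 3 ≤ k.factorial * k ^ 3 + k.factorial * k ^ 3 := by
          gcongr
          calc k = 1 * k ^ 1 := by ring
            _ ≤ k.factorial * k ^ 3 := Nat.mul_le_mul hf (hq (by norm_num))
      _ = k.factorial * (2 * k ^ 3) := by ring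
      _ ≤ k.factorial * k ^ 4 := Nat.mul_le_mul_left _ (hp 3)
  have h2 : roundCount k ≤ k ^ 5 := by
    calc (k ^ 2 + 1) * k ^ 2 ≤ (k ^ 2 + k ^ 2) * k ^ 2 := by
          gcongr; exact Nat.one_le_pow _ _ (by omega)
      _ = 2 * k ^ 4 := by ring
      _ ≤ k ^ 5 := hp 4
  have h3 : gapExponent k + 2 ≤ k ^ 7 := by
    calc roundCount k + 2 * k ^ 2 * (k * k) + 2 ≤ k ^ 5 + k ^ 5 + k ^ 6 := by
          have e1 : 2 * k ^ 2 * (k * k) = 2 * k ^ 4 := by ring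
          have : 2 * k ^ 4 ≤ k ^ 5 := hp 4
          have : 2 ≤ k ^ 6 := (hp 0).trans (hq (by norm_num))
          rw [e1]
          omega
      _ ≤ k ^ 7 := by
          have : 2 * k ^ 5 ≤ k ^ 6 := hp 5
          have : 2 * k ^ 6 ≤ k ^ 7 := hp 6
          omega
  have h4 : shrinkCost k (gapExponent k) ≤ k.factorial * k ^ 13 := by
    calc k * (gapExponent k + 2) * k * roundCost k ≤ k * k ^ 7 * k * (k.factorial * k ^ 4) := by
          gcongr
      _ = k.factorial * k ^ 13 := by ring
  calc winCost k ≤ k ^ 5 * (k.factorial * k ^ 4) + (k ^ 5 * (k * k) * (k.factorial * k ^ 13) +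
        (k * k * (k * (2 * k ^ 2)) + k.factorial * k ^ 3)) := by
        unfold winCost; gcongr
    _ = k.factorial * k ^ 9 + (k.factorial * k ^ 20 + (1 * (2 * k ^ 5) + k.factorial * k ^ 3)) := by
        ring
    _ ≤ k.factorial * k ^ 20 + (k.factorial * k ^ 20 +
        (k.factorial * k ^ 20 + k.factorial * k ^ 20)) := by
        have e1 := hq (show 9 ≤ 20 by norm_num)
        have e2 := hq (show 3 ≤ 20 by norm_num)
        have e3 : 2 * k ^ 5 ≤ k ^ 20 := (hp 5).trans (hq (by norm_num))
        gcongr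
    _ = k.factorial * (2 * (2 * k ^ 20)) := by ring
    _ ≤ k.factorial * k ^ 22 := by
        have : 2 * k ^ 20 ≤ k ^ 21 := hp 20
        have : 2 * k ^ 21 ≤ k ^ 22 := hp 21
        gcongr
        omega

/-- A tree falls apart when an edge is removed: the side of one of the ends. -/
theorem exists_branch {ι : Type*} {G : SimpleGraph ι} (hG : G.IsTree) {i j : ι} (hij : G.Adj i j) :
    ∃ C : Set ι, i ∉ C ∧ (G.induce C).IsTree ∧ ∀ x y, G.Adj x y → x ∉ C → y ∈ C → x = i ∧ y = j := by
  let G' := G.deleteEdges {s(i, j)}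
  let c := G'.connectedComponentMk j
  have hi : i ∉ c.supp := fun h =>
    SimpleGraph.isBridge_iff.1
      (SimpleGraph.isAcyclic_iff_forall_isBridge.1 hG.isAcyclic hij)
      (SimpleGraph.ConnectedComponent.exact h)
  refine ⟨c.supp, hi, ⟨?_, hG.isAcyclic.induce _⟩, fun x y hxy hx hy => ?_⟩
  · refine c.connected_toSimpleGraph.mono ?_
    intro x y h
    exact (G.deleteEdges_le _) h
  · by_contra hne
    have hj : j ∈ c.supp := rfl
    by_cases hxyij : s(x, y) = s(i, j)
    · rcases Sym2.eq_iff.1 hxyij with h | ⟨rfl, rfl⟩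
      · exact hne h
      · exact hx hj
    · have h' : G'.Adj x y := by
        rw [SimpleGraph.deleteEdges_adj]
        exact ⟨hxy, hxyij⟩
      exact hx ((SimpleGraph.ConnectedComponent.sound h'.reachable).trans hy)

/-- A region can be allocated completely without envy between neighbours in a tree. -/
theorem reach_allocation (k : ℕ) : ∀ {ι : Type} [Fintype ι] (a : ι → Fin n) {G : SimpleGraph ι},
    G.IsTree → Fintype.card ι = k → ∀ {P : Set (Prof n)} {R : Set Cake}, P.Nonempty → Kn P R →
    Reach (fun P' => ∃ A : ι → Set Cake, Part P' R A ∅ ∧ ∀ v ∈ P', ∀ i j, G.Adj i j →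
      (v (a i)).value (A j) ≤ (v (a i)).value (A i)) ((k - 1) * winCost k) P := by
  induction k using Nat.strong_induction_on with
  | _ k ih =>
  intro ι _ a G hG hk P R hP hR
  classical
  have hne : Nonempty ι := hG.connected.nonempty
  rcases Nat.lt_or_ge 1 (Fintype.card ι) with h1 | h1
  swap
  · have : Subsingleton ι := Fintype.card_le_one_iff_subsingleton.1 h1
    refine Reach.done ⟨fun _ => R, ⟨fun _ => hR, kn_empty, fun i j h => ?_, by simp, ?_⟩,
      fun v _ i j _ => le_rfl⟩
    · exact absurd (Subsingleton.elim i j) h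
    · rw [Set.union_empty, Set.iUnion_const]
  have h2 := reach_win a hG.connected h1 hP hR
  rw [hk] at h1 h2
  -- One edge is settled now; the branch beyond it has at most `k - 1` vertices, hence at most `k -
  -- 2` edges.
  rw [show (k - 1) * winCost k = winCost k + (k - 2) * winCost k by
    obtain ⟨d, rfl⟩ : ∃ d, k = d + 2 := ⟨k - 2, by omega⟩
    rw [show d + 2 - 1 = d + 1 by omega, Nat.add_sub_cancel]
    ring]
  refine h2.bind hP ?_
  rintro P₁ hP₁ hne₁ ⟨A, R', hA, i, j, hij, hwin⟩
  obtain ⟨C, hiC, hC, hedge⟩ := exists_branch hG hij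
  have hcard : Fintype.card C < k := by
    rw [← hk]
    exact Fintype.card_subtype_lt hiC
  refine ((ih _ hcard (fun x : C => a x) hC rfl hne₁ hA.kn').mono ?_).imp hne₁ ?_
  · exact Nat.mul_le_mul (by omega) (winCost_mono hcard.le)
  rintro P₂ hP₂ hne₂ ⟨B, hB, hBe⟩
  replace hA := hA.anti hP₂
  let B' : ι → Set Cake := fun x => if h : x ∈ C then B ⟨x, h⟩ else ∅
  have hB'C : ∀ x : C, B' x = B x := fun x => dif_pos x.2
  have hB'n : ∀ x, x ∉ C → B' x = ∅ := fun x hx => dif_neg hx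
  have hB' : Part P₂ R' B' ∅ := by
    refine ⟨fun x => ?_, kn_empty, fun x y hxy => ?_, by simp, ?_⟩
    · by_cases hx : x ∈ C
      · rw [hB'C ⟨x, hx⟩]; exact hB.kn _
      · rw [hB'n x hx]; exact kn_empty
    · by_cases hx : x ∈ C
      · by_cases hy : y ∈ C
        · rw [hB'C ⟨x, hx⟩, hB'C ⟨y, hy⟩]
          exact hB.disj _ _ fun h => hxy (congrArg Subtype.val h)
        · rw [hB'n y hy]; exact Set.disjoint_empty _
      · rw [hB'n x hx]; exact Set.empty_disjoint _
    · rw [← hB.union]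
      congr 1
      ext z
      simp only [Set.mem_iUnion]
      constructor
      · rintro ⟨x, hx⟩
        by_cases hxC : x ∈ C
        · exact ⟨⟨x, hxC⟩, by rwa [hB'C ⟨x, hxC⟩] at hx⟩
        · rw [hB'n x hxC] at hx
          exact absurd hx (Set.notMem_empty z)
      · rintro ⟨x, hx⟩
        exact ⟨x, by rwa [hB'C]⟩
  refine ⟨_, hA.toPart.trans hB', fun v hv x y hxy => ?_⟩
  simp only [hA.toPart.value_union hB']
  have hef := hA.ef v hv x y
  have hnn : 0 ≤ (v (a x)).value (B' x) := (v (a x)).value_nonneg (hB'.kn x).reg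
  by_cases hy : y ∈ C
  · by_cases hx : x ∈ C
    · have h3 := hBe v hv ⟨x, hx⟩ ⟨y, hy⟩ hxy
      rw [← hB'C ⟨x, hx⟩, ← hB'C ⟨y, hy⟩] at h3
      exact add_le_add hef h3
    -- This is the only edge into the branch, and its outer end would accept even that the neighbour
    -- received the whole residue.
    · obtain ⟨rfl, rfl⟩ := hedge x y hxy hx hy
      have h3 := hwin v (hP₂ hv)
      have h4 := (v (a x)).value_mono (hB'.kn y).reg hA.kn'.reg (hB'.subset y)
      linarith
  · rw [hB'n y hy, AgentValuation.value_empty]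
    linarith

/-! ### The protocol and its number of queries -/

theorem exists_treeProtocol (n : ℕ) (G : SimpleGraph (Fin n)) : ∃ prot : Protocol n, G.IsTree →
    ∀ (v : Prof n) (q : ℕ) (A : Fin n → Set Cake), Run v prot q A →
      (IsAllocation A ∧ LocallyEnvyFree G v A) ∧ q ≤ (n - 1) * winCost n * (n + 1) := by
  by_cases hG : G.IsTree
  swap
  · exact ⟨Protocol.output fun _ => ∅, fun h => absurd h hG⟩
  rcases isEmpty_or_nonempty (Prof n) with h | h
  · exact ⟨Protocol.output fun _ => ∅, fun _ v => h.elim v⟩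
  have h1 := (reach_allocation n (fun i : Fin n => i) hG (Fintype.card_fin n)
    (Set.univ_nonempty (α := Prof n)) kn_univ).imp Set.univ_nonempty
    (Ψ := fun P' => ∃ A, ∀ v ∈ P', IsAllocation A ∧ LocallyEnvyFree G v A) (by
      rintro P' - - ⟨A, hA, hle⟩
      refine ⟨A, fun v hv => ⟨⟨fun i => (hA.kn i).reg.isPiece, hA.disj, ?_⟩, hle v hv⟩⟩
      rw [← hA.union, Set.union_empty])
  obtain ⟨prot, hprot⟩ := h1.exists_protocol
  exact ⟨prot, fun _ v q A hr => hprot v (Set.mem_univ v) q A hr⟩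

/-- With `ε n = 24 / n` the exponent is `n + 24`: it collects `n! ≤ n ^ n`, the factor `n ^ 22` of
`winCost_le`, and `(n - 1) * (n + 1) ≤ n ^ 2`. For `n = 1` there are no queries. -/
theorem queries_le {n : ℕ} (hn : 0 < n) :
    (((n - 1) * winCost n * (n + 1) : ℕ) : ℝ) ≤ (n : ℝ) ^ ((1 + 24 / (n : ℝ)) * (n : ℝ)) := by
  have hn' : (n : ℝ) ≠ 0 := by positivity
  have e1 : (1 + 24 / (n : ℝ)) * (n : ℝ) = ((n + 24 : ℕ) : ℝ) := by
    push_cast; field_simp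
  rw [e1, Real.rpow_natCast]
  rcases Nat.lt_or_ge 1 n with h | h
  · have h1 : (n - 1) * winCost n * (n + 1) ≤ n ^ (n + 24) := by
      calc (n - 1) * winCost n * (n + 1) = ((n + 1) * (n - 1)) * winCost n := by ring
        _ ≤ n ^ 2 * (n.factorial * n ^ 22) := by
          refine Nat.mul_le_mul ?_ (winCost_le h)
          rw [← Nat.sq_sub_sq n 1]
          exact Nat.sub_le _ _
        _ ≤ n ^ 2 * (n ^ n * n ^ 22) := by
          gcongr
          exact Nat.factorial_le_pow n
        _ = n ^ (n + 24) := by ring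
    exact_mod_cast h1
  · obtain rfl : n = 1 := by omega
    simp

end CakeCutting

theorem mainTheorem1 :
    ∃ (P : (n : ℕ) → SimpleGraph (Fin n) → CakeCutting.Protocol n) (ε : ℕ → ℝ),
      Filter.Tendsto ε Filter.atTop (nhds 0) ∧
      ∀ (n : ℕ) (G : SimpleGraph (Fin n)), G.IsTree →
        ∀ (v : Fin n → CakeCutting.AgentValuation) (q : ℕ) (A : Fin n → Set CakeCutting.Cake),
          CakeCutting.Run v (P n G) q A →
            CakeCutting.IsAllocation A ∧
            CakeCutting.LocallyEnvyFree G v A ∧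
            (q : ℝ) ≤ (n : ℝ) ^ ((1 + ε n) * (n : ℝ)) := by
  choose P hP using CakeCutting.exists_treeProtocol
  refine ⟨P, fun n => 24 / (n : ℝ), tendsto_const_div_atTop_nhds_zero_nat 24,
    fun n G hG v q A hr => ?_⟩
  obtain ⟨⟨h1, h2⟩, h3⟩ := hP n G hG v q A hr
  have : Nonempty (Fin n) := hG.connected.nonempty
  have hn : 0 < n := Fin.pos_iff_nonempty.2 this
  exact ⟨h1, h2, (Nat.cast_le.2 h3).trans (CakeCutting.queries_le hn)⟩
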